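/- Let $m\ge 2$ and $1\le d\le m$ be integers, let $(\xi_i)_{i\ge 1}$ be an i.i.d. sequence of random variables with values in a measurable space $(S,\mathcal S)$, and let $1<r\le 2$. Let $(\mathbb B,\|\cdot\|)$ be a real separable Banach space which is $r$-smooth, i.e. there is an equivalent norm $\|\cdot\|'$ on $\mathbb B$ with $$\sup_{t>0}\ \sup_{\|x\|'=\|y\|'=1}\frac{\|x+ty\|'+\|x-ty\|'-2}{t^r}<\infty .$$ Let $h\colon S^m\to\mathbb B$ be measurable and symmetric (invariant under permutations of its $m$ arguments), and suppose that $h$ is degenerate of order $d$: $h(\xi_1,\dots,\xi_m)$ is integrable, $$\mathbb E[h(\xi_1,\dots,\xi_m)\mid \xi_1,\dots,\xi_{d-1}]=0\ \text{ a.s.}\qquad\text{and}\qquad \mathbb E\big\|\mathbb E[h(\xi_1,\dots,\xi_m)\mid \xi_1,\dots,\xi_d]\big\|\neq 0$$ (for $d=1$ the first condition reads $\mathbb E[h(\xi_1,\dots,\xi_m)]=0$). For $1\le j\le m$ let $$H_{j,r}:=\big(\mathbb E[\|h(\xi_1,\dots,\xi_m)\|^r\mid \xi_1,\dots,\xi_j]\big)^{1/r}\in[0,\infty].$$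 Let $0<\alpha<(r-1)d/r$ and let $\gamma>-1$ be real. Suppose that for every $j\in\{1,\dots,m\}$, $$H_{j,r}\in\mathbb L^{q(d,j,\gamma,r)},\qquad q(d,j,\gamma,r):=\frac{\gamma+j+1}{\max\{d,j\}\frac{r-1}{r}-\alpha+\frac jr}.$$ Then for every $\varepsilon>0$, $$\sum_{N=1}^\infty N^\gamma\,\mathbb P\Big(\sup_{n\ge \max\{N,m\}} n^\alpha\binom nm^{-1}\|U_{m,n}(h)\|>\varepsilon\Big)<\infty,\qquad U_{m,n}(h)=\sum_{1\le i_1<\dots<i_m\le n}h(\xi_{i_1},\dots,\xi_{i_m}).$$ -/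

import Mathlib

open MeasureTheory ProbabilityTheory
open scoped ENNReal

noncomputable section

namespace UStat

/-- A real normed space is `r`-smooth (`1 < r ≤ 2`) if it has an equivalent norm `N` with
`sup_{t > 0} sup_{N x = N y = 1} (N (x + t y) + N (x - t y) - 2) / t ^ r < ∞`. -/
def IsSmoothSpace (B : Type*) [NormedAddCommGroup B] [NormedSpace ℝ B] (r : ℝ) : Prop :=
  1 < r ∧ r ≤ 2 ∧
    ∃ N : Seminorm ℝ B,
      (∃ c C : ℝ, 0 < c ∧ 0 < C ∧ ∀ x, c * ‖x‖ ≤ N x ∧ N x ≤ C * ‖x‖) ∧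
      ∃ K : ℝ, ∀ t : ℝ, 0 < t → ∀ x y : B, N x = 1 → N y = 1 →
        (N (x + t • y) + N (x - t • y) - 2) / t ^ r ≤ K

/-- The kernel is invariant under every permutation of its arguments. -/
def IsSymmKernel {S B : Type*} {m : ℕ} (h : (Fin m → S) → B) : Prop :=
  ∀ (σ : Equiv.Perm (Fin m)) (x : Fin m → S), h (fun k => x (σ k)) = h x

/-- The vector `(ξ_1, …, ξ_k)`; the sequence is indexed from `0`, so that `ξ i` stands for
`ξ_{i+1}`. -/
def initial {Ω S : Type*} (ξ : ℕ → Ω → S) (k : ℕ) (ω : Ω) : Fin k → S :=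
  fun l => ξ l ω

/-- The `σ`-algebra generated by `ξ_1, …, ξ_k` (trivial for `k = 0`). -/
abbrev sigmaInitial {Ω S : Type*} [MeasurableSpace S] (ξ : ℕ → Ω → S) (k : ℕ) :
    MeasurableSpace Ω :=
  MeasurableSpace.comap (initial ξ k) inferInstance

/-- The kernel `h` is degenerate of order `d` with respect to `ξ`: `h (ξ_1, …, ξ_m)` is
integrable, `E[h (ξ_1, …, ξ_m) | ξ_1, …, ξ_{d-1}] = 0` a.s. and
`E ‖E[h (ξ_1, …, ξ_m) | ξ_1, …, ξ_d]‖ ≠ 0`. Meaningful for `1 ≤ d ≤ m`. -/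
def IsDegenerateOfOrder {Ω S B : Type*} [MeasurableSpace Ω] [MeasurableSpace S]
    [NormedAddCommGroup B] [NormedSpace ℝ B] [CompleteSpace B]
    (P : Measure Ω) (ξ : ℕ → Ω → S) {m : ℕ} (h : (Fin m → S) → B) (d : ℕ) : Prop :=
  Integrable (fun ω => h (initial ξ m ω)) P ∧
    P[fun ω => h (initial ξ m ω) | sigmaInitial ξ (d - 1)] =ᵐ[P] 0 ∧
    ∫ ω, ‖(P[fun ω => h (initial ξ m ω) | sigmaInitial ξ d]) ω‖ ∂P ≠ 0

/-- `H_{j,r} = (E[‖h (ξ_1, …, ξ_m)‖ ^ r | ξ_1, …, ξ_j]) ^ (1 / r)`, where the conditional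
expectation of a nonnegative random variable takes values in `[0, ∞]`. -/
def condMoment {Ω S B : Type*} [MeasurableSpace Ω] [MeasurableSpace S]
    [NormedAddCommGroup B] (P : Measure Ω) (ξ : ℕ → Ω → S) {m : ℕ} (h : (Fin m → S) → B)
    (r : ℝ) (j : ℕ) (ω : Ω) : ℝ≥0∞ :=
  ((P⁻[fun ω => ‖h (initial ξ m ω)‖ₑ ^ r | sigmaInitial ξ j]) ω) ^ (1 / r)

/-- The exponent `q (d, j, γ, r)`; `α` is an argument as well. -/
def momentExponent (α : ℝ) (d j : ℕ) (γ r : ℝ) : ℝ :=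
  (γ + j + 1) / ((max d j : ℕ) * ((r - 1) / r) - α + j / r)

open scoped Classical in
/-- The index set of strictly increasing `m`-tuples of elements of `{0, …, n - 1}`. -/
def incIndices (m n : ℕ) : Finset (Fin m → Fin n) :=
  Finset.univ.filter fun i => StrictMono i

/-- The `U`-statistic `U_{m,n}(h) = ∑_{1 ≤ i_1 < ⋯ < i_m ≤ n} h (ξ_{i_1}, …, ξ_{i_m})`. -/
def uStat {Ω S B : Type*} [AddCommMonoid B] (ξ : ℕ → Ω → S) {m : ℕ}
    (h : (Fin m → S) → B) (n : ℕ) (ω : Ω) : B :=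
  ∑ i ∈ incIndices m n, h (fun l => ξ (i l) ω)

end UStat

end

/-! ### Smooth norms: two-point inequality and centred increments -/

namespace UStat

/-! Splitting off the largest index writes a `U`-statistic of order `k + 1` as a sum over `j` of
increments, each a `U`-statistic of order `k` in the strict past with `x_j` inserted (`usum_succ`).
Given the past, the increment has a norm, a conditional `L^r` norm and a conditional mean. These are
again governed by `U`-statistics of order `k`, whose kernels arise by freezing (`kerF`), integrating
in `L^r` (`kerI`) or averaging (`kerA`) one variable. Kernels therefore carry two extra arguments: a
random parameter in `F`, holding frozen variables, and a point of `Y`, over which `L^r` norms are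
taken.

Smoothness enters only through a martingale inequality: the `r`-th moment of a sum of centred
increments is at most a constant times the sum of the `r`-th moments
(`IsSmoothSpace.exists_isMartingaleConst`). It yields the good-`λ` inequality `uTail_two_mul_le`. A
maximum over times up to `N` above `2 * l` forces a frozen kernel above `δ * l` (a union bound costs
`N`), an integrated kernel above `δ * l / N ^ (1 / r)`, an averaged kernel above `δ * l / N`, or a
large martingale part between the passages of `l` and `2 * l`. The last case has probability at most
`C * (2 * δ) ^ r` times that of exceeding `l`. In a geometrically weighted series of tails over the
levels `t / 2 ^ l` this term is absorbed (`uSeries_le`).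

The series of the theorem is dominated by a sum over dyadic horizons `2 ^ b`, with weights `2 ^ (b *
ρ)` and levels proportional to `2 ^ (b * τ)`, where `ρ = γ + 1` and `τ = m - α`
(`exists_tsum_le_uSum`). A recursion step raises `ρ` by `1`, or lowers `τ` by `1 / r` or by `1`
(`uSum_le`). After `j` freezings, `a` integrations and `c` averagings, `j + a + c = m`, no variable
is left. If `a + j < d`, degeneracy makes the remaining kernel vanish. Otherwise a moment of order
`q_j` suffices as soon as `γ + 1 + j ≤ q_j * (m - α - a / r - c)`. The bracket is at least the
denominator of `q_j`, with equality when `a + j = max d j` (`exponentCond_momentExponent`).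

The hypotheses contain no moment for `j = 0`. If `q_1 ≥ r`, they imply that `‖h‖ ^ r` is integrable,
and the recursion runs to order zero (`uSum_lt_top_of_moments`). If `q_1 < r`, the branches that
never freeze a variable stop at order one, where truncation of the kernel replaces the missing
moment (`uSum_order_one_lt_top`, `eventually_uSum_lt_top`). -/

theorem one_add_rpow_le {p r : ℝ} (hp : -1 ≤ p) (hr : 1 ≤ r) (hr2 : r ≤ 2) :
    (1 + p) ^ r ≤ 1 + r * p + p ^ 2 := by
  have h0 : 0 ≤ 1 + p := by linarith
  have h1 : (1 + p) ^ r = (1 + p) * (1 + p) ^ (r - 1) := by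
    conv_rhs => rw [← Real.rpow_one (1 + p), Real.rpow_one]
    rw [mul_comm, ← Real.rpow_add_one' h0 (by linarith)]
    congr 1; ring
  -- Bernoulli's inequality for the exponent `r - 1`, which lies in `[0, 1]`.
  have h2 : (1 + p) ^ (r - 1) ≤ 1 + (r - 1) * p :=
    rpow_one_add_le_one_add_mul_self hp (by linarith) (by linarith)
  rw [h1]
  calc (1 + p) * (1 + p) ^ (r - 1) ≤ (1 + p) * (1 + (r - 1) * p) := by gcongr
    _ ≤ _ := by nlinarith [sq_nonneg p]

/-- A smooth space has an equivalent norm whose `r`-th power satisfies a two-point inequality. -/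
theorem IsSmoothSpace.two_point {B : Type*} [NormedAddCommGroup B] [NormedSpace ℝ B] {r : ℝ}
    (hB : IsSmoothSpace B r) :
    ∃ N : Seminorm ℝ B,
      (∃ c C : ℝ, 0 < c ∧ 0 < C ∧ ∀ x, c * ‖x‖ ≤ N x ∧ N x ≤ C * ‖x‖) ∧
      ∃ K : ℝ, 0 ≤ K ∧ ∀ x y : B, N (x + y) ^ r + N (x - y) ^ r ≤ 2 * N x ^ r + K * N y ^ r := by
  obtain ⟨hr1, hr2, N, ⟨c, C, hc, hC, hN⟩, K0, hK0⟩ := hB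
  -- The summand `10` leaves room: `8` is enough when `N x < N y`, and `2` when `N y ≤ N x`.
  refine ⟨N, ⟨c, C, hc, hC, hN⟩, 2 * max K0 0 + 10, by positivity, fun x y => ?_⟩
  have hr0 : 0 < r := by linarith
  have hz : ∀ x, N x = 0 → x = 0 := by
    intro x hx
    have := (hN x).1
    rw [hx] at this
    have h2 : ‖x‖ ≤ 0 := by
      by_contra h
      push Not at h
      nlinarith [mul_pos hc h]
    simpa using h2
  have hmax : 0 ≤ max K0 0 := le_max_right _ _
  rcases eq_or_lt_of_le (apply_nonneg N x) with hx | hx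
  · have := hz x hx.symm
    subst this
    simp only [zero_add, zero_sub, map_neg_eq_map, map_zero, Real.zero_rpow hr0.ne']
    have : 0 ≤ N y ^ r := Real.rpow_nonneg (apply_nonneg N y) _
    nlinarith [mul_nonneg hmax this]
  rcases eq_or_lt_of_le (apply_nonneg N y) with hy | hy
  · have := hz y hy.symm
    subst this
    simp only [add_zero, sub_zero, map_zero, Real.zero_rpow hr0.ne']
    linarith
  have hyr : 0 < N y ^ r := Real.rpow_pos_of_pos hy r
  have hxr : 0 < N x ^ r := Real.rpow_pos_of_pos hx r
  by_cases hs : N x < N y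
  · have key : ∀ u : B, N u ≤ 2 * N y → N u ^ r ≤ 4 * N y ^ r := by
      intro u hu
      calc N u ^ r ≤ (2 * N y) ^ r := Real.rpow_le_rpow (apply_nonneg N u) hu hr0.le
        _ = 2 ^ r * N y ^ r := Real.mul_rpow (by norm_num) hy.le
        _ ≤ 4 * N y ^ r := by
          gcongr
          calc (2 : ℝ) ^ r ≤ 2 ^ (2 : ℝ) := Real.rpow_le_rpow_of_exponent_le (by norm_num) hr2
            _ = 4 := by norm_num
    have h1 := key (x + y) (by linarith [map_add_le_add N x y])
    have h2 := key (x - y) (by linarith [map_sub_le_add N x y])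
    nlinarith [mul_nonneg hmax hyr.le]
  · push Not at hs
    set s := N y / N x with hsdef
    have hs0 : 0 < s := div_pos hy hx
    have hs1 : s ≤ 1 := (div_le_one hx).2 hs
    set x' := (N x)⁻¹ • x with hx'
    set y' := (N y)⁻¹ • y with hy'
    have hNx' : N x' = 1 := by
      rw [hx', map_smul_eq_mul, Real.norm_of_nonneg (by positivity)]
      field_simp
    have hNy' : N y' = 1 := by
      rw [hy', map_smul_eq_mul, Real.norm_of_nonneg (by positivity)]
      field_simp
    have e1 : x + y = N x • (x' + s • y') := by
      rw [hx', hy', hsdef, smul_add, smul_smul, smul_smul, smul_smul]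
      rw [show N x * (N x)⁻¹ = 1 by field_simp, show N x * (N y / N x) * (N y)⁻¹ = 1 by field_simp]
      simp
    have e2 : x - y = N x • (x' - s • y') := by
      rw [hx', hy', hsdef, smul_sub, smul_smul, smul_smul, smul_smul]
      rw [show N x * (N x)⁻¹ = 1 by field_simp, show N x * (N y / N x) * (N y)⁻¹ = 1 by field_simp]
      simp
    have hsy : N (s • y') = s := by
      rw [map_smul_eq_mul, hNy', Real.norm_of_nonneg hs0.le, mul_one]
    set a := N (x' + s • y') with ha
    set b := N (x' - s • y') with hb
    have ha1 : a ≤ 1 + s := by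
      have := map_add_le_add N x' (s • y'); rw [hNx', hsy] at this; exact this
    have hb1 : b ≤ 1 + s := by
      have := map_sub_le_add N x' (s • y'); rw [hNx', hsy] at this; exact this
    have hab : 2 ≤ a + b := by
      have := map_add_le_add N (x' + s • y') (x' - s • y')
      rw [show (x' + s • y') + (x' - s • y') = (2 : ℝ) • x' by rw [two_smul]; abel,
        map_smul_eq_mul, hNx'] at this
      norm_num at this
      exact this
    have hab2 : a + b - 2 ≤ max K0 0 * s ^ r := by
      have h1 := hK0 s hs0 x' y' hNx' hNy'
      rw [div_le_iff₀ (Real.rpow_pos_of_pos hs0 r)] at h1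
      refine h1.trans ?_
      have := Real.rpow_nonneg hs0.le r
      gcongr
      exact le_max_left _ _
    have ha0 : 0 ≤ a := apply_nonneg N _
    have hb0 : 0 ≤ b := apply_nonneg N _
    have hsr : s ^ 2 ≤ s ^ r := by
      rw [← Real.rpow_natCast]
      exact Real.rpow_le_rpow_of_exponent_ge hs0 hs1 (by simpa using hr2)
    have pa := one_add_rpow_le (p := a - 1) (by linarith) hr1.le hr2
    have pb := one_add_rpow_le (p := b - 1) (by linarith) hr1.le hr2
    rw [add_sub_cancel] at pa pb
    -- Since `a + b ≥ 2` and both are at most `1 + s`, both are also at least `1 - s`.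
    have qa : (a - 1) ^ 2 ≤ s ^ 2 := by nlinarith
    have qb : (b - 1) ^ 2 ≤ s ^ 2 := by nlinarith
    -- The linear terms of the two expansions combine into `r * (a + b - 2)`, the symmetric
    -- difference that smoothness controls; the quadratic terms are at most `s ^ 2 ≤ s ^ r`.
    have main : a ^ r + b ^ r ≤ 2 + (2 * max K0 0 + 10) * s ^ r := by
      have : r * (a + b - 2) ≤ 2 * (max K0 0 * s ^ r) :=
        mul_le_mul hr2 hab2 (by linarith) (by norm_num)
      nlinarith [Real.rpow_nonneg hs0.le r]
    have f1 : N (x + y) ^ r = N x ^ r * a ^ r := by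
      rw [e1, map_smul_eq_mul, Real.norm_of_nonneg hx.le, Real.mul_rpow hx.le ha0]
    have f2 : N (x - y) ^ r = N x ^ r * b ^ r := by
      rw [e2, map_smul_eq_mul, Real.norm_of_nonneg hx.le, Real.mul_rpow hx.le hb0]
    have f3 : N y ^ r = N x ^ r * s ^ r := by
      rw [← Real.mul_rpow hx.le hs0.le, hsdef]; congr 1; field_simp
    rw [f1, f2, f3]
    nlinarith [mul_le_mul_of_nonneg_left main hxr.le]

theorem convexOn_seminorm_rpow {B : Type*} [NormedAddCommGroup B] [NormedSpace ℝ B]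
    (N : Seminorm ℝ B) {r : ℝ} (hr : 1 ≤ r) : ConvexOn ℝ Set.univ fun x => N x ^ r := by
  refine ⟨convex_univ, fun x _ y _ a b ha hb hab => ?_⟩
  have h1 : N (a • x + b • y) ≤ a • N x + b • N y := N.convexOn.2 trivial trivial ha hb hab
  calc N (a • x + b • y) ^ r ≤ (a • N x + b • N y) ^ r :=
        Real.rpow_le_rpow (apply_nonneg N _) h1 (by linarith)
    _ ≤ a • N x ^ r + b • N y ^ r :=
        (convexOn_rpow hr).2 (apply_nonneg N x) (apply_nonneg N y) ha hb hab

theorem continuous_seminorm_of_le {B : Type*} [NormedAddCommGroup B] [NormedSpace ℝ B]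
    {N : Seminorm ℝ B} {C : ℝ} (hN : ∀ x, N x ≤ C * ‖x‖) : Continuous N := by
  refine Seminorm.continuous_of_continuousAt_zero ?_
  rw [ContinuousAt, map_zero]
  refine squeeze_zero (fun x => apply_nonneg N x) hN ?_
  have : Continuous fun x : B => C * ‖x‖ := by fun_prop
  simpa using this.tendsto 0

/-- Adding a centred increment to a point raises the `r`-th moment of a smooth norm by at most
a constant multiple of the `r`-th moment of the increment. -/
theorem lintegral_seminorm_add_centered_le {B Z : Type*} [NormedAddCommGroup B] [NormedSpace ℝ B]
    [CompleteSpace B] [MeasurableSpace Z] {μ : Measure Z} [IsProbabilityMeasure μ] {r : ℝ}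
    (hr : 1 ≤ r)
    {N : Seminorm ℝ B} {C K : ℝ} (hC : 0 < C) (hN : ∀ x, N x ≤ C * ‖x‖) (hK : 0 < K)
    (hNK : ∀ x y : B, N (x + y) ^ r + N (x - y) ^ r ≤ 2 * N x ^ r + K * N y ^ r)
    (a : B) {V : Z → B} (hV : StronglyMeasurable V) :
    ∫⁻ z, ENNReal.ofReal (N (a + (V z - ∫ w, V w ∂μ)) ^ r) ∂μ ≤
      ENNReal.ofReal (N a ^ r) +
        ENNReal.ofReal (K * (2 * C) ^ r) * ∫⁻ z, ‖V z‖ₑ ^ r ∂μ := by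
  have hr0 : 0 < r := by linarith
  by_cases hfin : ∫⁻ z, ‖V z‖ₑ ^ r ∂μ = ∞
  · rw [hfin, ENNReal.mul_top]
    · simp
    · simpa using by positivity
  have hNc := continuous_seminorm_of_le hN
  set e := ∫ w, V w ∂μ with he
  have hVr : MemLp V (ENNReal.ofReal r) μ := by
    refine ⟨hV.aestronglyMeasurable, ?_⟩
    rw [eLpNorm_eq_lintegral_rpow_enorm_toReal (by simpa using hr0) (by simp),
      ENNReal.toReal_ofReal hr0.le]
    exact ENNReal.rpow_lt_top_of_nonneg (by positivity) hfin
  have hVi : Integrable V μ := hVr.integrable (by simpa using hr)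
  have hY : MemLp (fun z => V z - e) (ENNReal.ofReal r) μ := hVr.sub (memLp_const e)
  have hint : ∀ W : Z → B, MemLp W (ENNReal.ofReal r) μ → Integrable (fun z => N (W z) ^ r) μ := by
    intro W hW
    have h1 := hW.integrable_norm_rpow (by simpa using hr0) (by simp)
    rw [ENNReal.toReal_ofReal hr0.le] at h1
    refine (h1.const_mul (C ^ r)).mono'
      ((hNc.rpow_const (fun _ => Or.inr hr0.le)).comp_aestronglyMeasurable hW.1) ?_
    refine Filter.Eventually.of_forall fun z => ?_
    rw [Real.norm_of_nonneg (Real.rpow_nonneg (apply_nonneg N _) _),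
      ← Real.mul_rpow hC.le (norm_nonneg _)]
    exact Real.rpow_le_rpow (apply_nonneg N _) (hN _) hr0.le
  have hA : MemLp (fun z => a + (V z - e)) (ENNReal.ofReal r) μ := (memLp_const a).add hY
  have hS : MemLp (fun z => a - (V z - e)) (ENNReal.ofReal r) μ := (memLp_const a).sub hY
  -- The reflected point `a - (V - e)` has mean `a`, so integrating the two-point inequality leaves
  -- `2 - 1 = 1` as the coefficient of `N a ^ r`. This exact coefficient lets the bound be iterated.
  have jensen : N a ^ r ≤ ∫ z, N (a - (V z - e)) ^ r ∂μ := by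
    have h1 := (convexOn_seminorm_rpow N hr).map_integral_le (μ := μ)
      (f := fun z => a - (V z - e))
      (hNc.rpow_const (fun _ => Or.inr hr0.le)).continuousOn isClosed_univ (by simp)
      (hS.integrable (by simpa using hr)) (hint _ hS)
    have h2 : ∫ z, (a - (V z - e)) ∂μ = a := by
      have i1 : Integrable (fun z => V z - e) μ := hVi.sub (integrable_const _)
      rw [integral_sub (integrable_const _) i1, integral_sub hVi (integrable_const _)]
      simp [he]
    rwa [h2] at h1
  have step : ∫ z, N (a + (V z - e)) ^ r ∂μ ≤ N a ^ r + K * ∫ z, N (V z - e) ^ r ∂μ := by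
    have h1 : ∫ z, N (a + (V z - e)) ^ r ∂μ ≤
        ∫ z, (2 * N a ^ r + K * N (V z - e) ^ r - N (a - (V z - e)) ^ r) ∂μ := by
      refine integral_mono (hint _ hA)
        (((integrable_const _).add ((hint _ hY).const_mul K)).sub (hint _ hS)) fun z => ?_
      have := hNK a (V z - e)
      simp only
      linarith
    have i1 : Integrable (fun z => 2 * N a ^ r + K * N (V z - e) ^ r) μ :=
      (integrable_const _).add ((hint _ hY).const_mul K)
    rw [integral_sub i1 (hint _ hS), integral_add (integrable_const _) ((hint _ hY).const_mul K), integral_const,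
      integral_const_mul] at h1
    simp only [probReal_univ, one_smul] at h1
    linarith
  have cent : ENNReal.ofReal (∫ z, N (V z - e) ^ r ∂μ) ≤
      ENNReal.ofReal ((2 * C) ^ r) * ∫⁻ z, ‖V z‖ₑ ^ r ∂μ := by
    rw [ofReal_integral_eq_lintegral_ofReal (hint _ hY)
      (Filter.Eventually.of_forall fun z => Real.rpow_nonneg (apply_nonneg N _) _)]
    have h1 : ∀ z, ENNReal.ofReal (N (V z - e) ^ r) ≤ ENNReal.ofReal (C ^ r) * ‖V z - e‖ₑ ^ r := by
      intro z
      rw [← ofReal_norm, ENNReal.ofReal_rpow_of_nonneg (norm_nonneg _) hr0.le,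
        ← ENNReal.ofReal_mul (by positivity), ← Real.mul_rpow hC.le (norm_nonneg _)]
      exact ENNReal.ofReal_le_ofReal (Real.rpow_le_rpow (apply_nonneg N _) (hN _) hr0.le)
    -- The norm of the mean is at most the `L^r` norm of `V`, so centring at most doubles that norm;
    -- hence `(2 * C) ^ r`.
    have hle : eLpNorm' (fun z => V z - e) r μ ≤ 2 * eLpNorm' V r μ := by
      have h2 := eLpNorm'_add_le (μ := μ) (f := V) (g := -fun _ : Z => e)
        hV.aestronglyMeasurable aestronglyMeasurable_const.neg hr
      rw [eLpNorm'_neg, ← sub_eq_add_neg] at h2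
      calc eLpNorm' (V - fun _ => e) r μ ≤ eLpNorm' V r μ + eLpNorm' (fun _ : Z => e) r μ := h2
        _ ≤ eLpNorm' V r μ + eLpNorm' V r μ := by
            gcongr
            have : eLpNorm' (fun _ : Z => e) r μ = ‖e‖ₑ := by
              rw [eLpNorm'_const _ hr0]; simp
            rw [this]
            calc ‖e‖ₑ ≤ ∫⁻ z, ‖V z‖ₑ ∂μ := enorm_integral_le_lintegral_enorm _
              _ = eLpNorm' V 1 μ := by simp [eLpNorm']
              _ ≤ eLpNorm' V r μ :=
                eLpNorm'_le_eLpNorm'_of_exponent_le one_pos hr μ hV.aestronglyMeasurable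
        _ = _ := (two_mul _).symm
    have hpow : ∀ W : Z → B, ∫⁻ z, ‖W z‖ₑ ^ r ∂μ = eLpNorm' W r μ ^ r := by
      intro W
      rw [eLpNorm', ← ENNReal.rpow_mul, one_div, inv_mul_cancel₀ hr0.ne', ENNReal.rpow_one]
    calc ∫⁻ z, ENNReal.ofReal (N (V z - e) ^ r) ∂μ
        ≤ ∫⁻ z, ENNReal.ofReal (C ^ r) * ‖V z - e‖ₑ ^ r ∂μ := lintegral_mono h1
      _ = ENNReal.ofReal (C ^ r) * eLpNorm' (fun z => V z - e) r μ ^ r := by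
          rw [lintegral_const_mul' _ _ ENNReal.ofReal_ne_top, hpow]
      _ ≤ ENNReal.ofReal (C ^ r) * (2 * eLpNorm' V r μ) ^ r := by gcongr
      _ = _ := by
          rw [ENNReal.mul_rpow_of_nonneg _ _ hr0.le, ← hpow, ← mul_assoc]
          congr 1
          rw [show (2 : ℝ≥0∞) = ENNReal.ofReal 2 by simp,
            ENNReal.ofReal_rpow_of_nonneg (by norm_num) hr0.le,
            ← ENNReal.ofReal_mul (by positivity), mul_comm, ← Real.mul_rpow (by norm_num) hC.le]
  rw [← ofReal_integral_eq_lintegral_ofReal (hint _ hA)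
      (Filter.Eventually.of_forall fun z => Real.rpow_nonneg (apply_nonneg N _) _)]
  have hnn : 0 ≤ ∫ z, N (V z - e) ^ r ∂μ :=
    integral_nonneg fun z => Real.rpow_nonneg (apply_nonneg N _) _
  calc ENNReal.ofReal (∫ z, N (a + (V z - e)) ^ r ∂μ)
      ≤ ENNReal.ofReal (N a ^ r + K * ∫ z, N (V z - e) ^ r ∂μ) := ENNReal.ofReal_le_ofReal step
    _ = ENNReal.ofReal (N a ^ r) +
          ENNReal.ofReal K * ENNReal.ofReal (∫ z, N (V z - e) ^ r ∂μ) := by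
        rw [ENNReal.ofReal_add (Real.rpow_nonneg (apply_nonneg N _) _) (by positivity),
          ENNReal.ofReal_mul hK.le]
    _ ≤ _ := by
        rw [ENNReal.ofReal_mul hK.le, mul_assoc]
        gcongr

end UStat

/-! ### Laws of i.i.d. sequences and resampling of one coordinate -/

namespace UStat

/-- The law of an i.i.d. sequence with marginal `μ`. -/
noncomputable abbrev seqLaw {S : Type*} [MeasurableSpace S] (μ : Measure S) : Measure (ℕ → S) :=
  Measure.infinitePi fun _ => μ

section

variable {S : Type*} [MeasurableSpace S] (μ : Measure S) [IsProbabilityMeasure μ]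

theorem measurePreserving_seq_comp {ι : Type*} [Fintype ι] {I : ι → ℕ}
    (hI : Function.Injective I) :
    MeasurePreserving (fun x : ℕ → S => fun i => x (I i)) (seqLaw μ)
      (Measure.pi fun _ : ι => μ) :=
  ⟨by fun_prop, by rw [Measure.map_infinitePi_infinitePi_of_inj hI, Measure.infinitePi_eq_pi]⟩

theorem measurePreserving_update (n : ℕ) :
    MeasurePreserving (fun p : (ℕ → S) × S => Function.update p.1 n p.2)
      ((seqLaw μ).prod μ) (seqLaw μ) := by
  have hm : Measurable fun p : (ℕ → S) × S => Function.update p.1 n p.2 := by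
    rw [measurable_pi_iff]
    intro i
    by_cases h : i = n
    · subst h; simpa using measurable_snd
    · simp only [Function.update_of_ne h]; fun_prop
  refine ⟨hm, ?_⟩
  refine Measure.eq_infinitePi _ fun s t ht => ?_
  rw [Measure.map_apply hm (MeasurableSet.pi s.countable_toSet fun i _ => ht i)]
  by_cases hn : n ∈ s
  · have h1 : ((fun p : (ℕ → S) × S => Function.update p.1 n p.2) ⁻¹' (Set.pi s t)) =
        (Set.pi (s.erase n) t) ×ˢ (t n) := by
      ext ⟨x, z⟩
      simp only [Set.mem_preimage, Set.mem_pi, Finset.mem_coe, Set.mem_prod, Finset.mem_erase]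
      constructor
      · intro h
        refine ⟨fun i hi => ?_, ?_⟩
        · have := h i hi.2; rwa [Function.update_of_ne hi.1] at this
        · have := h n hn; rwa [Function.update_self] at this
      · rintro ⟨h, h'⟩ i hi
        by_cases hin : i = n
        · subst hin; rwa [Function.update_self]
        · rw [Function.update_of_ne hin]; exact h i ⟨hin, hi⟩
    rw [h1, Measure.prod_prod, Measure.infinitePi_pi _ (fun i _ => ht i),
      Finset.prod_erase_mul _ _ hn]
  · have h1 : ((fun p : (ℕ → S) × S => Function.update p.1 n p.2) ⁻¹' (Set.pi s t)) =
        (Set.pi s t) ×ˢ Set.univ := by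
      ext ⟨x, z⟩
      simp only [Set.mem_preimage, Set.mem_pi, Finset.mem_coe, Set.mem_prod, Set.mem_univ, and_true]
      refine forall₂_congr fun i hi => ?_
      rw [Function.update_of_ne (by rintro rfl; exact hn hi)]
    rw [h1, Measure.prod_prod, Measure.infinitePi_pi _ (fun i _ => ht i), measure_univ, mul_one]

/-- The substitute for conditioning: integrating out a fresh copy of coordinate `n` plays the role
of the conditional expectation given all other coordinates. -/
theorem lintegral_resample (n : ℕ) {f : (ℕ → S) → ℝ≥0∞} (hf : Measurable f) :
    ∫⁻ x, f x ∂(seqLaw μ) = ∫⁻ x, ∫⁻ z, f (Function.update x n z) ∂μ ∂(seqLaw μ) := by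
  have h := measurePreserving_update μ n
  rw [← h.lintegral_comp hf, lintegral_prod (fun p => f (Function.update p.1 n p.2))
    (hf.comp h.measurable).aemeasurable]

end

/-! ### The martingale inequality in smooth spaces -/

section Martingale

variable {S B : Type*} [MeasurableSpace S] (μ : Measure S) [IsProbabilityMeasure μ]
  [NormedAddCommGroup B] [NormedSpace ℝ B] [CompleteSpace B]
  [TopologicalSpace.SeparableSpace B] [MeasurableSpace B] [BorelSpace B]

open scoped Classical in
/-- The sum of the centred increments `V j (·, x_j)` over the times `j < n` at which the
predictable event `A j` holds. -/
noncomputable def predSum (V : ℕ → (ℕ → S) → S → B) (A : ℕ → Set (ℕ → S)) (n : ℕ) (x : ℕ → S) :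
    B :=
  ∑ j ∈ Finset.range n, if x ∈ A j then V j x (x j) - ∫ z, V j x z ∂μ else 0

variable (B) in
/-- `C` bounds the `r`-th moments of predictable sums of centred increments by the sum of the
`r`-th moments of the increments. -/
def IsMartingaleConst (r C : ℝ) : Prop :=
  ∀ (V : ℕ → (ℕ → S) → S → B) (A : ℕ → Set (ℕ → S)),
    (∀ j, Measurable fun p : (ℕ → S) × S => V j p.1 p.2) → (∀ j, MeasurableSet (A j)) →
    (∀ j n x w z, j ≤ n → V j (Function.update x n w) z = V j x z) →
    (∀ j n x w, j ≤ n → (Function.update x n w ∈ A j ↔ x ∈ A j)) →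
    ∀ n, ∫⁻ x, ‖predSum μ V A n x‖ₑ ^ r ∂(seqLaw μ) ≤
      ENNReal.ofReal C * ∑ j ∈ Finset.range n,
        ∫⁻ x, (A j).indicator (fun x => ∫⁻ z, ‖V j x z‖ₑ ^ r ∂μ) x ∂(seqLaw μ)

/-- Induction on the number of summands. Resampling coordinate `n` leaves the sum up to time `n`
unchanged and makes the new term a centred increment, so its `r`-th moment is simply added, up to a
constant. Passing between `N` and the original norm costs the factor `c⁻¹ ^ r`. -/
theorem IsSmoothSpace.exists_isMartingaleConst {r : ℝ} (hB : IsSmoothSpace B r) :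
    ∃ C : ℝ, 0 < C ∧ IsMartingaleConst B μ r C := by
  classical
  have hr1 : 1 < r := hB.1
  have hr0 : 0 < r := by linarith
  obtain ⟨N, ⟨c, C, hc, hC, hN⟩, K0, hK0, hNK0⟩ := hB.two_point
  set K := K0 + 1 with hK
  have hKpos : 0 < K := by linarith
  have hNK : ∀ x y : B, N (x + y) ^ r + N (x - y) ^ r ≤ 2 * N x ^ r + K * N y ^ r := by
    intro x y
    have := hNK0 x y
    have h2 := Real.rpow_nonneg (apply_nonneg N y) r
    nlinarith
  refine ⟨c⁻¹ ^ r * (K * (2 * C) ^ r), by positivity, fun V A hV hA hVad hAad n => ?_⟩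
  have hNc := continuous_seminorm_of_le fun x => (hN x).2
  have hVm : ∀ j, Measurable fun x : ℕ → S => V j x (x j) := fun j =>
    (hV j).comp (measurable_id.prodMk (measurable_pi_apply j))
  have hVI : ∀ j, Measurable fun x : ℕ → S => ∫ z, V j x z ∂μ := fun j =>
    ((hV j).stronglyMeasurable.integral_prod_right).measurable
  have hTm : ∀ n, Measurable (predSum μ V A n) := by
    intro n
    unfold predSum
    refine Finset.measurable_sum _ fun j _ => ?_
    exact Measurable.ite (hA j) ((hVm j).sub (hVI j)) measurable_const
  have hTad : ∀ m x w, predSum μ V A m (Function.update x m w) = predSum μ V A m x := by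
    intro m x w
    unfold predSum
    refine Finset.sum_congr rfl fun j hj => ?_
    have hjm : j < m := Finset.mem_range.1 hj
    simp only [hAad j m x w hjm.le, hVad j m x w _ hjm.le, Function.update_of_ne hjm.ne]
  have hNm : ∀ n, Measurable fun x => ENNReal.ofReal (N (predSum μ V A n x) ^ r) := fun n =>
    ((hNc.measurable.comp (hTm n)).pow_const r).ennreal_ofReal
  have key : ∀ n, ∫⁻ x, ENNReal.ofReal (N (predSum μ V A n x) ^ r) ∂(seqLaw μ) ≤
      ENNReal.ofReal (K * (2 * C) ^ r) * ∑ j ∈ Finset.range n,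
          ∫⁻ x, (A j).indicator (fun x => ∫⁻ z, ‖V j x z‖ₑ ^ r ∂μ) x ∂(seqLaw μ) := by
    intro n
    induction n with
    | zero => simp [predSum, Real.zero_rpow hr0.ne']
    | succ n ih =>
      rw [lintegral_resample μ n (hNm (n + 1)), Finset.sum_range_succ, mul_add]
      have hI : Measurable ((A n).indicator fun x => ∫⁻ z, ‖V n x z‖ₑ ^ r ∂μ) :=
        Measurable.indicator (((hV n).enorm.pow_const r).lintegral_prod_right') (hA n)
      calc ∫⁻ x, ∫⁻ z, ENNReal.ofReal (N (predSum μ V A (n + 1) (Function.update x n z)) ^ r) ∂μ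
            ∂(seqLaw μ)
          ≤ ∫⁻ x, (ENNReal.ofReal (N (predSum μ V A n x) ^ r) + ENNReal.ofReal (K * (2 * C) ^ r) *
              (A n).indicator (fun x => ∫⁻ z, ‖V n x z‖ₑ ^ r ∂μ) x) ∂(seqLaw μ) := by
            refine lintegral_mono fun x => ?_
            have e : ∀ z, predSum μ V A (n + 1) (Function.update x n z) =
                predSum μ V A n x + if x ∈ A n then V n x z - ∫ w, V n x w ∂μ else 0 := by
              intro z
              have h1 : predSum μ V A (n + 1) (Function.update x n z) =
                  predSum μ V A n (Function.update x n z) +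
                  if Function.update x n z ∈ A n then V n (Function.update x n z)
                    ((Function.update x n z) n) - ∫ w, V n (Function.update x n z) w ∂μ else 0 := by
                unfold predSum
                rw [Finset.sum_range_succ]
              rw [h1, hTad]
              simp only [hAad n n x z le_rfl, hVad n n x z _ le_rfl, Function.update_self]
            simp only [e]
            by_cases hx : x ∈ A n
            · simp only [hx, if_true, Set.indicator_of_mem]
              exact lintegral_seminorm_add_centered_le hr1.le hC (fun x => (hN x).2) hKpos hNK _
                ((hV n).comp measurable_prodMk_left).stronglyMeasurable
            · simp [hx]
        _ = _ := by
            rw [lintegral_add_left (hNm n), lintegral_const_mul _ hI]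
        _ ≤ _ := by gcongr
  calc ∫⁻ x, ‖predSum μ V A n x‖ₑ ^ r ∂(seqLaw μ)
      ≤ ∫⁻ x, ENNReal.ofReal (c⁻¹ ^ r) * ENNReal.ofReal (N (predSum μ V A n x) ^ r)
          ∂(seqLaw μ) := by
        refine lintegral_mono fun x => ?_
        simp only
        rw [← ENNReal.ofReal_mul (by positivity), ← Real.mul_rpow (by positivity)
          (apply_nonneg N _), ← ofReal_norm, ENNReal.ofReal_rpow_of_nonneg (norm_nonneg _) hr0.le]
        refine ENNReal.ofReal_le_ofReal (Real.rpow_le_rpow (norm_nonneg _) ?_ hr0.le)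
        rw [le_inv_mul_iff₀ hc]
        exact (hN _).1
    _ = ENNReal.ofReal (c⁻¹ ^ r) *
          ∫⁻ x, ENNReal.ofReal (N (predSum μ V A n x) ^ r) ∂(seqLaw μ) := by
        rw [lintegral_const_mul _ (hNm n)]
    _ ≤ _ := by
        rw [ENNReal.ofReal_mul (by positivity : (0:ℝ) ≤ c⁻¹ ^ r), mul_assoc]
        gcongr
        exact key n

end Martingale

end UStat

/-! ### U-statistics as iterated sums over decreasing tuples -/

namespace UStat

section Cons

variable {S : Type*} {k : ℕ}

/-- Prepend a coordinate to a vector. -/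
def vcons (z : S) (v : Fin k → S) : Fin (k + 1) → S := Fin.cons z v

@[simp] theorem vcons_zero (z : S) (v : Fin k → S) : vcons z v 0 = z := rfl

@[simp] theorem vcons_succ (z : S) (v : Fin k → S) (i : Fin k) : vcons z v i.succ = v i := rfl

theorem vcons_head_tail (v : Fin (k + 1) → S) : vcons (v 0) (fun i => v i.succ) = v := by
  ext i
  refine Fin.cases ?_ (fun i => ?_) i <;> simp

variable [MeasurableSpace S]

theorem measurable_vcons : Measurable fun p : S × (Fin k → S) => vcons p.1 p.2 := by
  rw [measurable_pi_iff]
  intro i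
  refine Fin.cases ?_ (fun i => ?_) i
  · simpa using measurable_fst
  · simp only [vcons_succ]; fun_prop

@[fun_prop]
theorem Measurable.vcons {α : Type*} [MeasurableSpace α] {f : α → S} {h : α → Fin k → S}
    (hf : Measurable f) (hh : Measurable h) : Measurable fun a => vcons (f a) (h a) :=
  measurable_vcons.comp (hf.prodMk hh)

variable (μ : Measure S) [IsProbabilityMeasure μ]

/-- The law of `k` independent variables with marginal `μ`. -/
noncomputable abbrev vecLaw (μ : Measure S) (k : ℕ) : Measure (Fin k → S) :=
  Measure.pi fun _ : Fin k => μ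

theorem measurePreserving_vcons :
    MeasurePreserving (fun p : S × (Fin k → S) => vcons p.1 p.2) (μ.prod (vecLaw μ k))
      (vecLaw μ (k + 1)) := by
  refine ⟨measurable_vcons, (Measure.pi_eq fun s hs => ?_).symm⟩
  rw [Measure.map_apply measurable_vcons (MeasurableSet.univ_pi hs)]
  have : (fun p : S × (Fin k → S) => vcons p.1 p.2) ⁻¹' Set.univ.pi s =
      s 0 ×ˢ Set.univ.pi fun i : Fin k => s i.succ := by
    ext ⟨z, v⟩
    simp [Set.mem_pi, Fin.forall_fin_succ]
  rw [this, Measure.prod_prod, Measure.pi_pi, Fin.prod_univ_succ]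

theorem lintegral_vecLaw_succ {f : (Fin (k + 1) → S) → ℝ≥0∞} (hf : Measurable f) :
    ∫⁻ v, f v ∂(vecLaw μ (k + 1)) = ∫⁻ z, ∫⁻ v, f (vcons z v) ∂(vecLaw μ k) ∂μ := by
  rw [← (measurePreserving_vcons μ).lintegral_comp hf,
    lintegral_prod (fun p : S × (Fin k → S) => f (vcons p.1 p.2)) (by fun_prop)]

theorem lintegral_vecLaw_zero (f : (Fin 0 → S) → ℝ≥0∞) :
    ∫⁻ v, f v ∂(vecLaw μ 0) = f Fin.elim0 := by
  have : vecLaw μ 0 = Measure.dirac Fin.elim0 := by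
    rw [vecLaw, Measure.pi_of_empty _ Fin.elim0]
  rw [this, lintegral_dirac]

end Cons

section USum

variable {S B : Type*} [AddCommMonoid B] {k : ℕ}

open scoped Classical in
/-- Strictly decreasing `k`-tuples of elements of `{0, …, n - 1}`. -/
noncomputable def decIdx (k n : ℕ) : Finset (Fin k → ℕ) :=
  (Fintype.piFinset fun _ => Finset.range n).filter StrictAnti

theorem mem_decIdx {n : ℕ} {I : Fin k → ℕ} : I ∈ decIdx k n ↔ (∀ i, I i < n) ∧ StrictAnti I := by
  simp [decIdx]

/-- The sum of a kernel over all decreasing tuples of terms among the first `n` of a sequence. -/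
noncomputable def usum (g : (Fin k → S) → B) (n : ℕ) (x : ℕ → S) : B :=
  ∑ I ∈ decIdx k n, g fun l => x (I l)

theorem usum_order_zero (g : (Fin 0 → S) → B) (n : ℕ) (x : ℕ → S) : usum g n x = g Fin.elim0 := by
  have : decIdx 0 n = {Fin.elim0} := by
    ext I
    simp only [mem_decIdx, Finset.mem_singleton]
    exact ⟨fun _ => Subsingleton.elim _ _, fun _ => ⟨fun i => i.elim0, fun i => i.elim0⟩⟩
  rw [usum, this, Finset.sum_singleton]
  congr 1
  exact Subsingleton.elim _ _

theorem strictAnti_cons {j : ℕ} {I : Fin k → ℕ} (hI : StrictAnti I) (h : ∀ i, I i < j) :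
    StrictAnti (Fin.cons j I : Fin (k + 1) → ℕ) := by
  intro a b hab
  induction b using Fin.cases with
  | zero => exact absurd hab (Fin.not_lt_zero a)
  | succ b =>
    induction a using Fin.cases with
    | zero => simpa using h b
    | succ a => simpa using hI (Fin.succ_lt_succ_iff.1 hab)

/-- In a decreasing tuple coordinate `0` carries the latest time, and the other coordinates form a
decreasing tuple strictly before it. -/
theorem usum_succ (g : (Fin (k + 1) → S) → B) (n : ℕ) (x : ℕ → S) :
    usum g n x = ∑ j ∈ Finset.range n, usum (fun v => g (vcons (x j) v)) j x := by
  simp only [usum]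
  rw [Finset.sum_sigma']
  refine Finset.sum_bij' (fun I _ => ⟨I 0, fun i => I i.succ⟩)
    (fun p _ => (Fin.cons p.1 p.2 : Fin (k + 1) → ℕ)) ?_ ?_ ?_ ?_ ?_
  · intro I hI
    rw [mem_decIdx] at hI
    simp only [Finset.mem_sigma, Finset.mem_range, mem_decIdx]
    exact ⟨hI.1 0, fun i => hI.2 (Fin.succ_pos i), fun a b hab => hI.2 (Fin.succ_lt_succ_iff.2 hab)⟩
  · rintro ⟨j, I⟩ hI
    simp only [Finset.mem_sigma, Finset.mem_range, mem_decIdx] at hI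
    rw [mem_decIdx]
    refine ⟨fun i => ?_, strictAnti_cons hI.2.2 hI.2.1⟩
    refine Fin.cases ?_ (fun i => ?_) i
    · simpa using hI.1
    · simpa using (hI.2.1 i).trans hI.1
  · intro I _
    exact vcons_head_tail I
  · rintro ⟨j, I⟩ _
    rfl
  · intro I _
    congr 1
    ext i
    refine Fin.cases ?_ (fun i => ?_) i <;> simp

theorem usum_succ_zero (g : (Fin (k + 1) → S) → B) (x : ℕ → S) : usum g 0 x = 0 := by
  rw [usum_succ]; simp

theorem usum_succ_succ (g : (Fin (k + 1) → S) → B) (n : ℕ) (x : ℕ → S) :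
    usum g (n + 1) x = usum g n x + usum (fun v => g (vcons (x n) v)) n x := by
  rw [usum_succ, usum_succ, Finset.sum_range_succ]

theorem usum_update (g : (Fin k → S) → B) {j n : ℕ} (hjn : j ≤ n) (x : ℕ → S) (w : S) :
    usum g j (Function.update x n w) = usum g j x := by
  refine Finset.sum_congr rfl fun I hI => ?_
  congr 1
  ext l
  rw [Function.update_of_ne]
  exact ((mem_decIdx.1 hI).1 l |>.trans_le hjn).ne

end USum

section Measure

variable {S B : Type*} [MeasurableSpace S] [NormedAddCommGroup B] [NormedSpace ℝ B]
  [TopologicalSpace.SeparableSpace B] [MeasurableSpace B] [BorelSpace B] {k : ℕ}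

@[fun_prop]
theorem measurable_usum {E : Type*} [MeasurableSpace E] {g : E → (Fin k → S) → B} {e : E → ℕ → S}
    (hg : Measurable fun p : E × (Fin k → S) => g p.1 p.2) (he : Measurable e) (n : ℕ) :
    Measurable fun p : E => usum (g p) n (e p) := by
  unfold usum
  refine Finset.measurable_sum _ fun I _ => ?_
  have : Measurable fun p : E => (p, fun l => e p (I l)) := by fun_prop
  exact hg.comp this

variable (μ : Measure S) [IsProbabilityMeasure μ]

/-- Distinct coordinates of the sequence have the product law, so each tuple contributes a null set,
and there are only countably many tuples. -/
theorem ae_forall_decIdx {F : Type*} [MeasurableSpace F] {φ : Measure F} [SFinite φ]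
    {Q : F × (Fin k → S) → Prop} (hQ : ∀ᵐ p ∂(φ.prod (vecLaw μ k)), Q p) :
    ∀ᵐ p ∂(φ.prod (seqLaw μ)), ∀ n, ∀ I ∈ decIdx k n, Q (p.1, fun l => p.2 (I l)) := by
  have h1 : ∀ᵐ p ∂(φ.prod (seqLaw μ)), ∀ I : Fin k → ℕ, StrictAnti I →
      Q (p.1, fun l => p.2 (I l)) := by
    rw [ae_all_iff]
    intro I
    by_cases hI : StrictAnti I
    · have hmp := (MeasurePreserving.id φ).prod (measurePreserving_seq_comp μ hI.injective)
      filter_upwards [hmp.quasiMeasurePreserving.ae hQ] with p hp _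
      exact hp
    · exact Filter.Eventually.of_forall fun p h => absurd h hI
  filter_upwards [h1] with p hp n I hI
  exact hp I (mem_decIdx.1 hI).2

end Measure

/-! ### Freezing, integrating and averaging one variable of a kernel -/

section Kernels

variable {S B F Y : Type*} [MeasurableSpace S] [NormedAddCommGroup B] [NormedSpace ℝ B]
  [MeasurableSpace F] [MeasurableSpace Y] {k : ℕ}

/-- Move the first variable of a kernel to the parameter space. -/
def kerF (g : F × Y × (Fin (k + 1) → S) → B) : (F × S) × Y × (Fin k → S) → B :=
  fun p => g (p.1.1, p.2.1, vcons p.1.2 p.2.2)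

/-- Move the first variable of a kernel to the space over which the `L^r` norm is taken. -/
def kerI (g : F × Y × (Fin (k + 1) → S) → B) : F × (Y × S) × (Fin k → S) → B :=
  fun p => g (p.1, p.2.1.1, vcons p.2.1.2 p.2.2)

/-- Average the first variable of a kernel. -/
noncomputable def kerA (μ : Measure S) (g : F × Y × (Fin (k + 1) → S) → B) :
    F × Y × (Fin k → S) → B :=
  fun p => ∫ z, g (p.1, p.2.1, vcons z p.2.2) ∂μ

/-- The joint law of the parameters and of the variables of a kernel. -/
noncomputable abbrev jointLaw (μ : Measure S) (φ : Measure F) (ν : Measure Y) (k : ℕ) :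
    Measure (F × Y × (Fin k → S)) :=
  φ.prod (ν.prod (vecLaw μ k))

variable (μ : Measure S) [IsProbabilityMeasure μ] (φ : Measure F) [IsProbabilityMeasure φ]
  (ν : Measure Y) [IsProbabilityMeasure ν]

theorem lintegral_jointLaw {f : F × Y × (Fin k → S) → ℝ≥0∞} (hf : Measurable f) :
    ∫⁻ p, f p ∂(jointLaw μ φ ν k) = ∫⁻ a, ∫⁻ y, ∫⁻ v, f (a, y, v) ∂(vecLaw μ k) ∂ν ∂φ := by
  rw [lintegral_prod _ hf.aemeasurable]
  refine lintegral_congr fun a => ?_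
  rw [lintegral_prod _ (by fun_prop)]

theorem lintegral_jointLaw_succ {f : F × Y × (Fin (k + 1) → S) → ℝ≥0∞} (hf : Measurable f) :
    ∫⁻ p, f p ∂(jointLaw μ φ ν (k + 1)) =
      ∫⁻ a, ∫⁻ y, ∫⁻ z, ∫⁻ v, f (a, y, vcons z v) ∂(vecLaw μ k) ∂μ ∂ν ∂φ := by
  rw [lintegral_jointLaw μ φ ν hf]
  refine lintegral_congr fun a => lintegral_congr fun y => ?_
  rw [lintegral_vecLaw_succ μ (by fun_prop)]

theorem measurePreserving_of_lintegral {α β : Type*} [MeasurableSpace α] [MeasurableSpace β]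
    {P : Measure α} {Q : Measure β} {T : α → β} (hT : Measurable T)
    (h : ∀ f : β → ℝ≥0∞, Measurable f → ∫⁻ a, f (T a) ∂P = ∫⁻ b, f b ∂Q) :
    MeasurePreserving T P Q :=
  ⟨hT, Measure.ext_of_lintegral _ fun f hf => by rw [lintegral_map hf hT, h f hf]⟩

/-- Moving coordinate `0` into another factor only reorders independent variables, so this is
Tonelli; the next three statements are of the same kind. -/
theorem measurePreserving_kerF :
    MeasurePreserving (fun p : (F × S) × Y × (Fin k → S) => (p.1.1, p.2.1, vcons p.1.2 p.2.2))
      (jointLaw μ (φ.prod μ) ν k) (jointLaw μ φ ν (k + 1)) := by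
  refine measurePreserving_of_lintegral (by fun_prop) fun f hf => ?_
  rw [lintegral_jointLaw_succ μ φ ν hf,
    lintegral_jointLaw μ (φ.prod μ) ν (f := fun p => f (p.1.1, p.2.1, vcons p.1.2 p.2.2))
      (by fun_prop),
    lintegral_prod _ (Measurable.aemeasurable (by fun_prop))]
  refine lintegral_congr fun a => ?_
  rw [lintegral_lintegral_swap (Measurable.aemeasurable (by fun_prop))]

theorem measurePreserving_kerI :
    MeasurePreserving (fun p : F × (Y × S) × (Fin k → S) => (p.1, p.2.1.1, vcons p.2.1.2 p.2.2))
      (jointLaw μ φ (ν.prod μ) k) (jointLaw μ φ ν (k + 1)) := by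
  refine measurePreserving_of_lintegral (by fun_prop) fun f hf => ?_
  rw [lintegral_jointLaw_succ μ φ ν hf,
    lintegral_jointLaw μ φ (ν.prod μ) (f := fun p => f (p.1, p.2.1.1, vcons p.2.1.2 p.2.2))
      (by fun_prop)]
  refine lintegral_congr fun a => ?_
  rw [lintegral_prod _ (Measurable.aemeasurable (by fun_prop))]

theorem measurePreserving_kerA :
    MeasurePreserving (fun p : (F × Y × (Fin k → S)) × S => (p.1.1, p.1.2.1, vcons p.2 p.1.2.2))
      ((jointLaw μ φ ν k).prod μ) (jointLaw μ φ ν (k + 1)) := by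
  refine measurePreserving_of_lintegral (by fun_prop) fun f hf => ?_
  rw [lintegral_jointLaw_succ μ φ ν hf, lintegral_prod _ (Measurable.aemeasurable (by fun_prop)),
    lintegral_jointLaw μ φ ν (f := fun a => ∫⁻ b, f (a.1, a.2.1, vcons b a.2.2) ∂μ)
      (by fun_prop)]
  refine lintegral_congr fun a => lintegral_congr fun y => ?_
  rw [lintegral_lintegral_swap (Measurable.aemeasurable (by fun_prop))]

theorem measurePreserving_fiber :
    MeasurePreserving (fun p : ((F × (Fin k → S)) × Y) × S => (p.1.1.1, p.1.2, vcons p.2 p.1.1.2))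
      (((φ.prod (vecLaw μ k)).prod ν).prod μ) (jointLaw μ φ ν (k + 1)) := by
  refine measurePreserving_of_lintegral (by fun_prop) fun f hf => ?_
  rw [lintegral_jointLaw_succ μ φ ν hf, lintegral_prod _ (Measurable.aemeasurable (by fun_prop)),
    lintegral_prod _ (Measurable.aemeasurable (by fun_prop)),
    lintegral_prod _ (Measurable.aemeasurable (by fun_prop))]
  refine lintegral_congr fun a => ?_
  rw [lintegral_lintegral_swap (Measurable.aemeasurable (by fun_prop))]
  refine lintegral_congr fun y => ?_
  rw [lintegral_lintegral_swap (Measurable.aemeasurable (by fun_prop))]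

variable {μ φ ν} {g : F × Y × (Fin (k + 1) → S) → B}

theorem integrable_kerF (hg : Integrable g (jointLaw μ φ ν (k + 1))) :
    Integrable (kerF g) (jointLaw μ (φ.prod μ) ν k) :=
  (measurePreserving_kerF μ φ ν).integrable_comp_of_integrable hg

theorem integrable_kerI (hg : Integrable g (jointLaw μ φ ν (k + 1))) :
    Integrable (kerI g) (jointLaw μ φ (ν.prod μ) k) :=
  (measurePreserving_kerI μ φ ν).integrable_comp_of_integrable hg

theorem integrable_kerA (hg : Integrable g (jointLaw μ φ ν (k + 1))) :
    Integrable (kerA μ g) (jointLaw μ φ ν k) :=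
  ((measurePreserving_kerA μ φ ν).integrable_comp_of_integrable hg).integral_prod_left

/-- Identifies the conditional mean of an increment with the `U`-statistic of the averaged kernel.
Only almost everywhere, since Fubini gives integrability of almost all sections. -/
theorem ae_usum_integral [CompleteSpace B] [TopologicalSpace.SeparableSpace B] [MeasurableSpace B]
    [BorelSpace B] (hg : Integrable g (jointLaw μ φ ν (k + 1))) :
    ∀ᵐ p ∂(φ.prod (seqLaw μ)), ∀ n, ∀ᵐ y ∂ν,
      ∫ z, usum (fun v => g (p.1, y, vcons z v)) n p.2 ∂μ =
        usum (fun v => kerA μ g (p.1, y, v)) n p.2 := by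
  have h1 := ((measurePreserving_fiber μ φ ν).integrable_comp_of_integrable hg).prod_right_ae
  have h2 := Measure.ae_ae_of_ae_prod h1
  have h3 := ae_forall_decIdx μ h2
  filter_upwards [h3] with p hp n
  have h4 : ∀ᵐ y ∂ν, ∀ I ∈ decIdx k n,
      Integrable (fun z => g (p.1, y, vcons z fun l => p.2 (I l))) μ := by
    rw [Finset.eventually_all]
    intro I hI
    exact hp n I hI
  filter_upwards [h4] with y hy
  simp only [usum, kerA]
  rw [integral_finsetSum _ hy]

end Kernels

section KernelMeas

variable {S B F Y : Type*} [MeasurableSpace S] [NormedAddCommGroup B] [NormedSpace ℝ B]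
  [MeasurableSpace F] [MeasurableSpace Y] {k : ℕ} [TopologicalSpace.SeparableSpace B]
  [MeasurableSpace B] [BorelSpace B] {g : F × Y × (Fin (k + 1) → S) → B}

theorem measurable_kerF (hg : Measurable g) : Measurable (kerF g) := by
  unfold kerF; fun_prop

theorem measurable_kerI (hg : Measurable g) : Measurable (kerI g) := by
  unfold kerI; fun_prop

theorem measurable_kerA (μ : Measure S) [SFinite μ] (hg : Measurable g) :
    Measurable (kerA μ g) := by
  have h : Measurable fun p : (F × Y × (Fin k → S)) × S => g (p.1.1, p.1.2.1, vcons p.2 p.1.2.2) := by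
    fun_prop
  exact (h.stronglyMeasurable.integral_prod_right).measurable

end KernelMeas

end UStat

/-! ### Passage times of a single path -/

namespace UStat

section Pathwise

variable {Y B : Type*} [MeasurableSpace Y] {ν : Measure Y} [NormedAddCommGroup B]

open scoped Classical in
/-- If a path exceeds `2 * l` while its increments and drifts are small, then the compensated sum
of the increments between the passage times of `l` and `2 * l` is large. -/
theorem le_eLpNorm'_sum_of_passage {r : ℝ} (hr : 1 ≤ r) {u V m : ℕ → Y → B}
    (hum : ∀ n, AEStronglyMeasurable (u n) ν) (hVm : ∀ n, AEStronglyMeasurable (V n) ν)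
    (hmm : ∀ n, AEStronglyMeasurable (m n) ν) (hu0 : u 0 = 0) (hu : ∀ n, u (n + 1) = u n + V n)
    {N : ℕ} {l δ : ℝ} (hl : 0 < l) (hδ : 0 < δ) (hδ4 : δ ≤ 1 / 4)
    (hN : ∃ n ≤ N, ENNReal.ofReal (2 * l) < eLpNorm' (u n) r ν)
    (hV : ∀ j < N, eLpNorm' (V j) r ν ≤ ENNReal.ofReal (δ * l))
    (hm : ∀ j < N, eLpNorm' (m j) r ν ≤ ENNReal.ofReal (δ * l / N)) :
    ENNReal.ofReal (l / 2) ≤ eLpNorm' (fun y => ∑ j ∈ Finset.range N,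
      if (∃ n ≤ j, ENNReal.ofReal l < eLpNorm' (u n) r ν) ∧
        (∀ n ≤ j, eLpNorm' (u n) r ν ≤ ENNReal.ofReal (2 * l)) then V j y - m j y else 0) r ν := by
  have hr0 : 0 < r := by linarith
  have hex : ∃ n, ENNReal.ofReal (2 * l) < eLpNorm' (u n) r ν := ⟨_, hN.choose_spec.2⟩
  -- `τ` is the first passage above `2 * l` and `σ`, below, the first passage above `l`; the
  -- condition in the sum selects exactly the times in `[σ, τ)`.
  set τ := Nat.find hex with hτ
  have hτN : τ ≤ N := (Nat.find_min' hex hN.choose_spec.2).trans hN.choose_spec.1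
  have hτs : ENNReal.ofReal (2 * l) < eLpNorm' (u τ) r ν := Nat.find_spec hex
  have hτl : ∀ n < τ, eLpNorm' (u n) r ν ≤ ENNReal.ofReal (2 * l) := fun n hn =>
    not_lt.1 (Nat.find_min hex hn)
  have hl2 : ENNReal.ofReal l ≤ ENNReal.ofReal (2 * l) := ENNReal.ofReal_le_ofReal (by linarith)
  have hex1 : ∃ n, ENNReal.ofReal l < eLpNorm' (u n) r ν := ⟨τ, hl2.trans_lt hτs⟩
  set σ := Nat.find hex1 with hσ
  have hσs : ENNReal.ofReal l < eLpNorm' (u σ) r ν := Nat.find_spec hex1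
  have hσl : ∀ n < σ, eLpNorm' (u n) r ν ≤ ENNReal.ofReal l := fun n hn =>
    not_lt.1 (Nat.find_min hex1 hn)
  have hστ : σ ≤ τ := Nat.find_min' hex1 (hl2.trans_lt hτs)
  have hcond : ∀ j, ((∃ n ≤ j, ENNReal.ofReal l < eLpNorm' (u n) r ν) ∧
      (∀ n ≤ j, eLpNorm' (u n) r ν ≤ ENNReal.ofReal (2 * l))) ↔ σ ≤ j ∧ j < τ := by
    intro j
    constructor
    · rintro ⟨⟨n, hn, hn'⟩, h2⟩
      refine ⟨(Nat.find_min' hex1 hn').trans hn, ?_⟩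
      by_contra h
      exact absurd hτs (not_lt.2 (h2 τ (not_lt.1 h)))
    · rintro ⟨h1, h2⟩
      exact ⟨⟨σ, h1, hσs⟩, fun n hn => hτl n (hn.trans_lt h2)⟩
  have hsum : ∀ a b, a ≤ b → u b = u a + ∑ j ∈ Finset.Ico a b, V j := by
    intro a b hab
    induction b, hab using Nat.le_induction with
    | base => simp
    | succ b hab ih => rw [hu, ih, Finset.sum_Ico_succ_top hab, add_assoc]
  set T : Y → B := fun y => ∑ j ∈ Finset.range N,
      if (∃ n ≤ j, ENNReal.ofReal l < eLpNorm' (u n) r ν) ∧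
        (∀ n ≤ j, eLpNorm' (u n) r ν ≤ ENNReal.ofReal (2 * l)) then V j y - m j y else 0 with hT
  have hTeq : T = ∑ j ∈ Finset.Ico σ τ, V j - ∑ j ∈ Finset.Ico σ τ, m j := by
    ext y
    simp only [hT, hcond, Pi.sub_apply, Finset.sum_apply]
    rw [← Finset.sum_sub_distrib, ← Finset.sum_filter]
    refine Finset.sum_congr ?_ fun _ _ => rfl
    ext j
    simp only [Finset.mem_filter, Finset.mem_range, Finset.mem_Ico]
    exact ⟨fun h => h.2, fun h => ⟨h.2.trans_le hτN, h⟩⟩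
  have hTm : AEStronglyMeasurable T ν := by
    rw [hTeq]
    exact (Finset.aestronglyMeasurable_sum _ fun j _ => hVm j).sub
      (Finset.aestronglyMeasurable_sum _ fun j _ => hmm j)
  -- The path starts at zero, so `σ` has a predecessor, and the overshoot above `l` at time `σ` is
  -- at most one increment.
  have hσ0 : σ ≠ 0 := by
    intro h
    rw [h, hu0] at hσs
    simp only [eLpNorm'_zero hr0] at hσs
    exact absurd hσs (by simp)
  obtain ⟨s, hs⟩ := Nat.exists_eq_succ_of_ne_zero hσ0
  have hsN : s < N := by omega
  have huσ : eLpNorm' (u σ) r ν ≤ ENNReal.ofReal l + ENNReal.ofReal (δ * l) := by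
    rw [hs, hu]
    exact (eLpNorm'_add_le (hum s) (hVm s) hr).trans
      (add_le_add (hσl s (by omega)) (hV s hsN))
  have hmσ : eLpNorm' (∑ j ∈ Finset.Ico σ τ, m j) r ν ≤ ENNReal.ofReal (δ * l) := by
    refine (eLpNorm'_sum_le (fun j _ => hmm j) hr).trans ?_
    calc ∑ j ∈ Finset.Ico σ τ, eLpNorm' (m j) r ν
        ≤ ∑ j ∈ Finset.Ico σ τ, ENNReal.ofReal (δ * l / N) :=
          Finset.sum_le_sum fun j hj => hm j ((Finset.mem_Ico.1 hj).2.trans_le hτN)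
      _ = (τ - σ : ℕ) * ENNReal.ofReal (δ * l / N) := by simp
      _ ≤ (N : ℕ) * ENNReal.ofReal (δ * l / N) := by
          gcongr
          omega
      _ = ENNReal.ofReal (δ * l) := by
          have : (0 : ℝ) < N := by exact_mod_cast (by omega : 0 < N)
          rw [← ENNReal.ofReal_natCast, ← ENNReal.ofReal_mul (by positivity)]
          congr 1; field_simp
  have huτ : u τ = u σ + (T + ∑ j ∈ Finset.Ico σ τ, m j) := by
    rw [hTeq, sub_add_cancel, ← hsum σ τ hστ]
  by_contra hlt
  push Not at hlt
  have hmS : AEStronglyMeasurable (∑ j ∈ Finset.Ico σ τ, m j) ν :=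
    Finset.aestronglyMeasurable_sum _ fun j _ => hmm j
  have h1 : eLpNorm' (u τ) r ν ≤ ENNReal.ofReal l + ENNReal.ofReal (δ * l) +
      (ENNReal.ofReal (l / 2) + ENNReal.ofReal (δ * l)) := by
    rw [huτ]
    refine (eLpNorm'_add_le (hum σ) (hTm.add hmS) hr).trans (add_le_add huσ ?_)
    exact (eLpNorm'_add_le hTm hmS hr).trans (add_le_add hlt.le hmσ)
  -- Here `δ ≤ 1 / 4` is used: `l + δ * l + l / 2 + δ * l ≤ 2 * l`.
  have h2 : ENNReal.ofReal l + ENNReal.ofReal (δ * l) +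
      (ENNReal.ofReal (l / 2) + ENNReal.ofReal (δ * l)) ≤ ENNReal.ofReal (2 * l) := by
    rw [← ENNReal.ofReal_add (by positivity) (by positivity),
      ← ENNReal.ofReal_add (by positivity) (by positivity),
      ← ENNReal.ofReal_add (by positivity) (by positivity)]
    refine ENNReal.ofReal_le_ofReal ?_
    nlinarith
  exact absurd (h1.trans h2) (not_le.2 hτs)

end Pathwise

/-! ### Tails of maxima and the union bound for frozen kernels -/

section Step

variable {S B F Y : Type*} [MeasurableSpace S] [NormedAddCommGroup B] [NormedSpace ℝ B]
  [CompleteSpace B] [TopologicalSpace.SeparableSpace B] [MeasurableSpace B] [BorelSpace B]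
  [MeasurableSpace F] [MeasurableSpace Y] {k : ℕ}

/-- The `L^r(ν)` norm of the `U`-statistic of order `k` built from the first `n` variables. -/
noncomputable def uNorm (r : ℝ) (ν : Measure Y) (g : F × Y × (Fin k → S) → B) (n : ℕ)
    (p : F × (ℕ → S)) : ℝ≥0∞ :=
  eLpNorm' (fun y => usum (fun v => g (p.1, y, v)) n p.2) r ν

/-- The tail of the maximum of the norms of the `U`-statistics of orders up to `N`. -/
noncomputable def uTail (r : ℝ) (μ : Measure S) (φ : Measure F) (ν : Measure Y)
    (g : F × Y × (Fin k → S) → B) (N : ℕ) (t : ℝ) : ℝ≥0∞ :=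
  (φ.prod (seqLaw μ)) {p | ∃ n ≤ N, ENNReal.ofReal t < uNorm r ν g n p}

theorem measurable_eLpNorm' {α : Type*} [MeasurableSpace α] (r : ℝ) (ν : Measure Y) [SFinite ν]
    {f : α → Y → B} (hf : Measurable fun p : α × Y => f p.1 p.2) :
    Measurable fun a => eLpNorm' (f a) r ν := by
  unfold eLpNorm'
  exact ((hf.enorm.pow_const r).lintegral_prod_right').pow_const _

theorem measurable_uNorm (r : ℝ) (ν : Measure Y) [SFinite ν] {g : F × Y × (Fin k → S) → B}
    (hg : Measurable g) (n : ℕ) : Measurable (uNorm r ν g n) := by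
  refine measurable_eLpNorm' r ν (f := fun (p : F × (ℕ → S)) y =>
    usum (fun v => g (p.1, y, v)) n p.2) ?_
  exact measurable_usum (E := (F × (ℕ → S)) × Y) (g := fun p v => g (p.1.1, p.2, v))
    (e := fun p => p.1.2) (by fun_prop) (by fun_prop) n

theorem uNorm_update (r : ℝ) (ν : Measure Y) (g : F × Y × (Fin k → S) → B) {j n : ℕ} (hjn : j ≤ n)
    (a : F) (x : ℕ → S) (w : S) :
    uNorm r ν g j (a, Function.update x n w) = uNorm r ν g j (a, x) := by
  simp only [uNorm, usum_update _ hjn]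

variable {μ : Measure S} [IsProbabilityMeasure μ] {φ : Measure F} [IsProbabilityMeasure φ]
  {ν : Measure Y} [IsProbabilityMeasure ν]

/-- A union bound over `j`. The `U`-statistic at time `j` does not see coordinate `j`, so that
coordinate may be resampled and becomes part of a parameter independent of the sequence. -/
theorem measure_kerF_le (r : ℝ) {g : F × Y × (Fin (k + 1) → S) → B} (hg : Measurable g) (N : ℕ)
    (t : ℝ) :
    (φ.prod (seqLaw μ)) {p | ∃ j < N, ENNReal.ofReal t < uNorm r ν (kerF g) j ((p.1, p.2 j), p.2)} ≤
      N * uTail r μ (φ.prod μ) ν (kerF g) N t := by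
  have hgF := measurable_kerF hg
  have hset : {p : F × (ℕ → S) | ∃ j < N, ENNReal.ofReal t <
      uNorm r ν (kerF g) j ((p.1, p.2 j), p.2)} = ⋃ j ∈ Finset.range N,
      {p | ENNReal.ofReal t < uNorm r ν (kerF g) j ((p.1, p.2 j), p.2)} := by
    ext p; simp
  rw [hset]
  refine (measure_biUnion_finset_le _ _).trans ?_
  have h1 : ∀ j ∈ Finset.range N, (φ.prod (seqLaw μ))
      {p | ENNReal.ofReal t < uNorm r ν (kerF g) j ((p.1, p.2 j), p.2)} ≤
      uTail r μ (φ.prod μ) ν (kerF g) N t := by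
    intro j hj
    have hm1 : MeasurableSet {q : (F × S) × (ℕ → S) | ENNReal.ofReal t < uNorm r ν (kerF g) j q} :=
      measurableSet_lt measurable_const (measurable_uNorm r ν hgF j)
    have hmap : Measurable fun p : F × (ℕ → S) => ((p.1, p.2 j), p.2) := by fun_prop
    have hmap2 : Measurable fun p : F × ((ℕ → S) × S) => ((p.1, p.2.2), p.2.1) := by fun_prop
    have e1 : (φ.prod (seqLaw μ))
        {p | ENNReal.ofReal t < uNorm r ν (kerF g) j ((p.1, p.2 j), p.2)} =
        (φ.prod ((seqLaw μ).prod μ))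
        {p | ENNReal.ofReal t < uNorm r ν (kerF g) j ((p.1, p.2.2), p.2.1)} := by
      have hmp := (MeasurePreserving.id φ).prod (measurePreserving_update μ j)
      refine (hmp.measure_preimage (s := {p | ENNReal.ofReal t <
        uNorm r ν (kerF g) j ((p.1, p.2 j), p.2)}) (hmap hm1).nullMeasurableSet).symm.trans ?_
      congr 1
      ext ⟨a, x, z⟩
      simp [uNorm_update r ν (kerF g) le_rfl]
    have hmp2 : MeasurePreserving (fun p : F × ((ℕ → S) × S) => ((p.1, p.2.2), p.2.1))
        (φ.prod ((seqLaw μ).prod μ)) ((φ.prod μ).prod (seqLaw μ)) := by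
      refine measurePreserving_of_lintegral hmap2 fun f hf => ?_
      rw [lintegral_prod _ (Measurable.aemeasurable (by fun_prop)),
        lintegral_prod _ (Measurable.aemeasurable (by fun_prop)),
        lintegral_prod _ (Measurable.aemeasurable (by fun_prop))]
      refine lintegral_congr fun a => ?_
      rw [lintegral_prod _ (Measurable.aemeasurable (by fun_prop)),
        lintegral_lintegral_swap (Measurable.aemeasurable (by fun_prop))]
    have e2 := hmp2.measure_preimage hm1.nullMeasurableSet
    rw [e1]
    refine (le_of_eq e2).trans (measure_mono fun q hq => ?_)
    exact ⟨j, (Finset.mem_range.1 hj).le, hq⟩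
  refine (Finset.sum_le_sum h1).trans ?_
  simp

end Step

end UStat

/-! ### The good-λ inequality -/

namespace UStat

section GoodLambda

variable {S B F Y : Type*} [MeasurableSpace S] [NormedAddCommGroup B] [NormedSpace ℝ B]
  [CompleteSpace B] [TopologicalSpace.SeparableSpace B] [MeasurableSpace B] [BorelSpace B]
  [MeasurableSpace F] [MeasurableSpace Y] {k : ℕ}
  {μ : Measure S} [IsProbabilityMeasure μ] {φ : Measure F} [IsProbabilityMeasure φ]
  {ν : Measure Y} [IsProbabilityMeasure ν]

theorem eLpNorm'_rpow_self {α : Type*} [MeasurableSpace α] {r : ℝ} (hr : 0 < r) (f : α → B)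
    (P : Measure α) : eLpNorm' f r P ^ r = ∫⁻ a, ‖f a‖ₑ ^ r ∂P := by
  rw [eLpNorm', ← ENNReal.rpow_mul, one_div, inv_mul_cancel₀ hr.ne', ENNReal.rpow_one]

/-- The times at which the path has passed the level `l` but not `2 * l`, and the next increment
has a conditional norm of at most `c`. -/
def passageSet (r : ℝ) (μ : Measure S) (ν : Measure Y) (g : F × Y × (Fin (k + 1) → S) → B)
    (l c : ℝ) (a : F) (j : ℕ) : Set (ℕ → S) :=
  {x | ((∃ n ≤ j, ENNReal.ofReal l < uNorm r ν g n (a, x)) ∧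
    (∀ n ≤ j, uNorm r ν g n (a, x) ≤ ENNReal.ofReal (2 * l))) ∧
    uNorm r (ν.prod μ) (kerI g) j (a, x) ≤ ENNReal.ofReal c}

theorem measurableSet_passageSet (r : ℝ) {g : F × Y × (Fin (k + 1) → S) → B} (hg : Measurable g)
    (l c : ℝ) (j : ℕ) :
    MeasurableSet {p : F × (ℕ → S) | p.2 ∈ passageSet r μ ν g l c p.1 j} := by
  have hgI := measurable_kerI hg
  have e : {p : F × (ℕ → S) | p.2 ∈ passageSet r μ ν g l c p.1 j} =
      ((⋃ n ∈ Set.Iic j, {p | ENNReal.ofReal l < uNorm r ν g n p}) ∩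
        (⋂ n ∈ Set.Iic j, {p | uNorm r ν g n p ≤ ENNReal.ofReal (2 * l)})) ∩
        {p | uNorm r (ν.prod μ) (kerI g) j p ≤ ENNReal.ofReal c} := by
    ext p
    simp [passageSet]
  rw [e]
  refine ((MeasurableSet.biUnion (Set.to_countable _) fun n _ => ?_).inter
    (MeasurableSet.biInter (Set.to_countable _) fun n _ => ?_)).inter ?_
  · exact measurableSet_lt measurable_const (measurable_uNorm r ν hg n)
  · exact measurableSet_le (measurable_uNorm r ν hg n) measurable_const
  · exact measurableSet_le (measurable_uNorm r (ν.prod μ) hgI j) measurable_const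

/-- The compensated sum over the passage times. -/
noncomputable def passageSum (r : ℝ) (μ : Measure S) (ν : Measure Y)
    (g : F × Y × (Fin (k + 1) → S) → B) (l c : ℝ) (N : ℕ) (a : F) (y : Y) (x : ℕ → S) : B :=
  predSum μ (fun j x z => usum (fun v => g (a, y, vcons z v)) j x)
    (passageSet r μ ν g l c a) N x

theorem measurable_increment {g : F × Y × (Fin (k + 1) → S) → B} (hg : Measurable g) (j : ℕ) :
    Measurable fun q : ((F × (ℕ → S)) × Y) × S =>
      usum (fun v => g (q.1.1.1, q.1.2, vcons q.2 v)) j q.1.1.2 :=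
  measurable_usum (E := ((F × (ℕ → S)) × Y) × S)
    (g := fun q v => g (q.1.1.1, q.1.2, vcons q.2 v)) (e := fun q => q.1.1.2)
    (by fun_prop) (by fun_prop) j

theorem measurable_passageSum (r : ℝ) {g : F × Y × (Fin (k + 1) → S) → B} (hg : Measurable g)
    (l c : ℝ) (N : ℕ) :
    Measurable fun q : (F × (ℕ → S)) × Y => passageSum r μ ν g l c N q.1.1 q.2 q.1.2 := by
  unfold passageSum predSum
  refine Finset.measurable_sum _ fun j _ => ?_
  have hV := measurable_increment hg j
  have h1 : Measurable fun q : (F × (ℕ → S)) × Y =>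
      usum (fun v => g (q.1.1, q.2, vcons (q.1.2 j) v)) j q.1.2 :=
    hV.comp (g := fun q : ((F × (ℕ → S)) × Y) × S =>
      usum (fun v => g (q.1.1.1, q.1.2, vcons q.2 v)) j q.1.1.2)
      (f := fun q : (F × (ℕ → S)) × Y => (q, q.1.2 j)) (by fun_prop)
  have h2 : Measurable fun q : (F × (ℕ → S)) × Y =>
      ∫ z, usum (fun v => g (q.1.1, q.2, vcons z v)) j q.1.2 ∂μ :=
    hV.stronglyMeasurable.integral_prod_right.measurable
  exact Measurable.ite (measurable_fst (measurableSet_passageSet r hg l c j)) (h1.sub h2)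
    measurable_const

/-- The martingale inequality is applied for fixed `a` and `y`. By Tonelli the moments of the
increments, integrated over `y` as well, become the `r`-th power of the norm of the integrated
kernel, at most `c ^ r` at the selected times. There are at most `N` such times, and none unless `l`
is exceeded by time `N`. -/
theorem lintegral_passageSum_le {r C : ℝ} (hr : 1 < r) (hC : IsMartingaleConst B μ r C)
    {g : F × Y × (Fin (k + 1) → S) → B} (hg : Measurable g) (l : ℝ) {c : ℝ} (N : ℕ) :
    ∫⁻ p, eLpNorm' (fun y => passageSum r μ ν g l c N p.1 y p.2) r ν ^ r ∂(φ.prod (seqLaw μ)) ≤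
      ENNReal.ofReal C * (N * ENNReal.ofReal c ^ r * uTail r μ φ ν g N l) := by
  have hr0 : 0 < r := by linarith
  have hT := measurable_passageSum (μ := μ) (ν := ν) r hg l c N
  have hTr : Measurable fun q : (F × (ℕ → S)) × Y =>
      ‖passageSum r μ ν g l c N q.1.1 q.2 q.1.2‖ₑ ^ r := hT.enorm.pow_const r
  have hTa : ∀ a, Measurable fun q : (ℕ → S) × Y =>
      ‖passageSum r μ ν g l c N a q.2 q.1‖ₑ ^ r := fun a =>
    hTr.comp (g := fun q : (F × (ℕ → S)) × Y =>
      ‖passageSum r μ ν g l c N q.1.1 q.2 q.1.2‖ₑ ^ r)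
      (f := fun q : (ℕ → S) × Y => ((a, q.1), q.2)) (by fun_prop)
  have hVr : ∀ j, Measurable fun q : (F × (ℕ → S)) × Y =>
      ∫⁻ z, ‖usum (fun v => g (q.1.1, q.2, vcons z v)) j q.1.2‖ₑ ^ r ∂μ := fun j =>
    ((measurable_increment hg j).enorm.pow_const r).lintegral_prod_right'
  have hAm : ∀ a j, MeasurableSet (passageSet r μ ν g l c a j) := fun a j =>
    measurable_prodMk_left (measurableSet_passageSet r hg l c j)
  have hInd : ∀ a j, Measurable fun q : (ℕ → S) × Y =>
      (passageSet r μ ν g l c a j).indicator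
        (fun x => ∫⁻ z, ‖usum (fun v => g (a, q.2, vcons z v)) j x‖ₑ ^ r ∂μ) q.1 := by
    intro a j
    have h1 : Measurable fun q : (ℕ → S) × Y =>
        ∫⁻ z, ‖usum (fun v => g (a, q.2, vcons z v)) j q.1‖ₑ ^ r ∂μ :=
      (hVr j).comp (f := fun q : (ℕ → S) × Y => ((a, q.1), q.2)) (by fun_prop)
    exact h1.indicator (measurable_fst (hAm a j))
  set G : Set (F × (ℕ → S)) := {p | ∃ n ≤ N, ENNReal.ofReal l < uNorm r ν g n p} with hG
  have hGm : MeasurableSet G := by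
    have : G = ⋃ n ∈ Set.Iic N, {p | ENNReal.ofReal l < uNorm r ν g n p} := by
      ext p; simp [hG]
    rw [this]
    exact MeasurableSet.biUnion (Set.to_countable _) fun n _ =>
      measurableSet_lt measurable_const (measurable_uNorm r ν hg n)
  calc ∫⁻ p, eLpNorm' (fun y => passageSum r μ ν g l c N p.1 y p.2) r ν ^ r ∂(φ.prod (seqLaw μ))
      = ∫⁻ a, ∫⁻ y, ∫⁻ x, ‖passageSum r μ ν g l c N a y x‖ₑ ^ r ∂(seqLaw μ) ∂ν ∂φ := by
        simp only [eLpNorm'_rpow_self hr0]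
        rw [lintegral_prod _ hTr.lintegral_prod_right'.aemeasurable]
        refine lintegral_congr fun a => ?_
        rw [lintegral_lintegral_swap (hTa a).aemeasurable]
    _ ≤ ∫⁻ a, ∫⁻ y, ENNReal.ofReal C * ∑ j ∈ Finset.range N,
          ∫⁻ x, (passageSet r μ ν g l c a j).indicator
            (fun x => ∫⁻ z, ‖usum (fun v => g (a, y, vcons z v)) j x‖ₑ ^ r ∂μ) x
            ∂(seqLaw μ) ∂ν ∂φ := by
        refine lintegral_mono fun a => lintegral_mono fun y => ?_
        refine hC _ _ (fun j => ?_) (hAm a) ?_ ?_ N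
        · exact (measurable_increment hg j).comp
            (f := fun q : (ℕ → S) × S => (((a, q.1), y), q.2)) (by fun_prop)
        · intro j n x w z hjn
          exact usum_update _ hjn x w
        · intro j n x w hjn
          simp only [passageSet, Set.mem_ofPred_eq, uNorm_update r _ _ hjn]
          have : ∀ i ≤ j, uNorm r ν g i (a, Function.update x n w) = uNorm r ν g i (a, x) :=
            fun i hi => uNorm_update r ν g (hi.trans hjn) a x w
          refine and_congr_left fun _ => and_congr ?_ ?_
          · exact exists_congr fun i => and_congr_right fun hi => by rw [this i hi]
          · exact forall₂_congr fun i hi => by rw [this i hi]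
    _ = ENNReal.ofReal C * ∫⁻ a, ∫⁻ x, ∑ j ∈ Finset.range N,
          (passageSet r μ ν g l c a j).indicator
            (fun x => uNorm r (ν.prod μ) (kerI g) j (a, x) ^ r) x ∂(seqLaw μ) ∂φ := by
        rw [← lintegral_const_mul' _ _ ENNReal.ofReal_ne_top]
        refine lintegral_congr fun a => ?_
        rw [lintegral_const_mul' _ _ ENNReal.ofReal_ne_top]
        congr 1
        rw [lintegral_finsetSum' _ fun j _ =>
          (hInd a j).lintegral_prod_left'.aemeasurable]
        rw [lintegral_finsetSum' _ fun j _ => ?_]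
        · refine Finset.sum_congr rfl fun j _ => ?_
          rw [← lintegral_lintegral_swap (hInd a j).aemeasurable]
          refine lintegral_congr fun x => ?_
          by_cases hx : x ∈ passageSet r μ ν g l c a j
          · simp only [Set.indicator_of_mem hx]
            rw [uNorm, eLpNorm'_rpow_self hr0, lintegral_prod]
            · rfl
            · refine Measurable.aemeasurable ?_
              exact ((measurable_increment hg j).enorm.pow_const r).comp
                (f := fun q : Y × S => (((a, x), q.1), q.2)) (by fun_prop)
          · simp [Set.indicator_of_notMem hx]
        · refine Measurable.aemeasurable (Measurable.indicator ?_ (hAm a j))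
          exact ((measurable_uNorm r (ν.prod μ) (measurable_kerI hg) j).comp
            measurable_prodMk_left).pow_const r
    _ ≤ ENNReal.ofReal C * ∫⁻ a, ∫⁻ x, ∑ j ∈ Finset.range N,
          ENNReal.ofReal c ^ r * G.indicator 1 (a, x) ∂(seqLaw μ) ∂φ := by
        gcongr with a x j hj
        by_cases hx : x ∈ passageSet r μ ν g l c a j
        · have hxG : (a, x) ∈ G := by
            obtain ⟨⟨⟨n, hn, hn'⟩, _⟩, _⟩ := hx
            exact ⟨n, hn.trans (Finset.mem_range.1 hj).le, hn'⟩
          rw [Set.indicator_of_mem hx, Set.indicator_of_mem hxG, Pi.one_apply, mul_one]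
          exact ENNReal.rpow_le_rpow hx.2 hr0.le
        · simp [Set.indicator_of_notMem hx]
    _ = _ := by
        congr 1
        simp only [Finset.sum_const, Finset.card_range, nsmul_eq_mul, ← mul_assoc]
        have hGi : Measurable (G.indicator (1 : F × (ℕ → S) → ℝ≥0∞)) :=
          measurable_one.indicator hGm
        rw [← lintegral_prod (f := fun p : F × (ℕ → S) =>
          (N * ENNReal.ofReal c ^ r) * G.indicator 1 p) (by fun_prop), lintegral_const_mul _ hGi,
          lintegral_indicator_one hGm, uTail]

/-- Good-`λ` inequality for the maximum of a `U`-statistic, in terms of the three `U`-statistics of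
smaller order obtained by freezing, integrating and averaging one variable. -/
theorem uTail_two_mul_le {r C : ℝ} (hr : 1 < r) (hC0 : 0 < C) (hC : IsMartingaleConst B μ r C)
    {g : F × Y × (Fin (k + 1) → S) → B} (hg : Measurable g)
    (hgi : Integrable g (jointLaw μ φ ν (k + 1))) {N : ℕ} (hN : 1 ≤ N) {l δ : ℝ} (hl : 0 < l)
    (hδ : 0 < δ) (hδ4 : δ ≤ 1 / 4) :
    uTail r μ φ ν g N (2 * l) ≤ ENNReal.ofReal (C * (2 * δ) ^ r) * uTail r μ φ ν g N l +
      (N * uTail r μ (φ.prod μ) ν (kerF g) N (δ * l) +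
        uTail r μ φ (ν.prod μ) (kerI g) N (δ * l / N ^ (1 / r)) +
        uTail r μ φ ν (kerA μ g) N (δ * l / N)) := by
  have hr0 : 0 < r := by linarith
  have hNR : (0 : ℝ) < N := by exact_mod_cast hN
  set c := δ * l / (N : ℝ) ^ (1 / r) with hc
  have hc0 : 0 < c := by positivity
  have hT := measurable_passageSum (μ := μ) (ν := ν) r hg l c N
  have hTn : Measurable fun p : F × (ℕ → S) =>
      eLpNorm' (fun y => passageSum r μ ν g l c N p.1 y p.2) r ν :=
    measurable_eLpNorm' r ν hT
  set E1 : Set (F × (ℕ → S)) :=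
    {p | ENNReal.ofReal (l / 2) ^ r ≤
      eLpNorm' (fun y => passageSum r μ ν g l c N p.1 y p.2) r ν ^ r} with hE1
  -- Markov's inequality at level `(l / 2) ^ r`. Since `N * c ^ r = (δ * l) ^ r`, the number of
  -- times cancels and `C * (2 * δ) ^ r` remains.
  have hPE1 : (φ.prod (seqLaw μ)) E1 ≤
      ENNReal.ofReal (C * (2 * δ) ^ r) * uTail r μ φ ν g N l := by
    have h1 := mul_meas_ge_le_lintegral₀ (μ := φ.prod (seqLaw μ))
      (hTn.pow_const r).aemeasurable (ENNReal.ofReal (l / 2) ^ r)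
    have h2 := h1.trans (lintegral_passageSum_le hr hC hg l N)
    have h3 : ENNReal.ofReal (l / 2) ^ r ≠ 0 := by
      rw [ENNReal.ofReal_rpow_of_pos (by positivity)]
      simpa using by positivity
    have h4 : ENNReal.ofReal (l / 2) ^ r ≠ ∞ := by
      rw [ENNReal.ofReal_rpow_of_pos (by positivity)]
      exact ENNReal.ofReal_ne_top
    refine (ENNReal.mul_le_mul_iff_right h3 h4).1 (h2.trans (le_of_eq ?_))
    rw [← mul_assoc, ← mul_assoc, ← mul_assoc]
    congr 1
    rw [ENNReal.ofReal_rpow_of_pos hc0, ENNReal.ofReal_rpow_of_pos (by positivity),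
      ← ENNReal.ofReal_natCast, ← ENNReal.ofReal_mul hC0.le, ← ENNReal.ofReal_mul (by positivity),
      ← ENNReal.ofReal_mul (by positivity)]
    congr 1
    have e1 : c ^ r = (δ * l) ^ r / N := by
      rw [hc, Real.div_rpow (by positivity) (by positivity), ← Real.rpow_mul hNR.le,
        one_div, inv_mul_cancel₀ hr0.ne', Real.rpow_one]
    have e2 : (l / 2) ^ r * (2 * δ) ^ r = (δ * l) ^ r := by
      rw [← Real.mul_rpow (by positivity) (by positivity)]
      congr 1; ring
    rw [e1, mul_left_comm, e2]
    field_simp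
  set EF : Set (F × (ℕ → S)) := {p | ∃ j < N, ENNReal.ofReal (δ * l) <
    uNorm r ν (kerF g) j ((p.1, p.2 j), p.2)} with hEF
  set EI : Set (F × (ℕ → S)) :=
    {p | ∃ n ≤ N, ENNReal.ofReal c < uNorm r (ν.prod μ) (kerI g) n p} with hEI
  set EA : Set (F × (ℕ → S)) :=
    {p | ∃ n ≤ N, ENNReal.ofReal (δ * l / N) < uNorm r ν (kerA μ g) n p} with hEA
  have hincl : ∀ᵐ p ∂(φ.prod (seqLaw μ)),
      p ∈ {p | ∃ n ≤ N, ENNReal.ofReal (2 * l) < uNorm r ν g n p} →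
      p ∈ E1 ∪ (EF ∪ EI ∪ EA) := by
    filter_upwards [ae_usum_integral hgi] with p hp hpE
    by_contra hnot
    simp only [Set.mem_union, not_or] at hnot
    obtain ⟨hn1, ⟨hnF, hnI⟩, hnA⟩ := hnot
    simp only [hEF, hEI, hEA, Set.mem_ofPred_eq, not_exists, not_and, not_lt] at hnF hnI hnA
    apply hn1
    simp only [hE1, Set.mem_ofPred_eq]
    refine ENNReal.rpow_le_rpow ?_ hr0.le
    have hinc := fun j => measurable_increment hg j
    have key := le_eLpNorm'_sum_of_passage (ν := ν) hr.le
      (u := fun n y => usum (fun v => g (p.1, y, v)) n p.2)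
      (V := fun j y => usum (fun v => g (p.1, y, vcons (p.2 j) v)) j p.2)
      (m := fun j y => ∫ z, usum (fun v => g (p.1, y, vcons z v)) j p.2 ∂μ)
      (fun n => (measurable_usum (E := Y) (g := fun y v => g (p.1, y, v)) (e := fun _ => p.2)
        (by fun_prop) (by fun_prop) n).aestronglyMeasurable)
      (fun j => ((hinc j).comp (f := fun y : Y => ((p, y), p.2 j))
        (by fun_prop)).aestronglyMeasurable)
      (fun j => ((hinc j).stronglyMeasurable.integral_prod_right'.measurable.comp
        (f := fun y : Y => (p, y)) (by fun_prop)).aestronglyMeasurable)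
      (by ext y; exact usum_succ_zero _ _)
      (fun n => by ext y; exact usum_succ_succ _ _ _) hl hδ hδ4 hpE
      (fun j hj => hnF j hj)
      (fun j hj => by
        rw [eLpNorm'_congr_ae (hp j)]
        exact hnA j hj.le)
    refine key.trans (le_of_eq ?_)
    congr 1
    ext y
    unfold passageSum predSum
    refine Finset.sum_congr rfl fun j hj => ?_
    -- Off `EI` the bound on the conditional norm, which makes the passage event predictable with
    -- controlled increments, holds automatically.
    have : (p.2 ∈ passageSet r μ ν g l c p.1 j) ↔
        ((∃ n ≤ j, ENNReal.ofReal l <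
            eLpNorm' (fun y => usum (fun v => g (p.1, y, v)) n p.2) r ν) ∧
          ∀ n ≤ j, eLpNorm' (fun y => usum (fun v => g (p.1, y, v)) n p.2) r ν ≤
            ENNReal.ofReal (2 * l)) :=
      and_iff_left (hnI j (Finset.mem_range.1 hj).le)
    simp only [this]
  calc uTail r μ φ ν g N (2 * l) ≤ (φ.prod (seqLaw μ)) (E1 ∪ (EF ∪ EI ∪ EA)) :=
        measure_mono_ae hincl
    _ ≤ (φ.prod (seqLaw μ)) E1 + ((φ.prod (seqLaw μ)) EF + (φ.prod (seqLaw μ)) EI +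
        (φ.prod (seqLaw μ)) EA) :=
        (measure_union_le _ _).trans (add_le_add le_rfl ((measure_union_le _ _).trans
          (add_le_add (measure_union_le _ _) le_rfl)))
    _ ≤ _ := by
        refine add_le_add hPE1 (add_le_add (add_le_add ?_ le_rfl) le_rfl)
        exact measure_kerF_le r hg N (δ * l)

end GoodLambda

end UStat

/-! ### Weighted series of tails and the recursion -/

namespace UStat

section Series

variable {S B F Y : Type*} [MeasurableSpace S] [NormedAddCommGroup B]
  [MeasurableSpace F] [MeasurableSpace Y] {k : ℕ}

/-- Geometrically weighted sum of the tails at the levels `t / 2 ^ l`. -/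
noncomputable def uSeries (r η : ℝ) (μ : Measure S) (φ : Measure F) (ν : Measure Y)
    (g : F × Y × (Fin k → S) → B) (N : ℕ) (t : ℝ) : ℝ≥0∞ :=
  ∑' l : ℕ, ENNReal.ofReal (η ^ l) * uTail r μ φ ν g N (t / 2 ^ l)

/-- Dyadic sum of the series of tails, with weights `2 ^ (b ρ)` and levels `ε 2 ^ (b τ)`. -/
noncomputable def uSum (r η : ℝ) (μ : Measure S) (φ : Measure F) (ν : Measure Y) (ρ τ : ℝ)
    (g : F × Y × (Fin k → S) → B) (ε : ℝ) : ℝ≥0∞ :=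
  ∑' b : ℕ, ENNReal.ofReal (2 ^ (b * ρ)) * uSeries r η μ φ ν g (2 ^ b) (ε * 2 ^ (b * τ))

theorem tsum_ofReal_pow_lt_top {x : ℝ} (hx : 0 ≤ x) (hx1 : x < 1) :
    ∑' l : ℕ, ENNReal.ofReal (x ^ l) < ∞ := by
  rw [← ENNReal.ofReal_tsum_of_nonneg (fun n => pow_nonneg hx n)
    (summable_geometric_of_lt_one hx hx1)]
  exact ENNReal.ofReal_lt_top

/-- Tails are probabilities, so the geometric weights alone force convergence; this permits the
absorption in `uSeries_le`. -/
theorem uSeries_ne_top {r η : ℝ} (hη : 0 ≤ η) (hη1 : η < 1) (μ : Measure S)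
    [IsProbabilityMeasure μ] (φ : Measure F) [IsProbabilityMeasure φ] (ν : Measure Y)
    (g : F × Y × (Fin k → S) → B) (N : ℕ) (t : ℝ) : uSeries r η μ φ ν g N t ≠ ∞ := by
  refine ((ENNReal.tsum_le_tsum fun l => ?_).trans_lt (tsum_ofReal_pow_lt_top hη hη1)).ne
  calc ENNReal.ofReal (η ^ l) * uTail r μ φ ν g N (t / 2 ^ l) ≤ ENNReal.ofReal (η ^ l) * 1 := by
        gcongr; exact prob_le_one
    _ = _ := mul_one _

end Series

section Step

variable {S B F Y : Type*} [MeasurableSpace S] [NormedAddCommGroup B] [NormedSpace ℝ B]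
  [CompleteSpace B] [TopologicalSpace.SeparableSpace B] [MeasurableSpace B] [BorelSpace B]
  [MeasurableSpace F] [MeasurableSpace Y] {k : ℕ}
  {μ : Measure S} [IsProbabilityMeasure μ] {φ : Measure F} [IsProbabilityMeasure φ]
  {ν : Measure Y} [IsProbabilityMeasure ν]

theorem exists_goodLambda_delta {r C η : ℝ} (hr : 1 < r) (hC : 0 < C) (hη : 0 < η) :
    ∃ δ : ℝ, 0 < δ ∧ δ ≤ 1 / 4 ∧ C * (2 * δ) ^ r ≤ η / 2 := by
  refine ⟨min (1 / 4) ((η / (2 * C)) ^ (1 / r) / 2), by positivity, min_le_left _ _, ?_⟩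
  have h1 : 2 * min (1 / 4) ((η / (2 * C)) ^ (1 / r) / 2) ≤ (η / (2 * C)) ^ (1 / r) := by
    have := min_le_right (1 / 4) ((η / (2 * C)) ^ (1 / r) / 2)
    linarith
  calc C * (2 * min (1 / 4) ((η / (2 * C)) ^ (1 / r) / 2)) ^ r
      ≤ C * ((η / (2 * C)) ^ (1 / r)) ^ r := by gcongr
    _ = C * (η / (2 * C)) := by
        rw [← Real.rpow_mul (by positivity), one_div, inv_mul_cancel₀ (by positivity),
          Real.rpow_one]
    _ = η / 2 := by field_simp

/-- The good-`λ` inequality at level `t / 2 ^ (l + 1)` bounds the `l`-th term by half of the next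
term plus the contributions of the three smaller kernels. Summed over `l`, the series is at most
half of itself plus the remainder, and being finite it can be absorbed. -/
theorem uSeries_le {r C η δ : ℝ} (hr : 1 < r) (hC0 : 0 < C) (hC : IsMartingaleConst B μ r C)
    (hη : 0 < η) (hη1 : η < 1) (hδ : 0 < δ) (hδ4 : δ ≤ 1 / 4) (hδη : C * (2 * δ) ^ r ≤ η / 2)
    {g : F × Y × (Fin (k + 1) → S) → B} (hg : Measurable g)
    (hgi : Integrable g (jointLaw μ φ ν (k + 1))) {N : ℕ} (hN : 1 ≤ N) {t : ℝ} (ht : 0 < t) :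
    uSeries r η μ φ ν g N t ≤ 2 * (N * uSeries r η μ (φ.prod μ) ν (kerF g) N (δ / 2 * t) +
      uSeries r η μ φ (ν.prod μ) (kerI g) N (δ / 2 * t / N ^ (1 / r)) +
      uSeries r η μ φ ν (kerA μ g) N (δ / 2 * t / N)) := by
  set R : ℝ≥0∞ := N * uSeries r η μ (φ.prod μ) ν (kerF g) N (δ / 2 * t) +
      uSeries r η μ φ (ν.prod μ) (kerI g) N (δ / 2 * t / N ^ (1 / r)) +
      uSeries r η μ φ ν (kerA μ g) N (δ / 2 * t / N) with hR
  have hz := uSeries_ne_top (r := r) hη.le hη1 μ φ ν g N t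
  have hterm : ∀ l : ℕ, ENNReal.ofReal (η ^ l) * uTail r μ φ ν g N (t / 2 ^ l) ≤
      2⁻¹ * (ENNReal.ofReal (η ^ (l + 1)) * uTail r μ φ ν g N (t / 2 ^ (l + 1))) +
      (N * (ENNReal.ofReal (η ^ l) * uTail r μ (φ.prod μ) ν (kerF g) N (δ / 2 * t / 2 ^ l)) +
        ENNReal.ofReal (η ^ l) *
          uTail r μ φ (ν.prod μ) (kerI g) N (δ / 2 * t / N ^ (1 / r) / 2 ^ l) +
        ENNReal.ofReal (η ^ l) * uTail r μ φ ν (kerA μ g) N (δ / 2 * t / N / 2 ^ l)) := by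
    intro l
    have h1 := uTail_two_mul_le hr hC0 hC hg hgi hN (l := t / 2 ^ (l + 1)) (by positivity) hδ hδ4
    have e0 : 2 * (t / 2 ^ (l + 1)) = t / 2 ^ l := by rw [pow_succ]; field_simp
    have e1 : δ * (t / 2 ^ (l + 1)) = δ / 2 * t / 2 ^ l := by rw [pow_succ]; field_simp
    rw [e0, e1, div_right_comm _ ((2 : ℝ) ^ l), div_right_comm _ ((2 : ℝ) ^ l)] at h1
    calc ENNReal.ofReal (η ^ l) * uTail r μ φ ν g N (t / 2 ^ l)
        ≤ ENNReal.ofReal (η ^ l) * _ := mul_le_mul_right h1 _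
      _ ≤ ENNReal.ofReal (η ^ l) * (ENNReal.ofReal (η / 2) * uTail r μ φ ν g N (t / 2 ^ (l + 1)) +
            _) := by
          refine mul_le_mul_right (add_le_add ?_ le_rfl) _
          gcongr
      _ = _ := by
          rw [mul_add, mul_add, mul_add, ← mul_assoc (ENNReal.ofReal (η ^ l)),
            ← ENNReal.ofReal_mul (by positivity), ← mul_assoc (2⁻¹ : ℝ≥0∞)]
          have e2 : ENNReal.ofReal (η ^ l * (η / 2)) = 2⁻¹ * ENNReal.ofReal (η ^ (l + 1)) := by
            rw [show (2⁻¹ : ℝ≥0∞) = ENNReal.ofReal 2⁻¹ by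
              rw [ENNReal.ofReal_inv_of_pos (by norm_num)]; simp,
              ← ENNReal.ofReal_mul (by norm_num)]
            congr 1; ring
          rw [e2, mul_left_comm (ENNReal.ofReal (η ^ l)) (N : ℝ≥0∞)]
  have hsum : uSeries r η μ φ ν g N t ≤ 2⁻¹ * uSeries r η μ φ ν g N t + R := by
    calc uSeries r η μ φ ν g N t ≤ _ := ENNReal.tsum_le_tsum hterm
      _ ≤ _ := by
          rw [ENNReal.tsum_add, ENNReal.tsum_add, ENNReal.tsum_add, ENNReal.tsum_mul_left,
            ENNReal.tsum_mul_left]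
          refine add_le_add (mul_le_mul_right ?_ _) le_rfl
          exact ENNReal.tsum_comp_le_tsum_of_injective (add_left_injective 1)
            fun l => ENNReal.ofReal (η ^ l) * uTail r μ φ ν g N (t / 2 ^ l)
  have hhalf : uSeries r η μ φ ν g N t =
      2⁻¹ * uSeries r η μ φ ν g N t + 2⁻¹ * uSeries r η μ φ ν g N t := by
    rw [← add_mul, ENNReal.inv_two_add_inv_two, one_mul]
  have hle : 2⁻¹ * uSeries r η μ φ ν g N t ≤ R := by
    refine (ENNReal.add_le_add_iff_left (a := 2⁻¹ * uSeries r η μ φ ν g N t) ?_).1 ?_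
    · exact ENNReal.mul_ne_top (by simp) hz
    · rw [← hhalf]; exact hsum
  calc uSeries r η μ φ ν g N t = 2 * (2⁻¹ * uSeries r η μ φ ν g N t) := by
        rw [← mul_assoc, ENNReal.mul_inv_cancel (by simp) (by simp), one_mul]
    _ ≤ 2 * R := by gcongr

/-- With `N = 2 ^ b`, the factor `N` raises the weight exponent by one, and dividing the level by `N
^ (1 / r)` or `N` lowers the level exponent by `1 / r` or `1`. -/
theorem uSum_le {r C η δ : ℝ} (hr : 1 < r) (hC0 : 0 < C) (hC : IsMartingaleConst B μ r C)
    (hη : 0 < η) (hη1 : η < 1) (hδ : 0 < δ) (hδ4 : δ ≤ 1 / 4) (hδη : C * (2 * δ) ^ r ≤ η / 2)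
    {g : F × Y × (Fin (k + 1) → S) → B} (hg : Measurable g)
    (hgi : Integrable g (jointLaw μ φ ν (k + 1))) (ρ τ : ℝ) {ε : ℝ} (hε : 0 < ε) :
    uSum r η μ φ ν ρ τ g ε ≤ 2 * (uSum r η μ (φ.prod μ) ν (ρ + 1) τ (kerF g) (δ / 2 * ε) +
      uSum r η μ φ (ν.prod μ) ρ (τ - 1 / r) (kerI g) (δ / 2 * ε) +
      uSum r η μ φ ν ρ (τ - 1) (kerA μ g) (δ / 2 * ε)) := by
  simp only [uSum]
  rw [← ENNReal.tsum_add, ← ENNReal.tsum_add, ← ENNReal.tsum_mul_left]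
  refine ENNReal.tsum_le_tsum fun b => ?_
  have h1 := uSeries_le hr hC0 hC hη hη1 hδ hδ4 hδη hg hgi (N := 2 ^ b) Nat.one_le_two_pow
    (t := ε * 2 ^ (b * τ)) (by positivity)
  have e0 : ((2 ^ b : ℕ) : ℝ) = 2 ^ (b : ℝ) := by
    rw [Real.rpow_natCast]; push_cast; rfl
  have e1 : δ / 2 * (ε * 2 ^ (b * τ)) = δ / 2 * ε * 2 ^ (b * τ) := by ring
  have e2 : δ / 2 * (ε * 2 ^ (b * τ)) / ((2 ^ b : ℕ) : ℝ) ^ (1 / r) =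
      δ / 2 * ε * 2 ^ (b * (τ - 1 / r)) := by
    rw [e0, ← Real.rpow_mul (by norm_num), mul_sub, Real.rpow_sub (by norm_num)]; ring
  have e3 : δ / 2 * (ε * 2 ^ (b * τ)) / ((2 ^ b : ℕ) : ℝ) = δ / 2 * ε * 2 ^ (b * (τ - 1)) := by
    rw [e0, mul_sub, Real.rpow_sub (by norm_num), mul_one]; ring
  have e4 : ENNReal.ofReal (2 ^ (b * (ρ + 1))) =
      ENNReal.ofReal (2 ^ (b * ρ)) * ((2 ^ b : ℕ) : ℝ≥0∞) := by
    rw [← ENNReal.ofReal_natCast, e0, ← ENNReal.ofReal_mul (by positivity),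
      ← Real.rpow_add (by norm_num)]
    congr 2; ring
  rw [e2, e3, e1] at h1
  calc ENNReal.ofReal (2 ^ (b * ρ)) * uSeries r η μ φ ν g (2 ^ b) (ε * 2 ^ (b * τ))
      ≤ ENNReal.ofReal (2 ^ (b * ρ)) * _ := mul_le_mul_right h1 _
    _ = _ := by rw [e4]; ring

end Step

/-! ### Dyadic sums of tails controlled by a moment -/

section Leaf

variable {F : Type*} [MeasurableSpace F]

/-- The active `b` form an initial segment, on which the increasing geometric sum is comparable with
its last term `2 ^ (n * ρ) ≤ (2 ^ (n * τ)) ^ q`, and `s * 2 ^ (n * τ) < H` there. -/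
theorem tsum_dyadic_indicator_le {ρ τ q : ℝ} (hρ : 0 < ρ) (hτ : 0 < τ) (hq : ρ ≤ q * τ) {s : ℝ}
    (hs : 0 < s) (H : ℝ≥0∞) :
    ∑' b : ℕ, (if ENNReal.ofReal (s * 2 ^ (b * τ)) < H then ENNReal.ofReal (2 ^ (b * ρ)) else 0) ≤
      ENNReal.ofReal ((1 - (2 ^ ρ)⁻¹)⁻¹ * s ^ (-q)) * H ^ q := by
  have hq0 : 0 < q := by
    by_contra h
    push Not at h
    nlinarith
  have hx1 : (1 : ℝ) < 2 ^ ρ := Real.one_lt_rpow (by norm_num) hρ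
  have hK : 0 < 1 - ((2 : ℝ) ^ ρ)⁻¹ := by
    have := inv_lt_one_of_one_lt₀ hx1
    linarith
  refine ENNReal.tsum_le_of_sum_range_le fun n => ?_
  induction n with
  | zero => simp
  | succ n ih =>
    by_cases hn : ENNReal.ofReal (s * 2 ^ (n * τ)) < H
    · have hgeom : ∑ b ∈ Finset.range (n + 1), (2 : ℝ) ^ (b * ρ) ≤
          (1 - (2 ^ ρ)⁻¹)⁻¹ * 2 ^ (n * ρ) := by
        have e : ∀ b : ℕ, (2 : ℝ) ^ (b * ρ) = (2 ^ ρ) ^ b := fun b => by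
          rw [mul_comm, Real.rpow_mul (by norm_num), Real.rpow_natCast]
        simp only [e]
        rw [geom_sum_eq hx1.ne', div_le_iff₀ (by linarith)]
        have : (1 - ((2 : ℝ) ^ ρ)⁻¹)⁻¹ = 2 ^ ρ / (2 ^ ρ - 1) := by
          rw [show 1 - ((2 : ℝ) ^ ρ)⁻¹ = (2 ^ ρ - 1) / 2 ^ ρ by field_simp, inv_div]
        rw [this, pow_succ]
        have h3 : (2 : ℝ) ^ ρ - 1 ≠ 0 := by linarith
        field_simp
        linarith
      calc ∑ b ∈ Finset.range (n + 1),
            (if ENNReal.ofReal (s * 2 ^ (b * τ)) < H then ENNReal.ofReal (2 ^ (b * ρ)) else 0)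
          ≤ ∑ b ∈ Finset.range (n + 1), ENNReal.ofReal (2 ^ (b * ρ)) := by
            refine Finset.sum_le_sum fun b _ => ?_
            split_ifs <;> simp
        _ = ENNReal.ofReal (∑ b ∈ Finset.range (n + 1), 2 ^ (b * ρ)) :=
            (ENNReal.ofReal_sum_of_nonneg fun b _ => by positivity).symm
        _ ≤ ENNReal.ofReal ((1 - (2 ^ ρ)⁻¹)⁻¹ * s ^ (-q) * (s * 2 ^ (n * τ)) ^ q) := by
            refine ENNReal.ofReal_le_ofReal (hgeom.trans ?_)
            rw [Real.mul_rpow hs.le (by positivity), mul_assoc, ← mul_assoc (s ^ (-q)),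
              ← Real.rpow_add hs, neg_add_cancel, Real.rpow_zero, one_mul,
              ← Real.rpow_mul (by norm_num)]
            refine mul_le_mul_of_nonneg_left ?_ (by positivity)
            refine Real.rpow_le_rpow_of_exponent_le (by norm_num) ?_
            have : (n : ℝ) * ρ ≤ n * (q * τ) := by gcongr
            linarith
        _ ≤ _ := by
            rw [ENNReal.ofReal_mul (by positivity)]
            gcongr
            rw [← ENNReal.ofReal_rpow_of_pos (by positivity)]
            exact ENNReal.rpow_le_rpow hn.le hq0.le
    · rw [Finset.sum_range_succ, if_neg hn, add_zero]
      exact ih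

theorem tsum_dyadic_measure_le {ρ τ q : ℝ} (hρ : 0 < ρ) (hτ : 0 < τ) (hq : ρ ≤ q * τ) {s : ℝ}
    (hs : 0 < s) (φ : Measure F) {H : F → ℝ≥0∞} (hH : Measurable H) :
    ∑' b : ℕ, ENNReal.ofReal (2 ^ (b * ρ)) * φ {a | ENNReal.ofReal (s * 2 ^ (b * τ)) < H a} ≤
      ENNReal.ofReal ((1 - (2 ^ ρ)⁻¹)⁻¹ * s ^ (-q)) * ∫⁻ a, H a ^ q ∂φ := by
  have hm : ∀ b : ℕ, MeasurableSet {a | ENNReal.ofReal (s * 2 ^ (b * τ)) < H a} := fun b =>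
    measurableSet_lt measurable_const hH
  calc ∑' b : ℕ, ENNReal.ofReal (2 ^ (b * ρ)) * φ {a | ENNReal.ofReal (s * 2 ^ (b * τ)) < H a}
      = ∑' b : ℕ, ∫⁻ a, (if ENNReal.ofReal (s * 2 ^ (b * τ)) < H a then
          ENNReal.ofReal (2 ^ (b * ρ)) else 0) ∂φ := by
        refine tsum_congr fun b => ?_
        rw [← lintegral_indicator_const (hm b)]
        simp [Set.indicator_apply]
    _ = ∫⁻ a, ∑' b : ℕ, (if ENNReal.ofReal (s * 2 ^ (b * τ)) < H a then
          ENNReal.ofReal (2 ^ (b * ρ)) else 0) ∂φ := by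
        rw [lintegral_tsum fun b =>
          (Measurable.ite (hm b) measurable_const measurable_const).aemeasurable]
    _ ≤ ∫⁻ a, ENNReal.ofReal ((1 - (2 ^ ρ)⁻¹)⁻¹ * s ^ (-q)) * H a ^ q ∂φ :=
        lintegral_mono fun a => tsum_dyadic_indicator_le hρ hτ hq hs (H a)
    _ = _ := lintegral_const_mul' _ _ ENNReal.ofReal_ne_top

/-- Lowering the level by the factor `2 ^ l` multiplies the moment bound by `2 ^ (l * q)`, which the
weight `η ^ l` compensates because `η * 2 ^ q < 1`. -/
theorem tsum_dyadic_geometric_lt_top {ρ τ q η : ℝ} (hρ : 0 < ρ) (hτ : 0 < τ) (hq : ρ ≤ q * τ)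
    (hη : 0 ≤ η) (hηq : η * 2 ^ q < 1) {s : ℝ} (hs : 0 < s) (φ : Measure F) {H : F → ℝ≥0∞}
    (hH : Measurable H) (hHq : ∫⁻ a, H a ^ q ∂φ < ∞) :
    ∑' b : ℕ, ENNReal.ofReal (2 ^ (b * ρ)) * ∑' l : ℕ, ENNReal.ofReal (η ^ l) *
      φ {a | ENNReal.ofReal (s * 2 ^ (b * τ) / 2 ^ l) < H a} < ∞ := by
  calc ∑' b : ℕ, ENNReal.ofReal (2 ^ (b * ρ)) * ∑' l : ℕ, ENNReal.ofReal (η ^ l) *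
        φ {a | ENNReal.ofReal (s * 2 ^ (b * τ) / 2 ^ l) < H a}
      = ∑' l : ℕ, ENNReal.ofReal (η ^ l) * ∑' b : ℕ, ENNReal.ofReal (2 ^ (b * ρ)) *
        φ {a | ENNReal.ofReal (s / 2 ^ l * 2 ^ (b * τ)) < H a} := by
        simp only [← ENNReal.tsum_mul_left]
        rw [ENNReal.tsum_comm]
        refine tsum_congr fun l => tsum_congr fun b => ?_
        rw [mul_left_comm]
        congr 6
        ext a
        rw [div_mul_eq_mul_div]
    _ ≤ ∑' l : ℕ, ENNReal.ofReal (η ^ l) *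
        (ENNReal.ofReal ((1 - (2 ^ ρ)⁻¹)⁻¹ * (s / 2 ^ l) ^ (-q)) * ∫⁻ a, H a ^ q ∂φ) := by
        refine ENNReal.tsum_le_tsum fun l => ?_
        gcongr
        exact tsum_dyadic_measure_le hρ hτ hq (by positivity) φ hH
    _ = ∑' l : ℕ, ENNReal.ofReal ((η * 2 ^ q) ^ l) *
        (ENNReal.ofReal ((1 - (2 ^ ρ)⁻¹)⁻¹ * s ^ (-q)) * ∫⁻ a, H a ^ q ∂φ) := by
        refine tsum_congr fun l => ?_
        rw [← mul_assoc, ← mul_assoc, ← ENNReal.ofReal_mul (by positivity),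
          ← ENNReal.ofReal_mul (by positivity)]
        congr 2
        rw [Real.div_rpow hs.le (by positivity), Real.rpow_neg (by positivity : (0:ℝ) ≤ 2 ^ l),
          mul_pow, ← Real.rpow_natCast 2 l, ← Real.rpow_mul (by norm_num), mul_comm (l : ℝ) q,
          Real.rpow_mul (by norm_num), Real.rpow_natCast]
        field_simp
    _ < ∞ := by
        rw [ENNReal.tsum_mul_right]
        exact ENNReal.mul_lt_top (tsum_ofReal_pow_lt_top (by positivity) hηq)
          (ENNReal.mul_lt_top ENNReal.ofReal_lt_top hHq)

end Leaf

end UStat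

/-! ### Moment, degeneracy and exponent conditions and their inheritance -/

namespace UStat

section Conditions

variable {S B F Y : Type*} [MeasurableSpace S] [NormedAddCommGroup B] [NormedSpace ℝ B]
  [TopologicalSpace.SeparableSpace B] [MeasurableSpace B] [BorelSpace B]
  [MeasurableSpace F] [MeasurableSpace Y] {k : ℕ}

/-- The moment of order `q |J|` of the conditional `L^r` norm of a kernel given the parameter and
the variables with index in `J` is finite. -/
def MomentCond (r : ℝ) (μ : Measure S) (φ : Measure F) (ν : Measure Y) (q : ℕ → ℝ)
    (g : F × Y × (Fin k → S) → B) (J : Finset (Fin k)) : Prop :=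
  ∫⁻ a, ∫⁻ x, (∫⁻ y, ∫⁻ x', ‖g (a, y, J.piecewise x x')‖ₑ ^ r ∂(vecLaw μ k) ∂ν) ^ (q J.card / r)
    ∂(vecLaw μ k) ∂φ < ∞

/-- Integrals of the kernel over events depending only on the parameters and on fewer than `e`
variables vanish. -/
def DegenerateCond (μ : Measure S) (φ : Measure F) (ν : Measure Y) (e : ℕ)
    (g : F × Y × (Fin k → S) → B) : Prop :=
  ∀ T : Finset (Fin k), T.card < e → ∀ A : Set (F × Y × (Fin k → S)), MeasurableSet A →
    (∀ a y x x', (∀ i ∈ T, x i = x' i) → ((a, y, x) ∈ A ↔ (a, y, x') ∈ A)) →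
    ∫ p in A, g p ∂(jointLaw μ φ ν k) = 0

/-- The numerical relations between the weight exponent `ρ`, the level exponent `τ` and the moment
exponents `q` of a kernel of order `k` which is degenerate of order `e`. -/
def ExponentCond (r : ℝ) (k e : ℕ) (ρ τ : ℝ) (q : ℕ → ℝ) : Prop :=
  ∀ j a c : ℕ, j + a + c = k → e ≤ a + j → 0 < τ - a / r - c ∧ ρ + j ≤ q j * (τ - a / r - c)

/-- The triple `(j, a, c)` counts the variables still to be frozen, integrated and averaged; using
up one variable shifts one count. Freezing and integrating lower the order of degeneracy by one,
averaging does not. -/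
theorem ExponentCond.kerF {r ρ τ : ℝ} {e : ℕ} {q : ℕ → ℝ} (h : ExponentCond r (k + 1) e ρ τ q) :
    ExponentCond r k (e - 1) (ρ + 1) τ fun j => q (j + 1) := by
  intro j a c hk he
  have := h (j + 1) a c (by omega) (by omega)
  push_cast at this
  exact ⟨this.1, by linarith [this.2]⟩

theorem ExponentCond.kerI {r ρ τ : ℝ} {e : ℕ} {q : ℕ → ℝ} (h : ExponentCond r (k + 1) e ρ τ q) :
    ExponentCond r k (e - 1) ρ (τ - 1 / r) q := by
  intro j a c hk he
  have := h j (a + 1) c (by omega) (by omega)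
  push_cast at this
  rw [show τ - 1 / r - a / r - c = τ - (a + 1) / r - c by ring]
  exact this

theorem ExponentCond.kerA {r ρ τ : ℝ} {e : ℕ} {q : ℕ → ℝ} (h : ExponentCond r (k + 1) e ρ τ q) :
    ExponentCond r k e ρ (τ - 1) q := by
  intro j a c hk he
  have := h j a (c + 1) (by omega) (by omega)
  push_cast at this
  rw [show τ - 1 - a / r - c = τ - a / r - (c + 1) by ring]
  exact this

theorem piecewise_vcons_insert (J : Finset (Fin k)) (z z' : S) (x x' : Fin k → S) :
    (insert 0 (J.map (Fin.succEmb k))).piecewise (vcons z x) (vcons z' x') =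
      vcons z (J.piecewise x x') := by
  ext i
  refine Fin.cases ?_ (fun i => ?_) i
  · simp [Finset.piecewise]
  · simp [Finset.piecewise]

theorem piecewise_vcons_map (J : Finset (Fin k)) (z z' : S) (x x' : Fin k → S) :
    (J.map (Fin.succEmb k)).piecewise (vcons z x) (vcons z' x') =
      vcons z' (J.piecewise x x') := by
  ext i
  refine Fin.cases ?_ (fun i => ?_) i
  · simp [Finset.piecewise]
  · simp [Finset.piecewise]

theorem card_insert_map_succ (J : Finset (Fin k)) :
    (insert 0 (J.map (Fin.succEmb k))).card = J.card + 1 := by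
  rw [Finset.card_insert_of_notMem (by simp), Finset.card_map]

@[fun_prop]
theorem measurable_piecewise {α : Type*} [MeasurableSpace α] (J : Finset (Fin k))
    {f h : α → Fin k → S} (hf : Measurable f) (hh : Measurable h) :
    Measurable fun a => J.piecewise (f a) (h a) := by
  rw [measurable_pi_iff]
  intro i
  by_cases hi : i ∈ J
  · simp only [Finset.piecewise, hi, if_true]; fun_prop
  · simp only [Finset.piecewise, hi, if_false]; fun_prop

variable {μ : Measure S} [IsProbabilityMeasure μ] {φ : Measure F} [IsProbabilityMeasure φ]
  {ν : Measure Y} [IsProbabilityMeasure ν] {r : ℝ} {q : ℕ → ℝ}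

/-- A variable moved to the parameter counts as one more member of the conditioning set, hence the
shift of `q`. -/
theorem MomentCond.kerF {g : F × Y × (Fin (k + 1) → S) → B} (hg : Measurable g)
    {J : Finset (Fin k)} (h : MomentCond r μ φ ν q g (insert 0 (J.map (Fin.succEmb k)))) :
    MomentCond r μ (φ.prod μ) ν (fun j => q (j + 1)) (kerF g) J := by
  unfold MomentCond at h ⊢
  rw [card_insert_map_succ] at h
  have hgF := measurable_kerF hg
  rw [lintegral_prod _ (Measurable.aemeasurable (by fun_prop))]
  refine lt_of_eq_of_lt (lintegral_congr fun a => ?_) h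
  rw [lintegral_vecLaw_succ μ (by fun_prop)]
  refine lintegral_congr fun z => lintegral_congr fun x => ?_
  congr 1
  refine lintegral_congr fun y => ?_
  rw [lintegral_vecLaw_succ μ (by fun_prop)]
  simp only [piecewise_vcons_insert, lintegral_const, measure_univ, mul_one]
  rfl

theorem momentCond_map_succ_iff {g : F × Y × (Fin (k + 1) → S) → B} (hg : Measurable g)
    {J : Finset (Fin k)} :
    MomentCond r μ φ ν q g (J.map (Fin.succEmb k)) ↔
      ∫⁻ a, ∫⁻ x, (∫⁻ y, ∫⁻ z, ∫⁻ x', ‖g (a, y, vcons z (J.piecewise x x'))‖ₑ ^ r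
        ∂(vecLaw μ k) ∂μ ∂ν) ^ (q J.card / r) ∂(vecLaw μ k) ∂φ < ∞ := by
  unfold MomentCond
  rw [Finset.card_map]
  refine iff_of_eq ?_
  congr 1
  refine lintegral_congr fun a => ?_
  rw [lintegral_vecLaw_succ μ (by fun_prop)]
  have : ∀ z, ∫⁻ v, (∫⁻ y, ∫⁻ x', ‖g (a, y, (J.map (Fin.succEmb k)).piecewise (vcons z v) x')‖ₑ ^ r
      ∂(vecLaw μ (k + 1)) ∂ν) ^ (q J.card / r) ∂(vecLaw μ k) =
      ∫⁻ x, (∫⁻ y, ∫⁻ z, ∫⁻ x', ‖g (a, y, vcons z (J.piecewise x x'))‖ₑ ^ r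
        ∂(vecLaw μ k) ∂μ ∂ν) ^ (q J.card / r) ∂(vecLaw μ k) := by
    intro z
    refine lintegral_congr fun x => ?_
    congr 1
    refine lintegral_congr fun y => ?_
    rw [lintegral_vecLaw_succ μ (by fun_prop)]
    simp only [piecewise_vcons_map]
  simp only [this, lintegral_const, measure_univ, mul_one]

theorem MomentCond.kerI {g : F × Y × (Fin (k + 1) → S) → B} (hg : Measurable g)
    {J : Finset (Fin k)} (h : MomentCond r μ φ ν q g (J.map (Fin.succEmb k))) :
    MomentCond r μ φ (ν.prod μ) q (kerI g) J := by
  rw [momentCond_map_succ_iff hg] at h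
  unfold MomentCond
  have hgI := measurable_kerI hg
  refine lt_of_eq_of_lt (lintegral_congr fun a => lintegral_congr fun x => ?_) h
  congr 1
  rw [lintegral_prod _ (Measurable.aemeasurable (by fun_prop))]
  rfl

theorem enorm_integral_rpow_le [CompleteSpace B] (hr : 1 ≤ r) {f : S → B} (hf : Measurable f) :
    ‖∫ z, f z ∂μ‖ₑ ^ r ≤ ∫⁻ z, ‖f z‖ₑ ^ r ∂μ := by
  have hr0 : 0 < r := by linarith
  have h1 : ‖∫ z, f z ∂μ‖ₑ ≤ eLpNorm' f r μ := by
    calc ‖∫ z, f z ∂μ‖ₑ ≤ ∫⁻ z, ‖f z‖ₑ ∂μ := enorm_integral_le_lintegral_enorm _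
      _ = eLpNorm' f 1 μ := by simp [eLpNorm']
      _ ≤ eLpNorm' f r μ :=
        eLpNorm'_le_eLpNorm'_of_exponent_le one_pos hr μ hf.aestronglyMeasurable
  rw [← eLpNorm'_rpow_self hr0]
  exact ENNReal.rpow_le_rpow h1 hr0.le

/-- Jensen's inequality: the `r`-th power of the norm of a mean is at most the mean of the `r`-th
powers. -/
theorem MomentCond.kerA [CompleteSpace B] (hr : 1 ≤ r) {g : F × Y × (Fin (k + 1) → S) → B}
    (hg : Measurable g) {J : Finset (Fin k)} (hq : 0 ≤ q J.card)
    (h : MomentCond r μ φ ν q g (J.map (Fin.succEmb k))) :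
    MomentCond r μ φ ν q (kerA μ g) J := by
  have hr0 : 0 < r := by linarith
  rw [momentCond_map_succ_iff hg] at h
  unfold MomentCond
  refine lt_of_le_of_lt (lintegral_mono fun a => lintegral_mono fun x => ?_) h
  refine ENNReal.rpow_le_rpow (lintegral_mono fun y => ?_) (by positivity)
  simp only
  rw [lintegral_lintegral_swap (Measurable.aemeasurable (by fun_prop))]
  refine lintegral_mono fun x' => ?_
  exact enorm_integral_rpow_le hr (by fun_prop)

/-- Events may now depend on the frozen variable through the parameter, so for the original kernel
they involve one variable more; this is the loss of one order. -/
theorem DegenerateCond.kerF {g : F × Y × (Fin (k + 1) → S) → B} {e : ℕ} (hg : Measurable g)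
    (h : DegenerateCond μ φ ν e g) : DegenerateCond μ (φ.prod μ) ν (e - 1) (kerF g) := by
  intro T hT A hA hAT
  set A' : Set (F × Y × (Fin (k + 1) → S)) :=
    (fun p => ((p.1, p.2.2 0), p.2.1, fun i => p.2.2 i.succ)) ⁻¹' A with hA'
  have hA'm : MeasurableSet A' := by
    have : Measurable fun p : F × Y × (Fin (k + 1) → S) =>
        ((p.1, p.2.2 0), p.2.1, fun i : Fin k => p.2.2 i.succ) := by fun_prop
    exact this hA
  have h1 := h (insert 0 (T.map (Fin.succEmb k)))
    (by rw [card_insert_map_succ]; omega) A' hA'm (by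
      intro a y x x' hx
      simp only [hA', Set.mem_preimage]
      rw [hx 0 (by simp)]
      exact hAT _ _ _ _ fun i hi => hx i.succ (by simp [hi]))
  have hmp := measurePreserving_kerF (k := k) μ φ ν
  rw [← integral_indicator hA'm, ← hmp.map_eq, integral_map hmp.measurable.aemeasurable
    (hg.indicator hA'm).aestronglyMeasurable] at h1
  rw [← integral_indicator hA, ← h1]
  rfl

theorem DegenerateCond.kerI {g : F × Y × (Fin (k + 1) → S) → B} {e : ℕ} (hg : Measurable g)
    (h : DegenerateCond μ φ ν e g) : DegenerateCond μ φ (ν.prod μ) (e - 1) (kerI g) := by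
  intro T hT A hA hAT
  set A' : Set (F × Y × (Fin (k + 1) → S)) :=
    (fun p => (p.1, (p.2.1, p.2.2 0), fun i => p.2.2 i.succ)) ⁻¹' A with hA'
  have hA'm : MeasurableSet A' := by
    have : Measurable fun p : F × Y × (Fin (k + 1) → S) =>
        (p.1, (p.2.1, p.2.2 0), fun i : Fin k => p.2.2 i.succ) := by fun_prop
    exact this hA
  have h1 := h (insert 0 (T.map (Fin.succEmb k)))
    (by rw [card_insert_map_succ]; omega) A' hA'm (by
      intro a y x x' hx
      simp only [hA', Set.mem_preimage]
      rw [hx 0 (by simp)]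
      exact hAT _ _ _ _ fun i hi => hx i.succ (by simp [hi]))
  have hmp := measurePreserving_kerI (k := k) μ φ ν
  rw [← integral_indicator hA'm, ← hmp.map_eq, integral_map hmp.measurable.aemeasurable
    (hg.indicator hA'm).aestronglyMeasurable] at h1
  rw [← integral_indicator hA, ← h1]
  rfl

theorem DegenerateCond.kerA {g : F × Y × (Fin (k + 1) → S) → B} {e : ℕ} (hg : Measurable g)
    (hgi : Integrable g (jointLaw μ φ ν (k + 1)))
    (h : DegenerateCond μ φ ν e g) : DegenerateCond μ φ ν e (kerA μ g) := by
  intro T hT A hA hAT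
  set A' : Set (F × Y × (Fin (k + 1) → S)) :=
    (fun p => (p.1, p.2.1, fun i => p.2.2 i.succ)) ⁻¹' A with hA'
  have hA'm : MeasurableSet A' := by
    have : Measurable fun p : F × Y × (Fin (k + 1) → S) =>
        (p.1, p.2.1, fun i : Fin k => p.2.2 i.succ) := by fun_prop
    exact this hA
  have h1 := h (T.map (Fin.succEmb k)) (by rwa [Finset.card_map]) A' hA'm (by
      intro a y x x' hx
      simp only [hA', Set.mem_preimage]
      exact hAT _ _ _ _ fun i hi => hx i.succ (by simp [hi]))
  have hmp := measurePreserving_kerA (k := k) μ φ ν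
  have hint : Integrable (fun p : (F × Y × (Fin k → S)) × S =>
      A'.indicator g (p.1.1, p.1.2.1, vcons p.2 p.1.2.2)) ((jointLaw μ φ ν k).prod μ) :=
    hmp.integrable_comp_of_integrable (hgi.indicator hA'm)
  rw [← integral_indicator hA'm, ← hmp.map_eq, integral_map hmp.measurable.aemeasurable
    (hg.indicator hA'm).aestronglyMeasurable, integral_prod _ hint] at h1
  rw [← integral_indicator hA, ← h1]
  refine integral_congr_ae (Filter.Eventually.of_forall fun p => ?_)
  by_cases hp : p ∈ A
  · have : ∀ z, (p.1, p.2.1, vcons z p.2.2) ∈ A' := fun z => hp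
    simp only [Set.indicator_of_mem hp, Set.indicator_of_mem (this _)]
    rfl
  · have : ∀ z, (p.1, p.2.1, vcons z p.2.2) ∉ A' := fun z => hp
    simp only [Set.indicator_of_notMem hp, Set.indicator_of_notMem (this _), integral_zero]

/-- With no variables left every measurable event is admissible, so all set integrals of the kernel
vanish. -/
theorem DegenerateCond.ae_eq_zero [CompleteSpace B] {g : F × Y × (Fin 0 → S) → B} {e : ℕ}
    (hgi : Integrable g (jointLaw μ φ ν 0)) (h : DegenerateCond μ φ ν e g) (he : 0 < e) :
    ∀ᵐ a ∂φ, ∀ᵐ y ∂ν, g (a, y, Fin.elim0) = 0 := by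
  have h1 : g =ᵐ[jointLaw μ φ ν 0] 0 := by
    refine hgi.ae_eq_zero_of_forall_setIntegral_eq_zero fun A hA _ => ?_
    refine h ∅ (by simpa using he) A hA fun a y x x' _ => ?_
    rw [Subsingleton.elim x x']
  have h2 := Measure.ae_ae_of_ae_prod h1
  filter_upwards [h2] with a ha
  have h3 := Measure.ae_ae_of_ae_prod ha
  filter_upwards [h3] with y hy
  obtain ⟨v, hv⟩ := hy.exists
  rw [Subsingleton.elim Fin.elim0 v]
  exact hv

end Conditions

/-! ### Induction on the order when all moments are available -/

section Main

theorem uTail_order_zero {S B F Y : Type*} [MeasurableSpace S] [NormedAddCommGroup B]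
    [MeasurableSpace F] [MeasurableSpace Y] {μ : Measure S} [IsProbabilityMeasure μ] (r : ℝ)
    (φ : Measure F) [IsProbabilityMeasure φ] (ν : Measure Y) (g : F × Y × (Fin 0 → S) → B)
    (N : ℕ) (t : ℝ) :
    uTail r μ φ ν g N t =
      φ {a | ENNReal.ofReal t < eLpNorm' (fun y => g (a, y, Fin.elim0)) r ν} := by
  have : {p : F × (ℕ → S) | ∃ n ≤ N, ENNReal.ofReal t < uNorm r ν g n p} =
      {a | ENNReal.ofReal t < eLpNorm' (fun y => g (a, y, Fin.elim0)) r ν} ×ˢ Set.univ := by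
    ext p
    simp only [uNorm, usum_order_zero, Set.mem_prod, Set.mem_univ, and_true]
    exact ⟨fun ⟨_, _, h⟩ => h, fun h => ⟨0, Nat.zero_le _, h⟩⟩
  rw [uTail, this, Measure.prod_prod, measure_univ, mul_one]

universe u v

variable {S : Type u} {B : Type v} [MeasurableSpace S] [NormedAddCommGroup B] [NormedSpace ℝ B]
  [CompleteSpace B] [TopologicalSpace.SeparableSpace B] [MeasurableSpace B] [BorelSpace B]
  {μ : Measure S} [IsProbabilityMeasure μ] {r C : ℝ}

theorem momentCond_order_zero_iff {F Y : Type*} [MeasurableSpace F] [MeasurableSpace Y]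
    {φ : Measure F} {ν : Measure Y} (q : ℕ → ℝ) (g : F × Y × (Fin 0 → S) → B) :
    MomentCond r μ φ ν q g ∅ ↔ ∫⁻ a, eLpNorm' (fun y => g (a, y, Fin.elim0)) r ν ^ q 0 ∂φ < ∞ := by
  unfold MomentCond
  refine iff_of_eq ?_
  congr 1
  refine lintegral_congr fun a => ?_
  simp only [lintegral_vecLaw_zero, Finset.card_empty]
  rw [eLpNorm', ← ENNReal.rpow_mul]
  congr 1
  ring

/-- A leaf of the recursion: with no degeneracy left the moment condition applies, otherwise the
kernel is zero almost everywhere. -/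
theorem uSum_order_zero_lt_top {F Y : Type*} [MeasurableSpace F] [MeasurableSpace Y]
    {φ : Measure F} [IsProbabilityMeasure φ] {ν : Measure Y} [IsProbabilityMeasure ν]
    {g : F × Y × (Fin 0 → S) → B} (hr : 1 < r) (hg : Measurable g)
    (hgi : Integrable g (jointLaw μ φ ν 0)) {q : ℕ → ℝ} {e : ℕ} {ρ τ : ℝ} (hρ : 0 < ρ)
    (hE : ExponentCond r 0 e ρ τ q) (hM : e ≤ 0 → ∀ J, MomentCond r μ φ ν q g J)
    (hD : DegenerateCond μ φ ν e g) {η : ℝ} (hη : 0 < η) (hηq : η * 2 ^ q 0 < 1) {ε : ℝ}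
    (hε : 0 < ε) : uSum r η μ φ ν ρ τ g ε < ∞ := by
  have hr0 : 0 < r := by linarith
  simp only [uSum, uSeries, uTail_order_zero]
  have hHm : Measurable fun a => eLpNorm' (fun y => g (a, y, Fin.elim0)) r ν :=
    measurable_eLpNorm' r ν (f := fun a y => g (a, y, Fin.elim0)) (by fun_prop)
  rcases Nat.eq_zero_or_pos e with he | he
  · have h0 := hE 0 0 0 rfl (by omega)
    simp only [Nat.cast_zero, zero_div, sub_zero, add_zero] at h0
    refine tsum_dyadic_geometric_lt_top hρ h0.1 h0.2 hη.le hηq hε φ hHm ?_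
    exact (momentCond_order_zero_iff _ _).1 (hM he.le ∅)
  · have h0 := hD.ae_eq_zero hgi he
    have hz : ∀ t : ℝ, φ {a | ENNReal.ofReal t < eLpNorm' (fun y => g (a, y, Fin.elim0)) r ν} = 0 := by
      intro t
      refine measure_mono_null (t := {a | ¬ ∀ᵐ y ∂ν, g (a, y, Fin.elim0) = 0}) (fun a ha hz => ?_) h0
      have : eLpNorm' (fun y => g (a, y, Fin.elim0)) r ν = 0 := by
        rw [eLpNorm'_congr_ae (g := 0) hz, eLpNorm'_zero hr0]
      have ha' : ENNReal.ofReal t < eLpNorm' (fun y => g (a, y, Fin.elim0)) r ν := ha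
      rw [this] at ha'
      exact absurd ha' (by simp)
    simp [hz]

/-- Induction through `uSum_le`. Moments are required only for `e ≤ k`: when `e > k`, every leaf
keeps a positive order of degeneracy and vanishes. The level `ε` is quantified inside because each
step multiplies it by `δ / 2`, while `η` is fixed throughout. -/
theorem uSum_lt_top_of_moments (hr : 1 < r) (hC0 : 0 < C) (hC : IsMartingaleConst B μ r C)
    {η : ℝ} (hη : 0 < η) (hη1 : η < 1) (k : ℕ) :
    ∀ {F Y : Type u} [MeasurableSpace F] [MeasurableSpace Y] (φ : Measure F)
      [IsProbabilityMeasure φ] (ν : Measure Y) [IsProbabilityMeasure ν]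
      {g : F × Y × (Fin k → S) → B} {q : ℕ → ℝ} {e : ℕ} {ρ τ ε : ℝ},
      Measurable g → Integrable g (jointLaw μ φ ν k) → 0 < ρ → (∀ j ≤ k, 0 ≤ q j) →
      (∀ j ≤ k, η * 2 ^ q j < 1) → ExponentCond r k e ρ τ q →
      (e ≤ k → ∀ J, MomentCond r μ φ ν q g J) → DegenerateCond μ φ ν e g → 0 < ε →
      uSum r η μ φ ν ρ τ g ε < ∞ := by
  obtain ⟨δ, hδ, hδ4, hδη⟩ := exists_goodLambda_delta hr hC0 hη
  induction k with
  | zero =>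
    intro F Y _ _ φ _ ν _ g q e ρ τ ε hg hgi hρ _ hηq hE hM hD hε
    exact uSum_order_zero_lt_top hr hg hgi hρ hE hM hD hη (hηq 0 le_rfl) hε
  | succ k ih =>
    intro F Y _ _ φ _ ν _ g q e ρ τ ε hg hgi hρ hq hηq hE hM hD hε
    refine (uSum_le hr hC0 hC hη hη1 hδ hδ4 hδη hg hgi ρ τ hε).trans_lt ?_
    refine ENNReal.mul_lt_top (by simp) (ENNReal.add_lt_top.2 ⟨ENNReal.add_lt_top.2 ⟨?_, ?_⟩, ?_⟩)
    · exact ih (φ.prod μ) ν (measurable_kerF hg) (integrable_kerF hgi) (by linarith)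
        (fun j hj => hq (j + 1) (by omega)) (fun j hj => hηq (j + 1) (by omega)) hE.kerF
        (fun he J => (hM (by omega) _).kerF hg) (hD.kerF hg) (by positivity)
    · exact ih φ (ν.prod μ) (measurable_kerI hg) (integrable_kerI hgi) hρ
        (fun j hj => hq j (by omega)) (fun j hj => hηq j (by omega)) hE.kerI
        (fun he J => (hM (by omega) _).kerI hg) (hD.kerI hg) (by positivity)
    · exact ih φ ν (measurable_kerA μ hg) (integrable_kerA hgi) hρ
        (fun j hj => hq j (by omega)) (fun j hj => hηq j (by omega)) hE.kerA
        (fun he J => (hM (by omega) _).kerA hr.le hg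
          (hq _ ((Finset.card_le_univ J).trans (by simp)))) (hD.kerA hg hgi) (by positivity)

end Main

end UStat

/-! ### Minkowski's inequality and pointwise truncation bounds -/

namespace UStat

section Minkowski

variable {S Y : Type*} [MeasurableSpace S] [MeasurableSpace Y] {μ : Measure S} [SFinite μ]
  {ν : Measure Y} [IsProbabilityMeasure ν]

/-- Minkowski's integral inequality. -/
theorem lintegral_rpow_lintegral_le {r : ℝ} (hr : 1 < r) {f : S × Y → ℝ≥0∞} (hf : Measurable f) :
    (∫⁻ y, (∫⁻ z, f (z, y) ∂μ) ^ r ∂ν) ^ (1 / r) ≤ ∫⁻ z, (∫⁻ y, f (z, y) ^ r ∂ν) ^ (1 / r) ∂μ := by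
  have hr0 : 0 < r := by linarith
  set G : Y → ℝ≥0∞ := fun y => ∫⁻ z, f (z, y) ∂μ with hG
  have hGm : Measurable G := by fun_prop
  set M := ∫⁻ z, (∫⁻ y, f (z, y) ^ r ∂ν) ^ (1 / r) ∂μ with hM
  have hpq : r.HolderConjugate (r / (r - 1)) := Real.HolderConjugate.conjExponent hr
  -- Truncating `G` at `n` makes the `r`-th moment finite, so that it can be divided out after
  -- Hölder's inequality.
  have key : ∀ n : ℕ, ∫⁻ y, (min (G y) n) ^ r ∂ν ≤ M ^ r := by
    intro n
    set h : Y → ℝ≥0∞ := fun y => min (G y) n with hh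
    have hhm : Measurable h := hGm.min measurable_const
    set I := ∫⁻ y, h y ^ r ∂ν with hI
    have hItop : I ≠ ∞ := by
      refine ne_of_lt (lt_of_le_of_lt (lintegral_mono (g := fun _ => (n : ℝ≥0∞) ^ r) fun y => ?_) ?_)
      · exact ENNReal.rpow_le_rpow (min_le_right _ _) hr0.le
      · simpa using ENNReal.rpow_lt_top_of_nonneg hr0.le (ENNReal.natCast_ne_top n)
    have h1 : I ≤ M * I ^ (1 / (r / (r - 1))) := by
      calc I ≤ ∫⁻ y, ∫⁻ z, f (z, y) * h y ^ (r - 1) ∂μ ∂ν := by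
            refine lintegral_mono fun y => ?_
            rw [lintegral_mul_const _ (by fun_prop)]
            calc h y ^ r = h y * h y ^ (r - 1) := by
                  conv_rhs => rw [← ENNReal.rpow_one (h y)]
                  rw [← ENNReal.rpow_mul, one_mul,
                    ← ENNReal.rpow_add_of_nonneg _ _ (by norm_num) (by linarith)]
                  congr 1; ring
              _ ≤ G y * h y ^ (r - 1) := by gcongr; exact min_le_left _ _
        _ = ∫⁻ z, ∫⁻ y, f (z, y) * h y ^ (r - 1) ∂ν ∂μ := by
            rw [lintegral_lintegral_swap (Measurable.aemeasurable (by fun_prop))]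
        _ ≤ ∫⁻ z, (∫⁻ y, f (z, y) ^ r ∂ν) ^ (1 / r) * I ^ (1 / (r / (r - 1))) ∂μ := by
            refine lintegral_mono fun z => ?_
            refine (ENNReal.lintegral_mul_le_Lp_mul_Lq ν hpq (f := fun y => f (z, y))
              (g := fun y => h y ^ (r - 1)) (Measurable.aemeasurable (by fun_prop))
              (Measurable.aemeasurable (by fun_prop))).trans (le_of_eq ?_)
            congr 2
            refine lintegral_congr fun y => ?_
            rw [← ENNReal.rpow_mul]
            congr 1
            have : r - 1 ≠ 0 := by linarith
            field_simp
        _ = M * I ^ (1 / (r / (r - 1))) := by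
            rw [lintegral_mul_const _ (by fun_prop)]
    rcases eq_or_ne I 0 with h0 | h0
    · rw [h0]; exact zero_le
    · have h2 : I = I ^ (1 / r) * I ^ (1 / (r / (r - 1))) := by
        rw [← ENNReal.rpow_add _ _ h0 hItop]
        have := hpq.inv_add_inv_eq_one
        rw [one_div, one_div, this, ENNReal.rpow_one]
      have h3 : I ^ (1 / r) ≤ M := by
        have h4 : I ^ (1 / (r / (r - 1))) ≠ 0 := by
          simp [ENNReal.rpow_eq_zero_iff, h0, hItop]
        have h5 : I ^ (1 / (r / (r - 1))) ≠ ∞ := by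
          refine (ENNReal.rpow_lt_top_of_nonneg ?_ hItop).ne
          have : 0 < r - 1 := by linarith
          positivity
        refine (ENNReal.mul_le_mul_iff_left h4 h5).1 ?_
        rw [← h2]; exact h1
      calc I = (I ^ (1 / r)) ^ r := by
            rw [← ENNReal.rpow_mul, one_div, inv_mul_cancel₀ hr0.ne', ENNReal.rpow_one]
        _ ≤ M ^ r := ENNReal.rpow_le_rpow h3 hr0.le
  have hsup : ∫⁻ y, G y ^ r ∂ν ≤ M ^ r := by
    have e : ∀ y, G y ^ r = ⨆ n : ℕ, (min (G y) n) ^ r := by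
      intro y
      have h1 : G y = ⨆ n : ℕ, min (G y) (n : ℝ≥0∞) := by
        rw [← inf_iSup_eq, ENNReal.iSup_natCast, inf_top_eq]
      conv_lhs => rw [h1]
      exact ((ENNReal.orderIsoRpow r hr0).map_iSup _)
    simp only [e]
    rw [lintegral_iSup]
    · exact iSup_le key
    · intro n
      exact (hGm.min measurable_const).pow_const r
    · intro n m hnm y
      refine ENNReal.rpow_le_rpow (min_le_min le_rfl ?_) hr0.le
      exact_mod_cast hnm
  calc (∫⁻ y, G y ^ r ∂ν) ^ (1 / r) ≤ (M ^ r) ^ (1 / r) :=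
        ENNReal.rpow_le_rpow hsup (by positivity)
    _ = M := by rw [← ENNReal.rpow_mul, one_div, mul_inv_cancel₀ hr0.ne', ENNReal.rpow_one]

theorem eLpNorm'_integral_le {B : Type*} [NormedAddCommGroup B] [NormedSpace ℝ B]
    [MeasurableSpace B] [OpensMeasurableSpace B] {r : ℝ} (hr : 1 < r) {f : S → Y → B}
    (hf : Measurable fun p : S × Y => f p.1 p.2) :
    eLpNorm' (fun y => ∫ z, f z y ∂μ) r ν ≤ ∫⁻ z, eLpNorm' (f z) r ν ∂μ := by
  have hr0 : 0 < r := by linarith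
  calc eLpNorm' (fun y => ∫ z, f z y ∂μ) r ν
      ≤ (∫⁻ y, (∫⁻ z, ‖f z y‖ₑ ∂μ) ^ r ∂ν) ^ (1 / r) := by
        unfold eLpNorm'
        gcongr with y
        exact enorm_integral_le_lintegral_enorm _
    _ ≤ _ := lintegral_rpow_lintegral_le hr (f := fun p => ‖f p.1 p.2‖ₑ) hf.enorm

end Minkowski

section Pointwise

theorem le_rpow_mul_rpow_of_le {H : ℝ≥0∞} {t q : ℝ} (ht : 0 < t) (hq : 0 < q) (hq1 : q ≤ 1)
    (hH : H ≤ ENNReal.ofReal t) : H ≤ ENNReal.ofReal (t ^ (1 - q)) * H ^ q := by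
  calc H = H ^ (1 - q) * H ^ q := by
        rw [← ENNReal.rpow_add_of_nonneg _ _ (by linarith) hq.le]; simp
    _ ≤ _ := by
        gcongr
        rw [← ENNReal.ofReal_rpow_of_pos ht]
        exact ENNReal.rpow_le_rpow hH (by linarith)

theorem le_rpow_mul_rpow_of_ge {H : ℝ≥0∞} {t q : ℝ} (ht : 0 < t) (hq1 : 1 < q)
    (hH : ENNReal.ofReal t < H) : H ≤ ENNReal.ofReal (t ^ (1 - q)) * H ^ q := by
  have ht0 : 0 < t ^ (1 - q) := by positivity
  rcases eq_or_ne H ∞ with h | h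
  · rw [h, ENNReal.top_rpow_of_pos (by linarith), ENNReal.mul_top (by simpa using ht0)]
  · have hH0 : H ≠ 0 := (lt_of_le_of_lt zero_le hH).ne'
    calc H = H ^ (1 - q) * H ^ q := by
          rw [← ENNReal.rpow_add _ _ hH0 h]; simp
      _ ≤ _ := by
          gcongr
          rw [← ENNReal.ofReal_rpow_of_pos ht, ← neg_sub, ENNReal.rpow_neg, ENNReal.rpow_neg,
            ENNReal.inv_le_inv]
          exact ENNReal.rpow_le_rpow hH.le (by linarith)

/-- The one term whose scale satisfies `t / 2 ^ (i + 1) < H ≤ t / 2 ^ i` already dominates. In this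
form a truncated `r`-th moment becomes a series of tails. -/
theorem trunc_rpow_le_tsum {H : ℝ≥0∞} {t r : ℝ} (ht : 0 < t) (hr : 0 < r)
    (hH : H ≤ ENNReal.ofReal t) :
    ENNReal.ofReal (t ^ (-r)) * H ^ r ≤
      ∑' i : ℕ, if ENNReal.ofReal (t / 2 / 2 ^ i) < H then ENNReal.ofReal ((2 ^ (-r)) ^ i) else 0 := by
  rcases eq_or_ne H 0 with h0 | h0
  · rw [h0, ENNReal.zero_rpow_of_pos hr, mul_zero]; exact zero_le
  have htop : H ≠ ∞ := ne_top_of_le_ne_top ENNReal.ofReal_ne_top hH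
  obtain ⟨u, hu, rfl⟩ : ∃ u : ℝ, 0 < u ∧ H = ENNReal.ofReal u :=
    ⟨H.toReal, ENNReal.toReal_pos h0 htop, (ENNReal.ofReal_toReal htop).symm⟩
  have hut : u ≤ t := (ENNReal.ofReal_le_ofReal_iff ht.le).1 hH
  obtain ⟨i, hi1, hi2⟩ := exists_nat_pow_near_of_lt_one (x := u / t) (y := (1 / 2 : ℝ))
    (by positivity) ((div_le_one ht).2 hut) (by norm_num) (by norm_num)
  refine le_trans ?_ (ENNReal.le_tsum i)
  rw [if_pos]
  · rw [ENNReal.ofReal_rpow_of_pos hu, ← ENNReal.ofReal_mul (by positivity)]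
    refine ENNReal.ofReal_le_ofReal ?_
    calc t ^ (-r) * u ^ r = (u / t) ^ r := by
          rw [Real.div_rpow hu.le ht.le, Real.rpow_neg ht.le]; ring
      _ ≤ ((1 / 2 : ℝ) ^ i) ^ r := Real.rpow_le_rpow (by positivity) hi2 hr.le
      _ = (2 ^ (-r)) ^ i := by
          rw [← Real.rpow_natCast, ← Real.rpow_mul (by norm_num), mul_comm,
            Real.rpow_mul (by norm_num), Real.rpow_natCast, one_div, Real.inv_rpow (by norm_num),
            Real.rpow_neg (by norm_num)]
  · refine (ENNReal.ofReal_lt_ofReal_iff hu).2 ?_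
    rw [lt_div_iff₀ ht] at hi1
    refine lt_of_eq_of_lt ?_ hi1
    rw [one_div, inv_pow, pow_succ]
    field_simp

/-- The probability is at most one if `s < w` and zero otherwise; an essential bound thus gives
polynomial tail bounds of any order `Q`. -/
theorem ofReal_geometric_mul_prob_le {Ω : Type*} [MeasurableSpace Ω] (P : Measure Ω)
    [IsProbabilityMeasure P] {X : Ω → ℝ≥0∞} {s w Q : ℝ} (hs : 0 < s) (hQ : 0 ≤ Q)
    (hX : ∀ᵐ a ∂P, X a ≤ ENNReal.ofReal w) :
    P {a | ENNReal.ofReal s < X a} ≤ ENNReal.ofReal ((w / s) ^ Q) := by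
  by_cases h : s < w
  · refine prob_le_one.trans ?_
    rw [← ENNReal.ofReal_one]
    exact ENNReal.ofReal_le_ofReal (Real.one_le_rpow ((one_le_div hs).2 h.le) hQ)
  · refine (le_of_eq ?_).trans zero_le
    refine measure_mono_null (t := {a | ¬ X a ≤ ENNReal.ofReal w}) (fun a ha hXa => ?_) hX
    have ha' : ENNReal.ofReal s < X a := ha
    exact absurd (ha'.trans_le hXa) (not_lt.2 (ENNReal.ofReal_le_ofReal (not_lt.1 h)))

end Pointwise

end UStat

/-! ### Truncated kernels of order one -/

namespace UStat

section Truncation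

variable {S B F Y : Type*} [MeasurableSpace S] [NormedAddCommGroup B] [NormedSpace ℝ B]
  [CompleteSpace B] [TopologicalSpace.SeparableSpace B] [MeasurableSpace B] [BorelSpace B]
  [MeasurableSpace F] [MeasurableSpace Y]
  {μ : Measure S} [IsProbabilityMeasure μ] {φ : Measure F} [IsProbabilityMeasure φ]
  {ν : Measure Y} [IsProbabilityMeasure ν] {r : ℝ}

/-- The `L^r(ν)` norm of a kernel of order one. -/
noncomputable def oneNorm (r : ℝ) (ν : Measure Y) (g : F × Y × (Fin 1 → S) → B) (p : F × S) :
    ℝ≥0∞ :=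
  eLpNorm' (fun y => kerF g (p, y, Fin.elim0)) r ν

open scoped Classical in
/-- The restriction of a kernel of order one to the event that its norm is at most `t`. -/
noncomputable def truncKer (r : ℝ) (ν : Measure Y) (t : ℝ) (g : F × Y × (Fin 1 → S) → B) :
    F × Y × (Fin 1 → S) → B :=
  fun p => if oneNorm r ν g (p.1, p.2.2 0) ≤ ENNReal.ofReal t then g p else 0

theorem measurable_oneNorm {g : F × Y × (Fin 1 → S) → B} (hg : Measurable g) :
    Measurable (oneNorm r ν g) := by
  have hgF := measurable_kerF hg
  exact measurable_eLpNorm' r ν (f := fun p y => kerF g (p, y, Fin.elim0)) (by fun_prop)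

theorem measurableSet_truncKer {g : F × Y × (Fin 1 → S) → B} (hg : Measurable g) (t : ℝ) :
    MeasurableSet {p : F × Y × (Fin 1 → S) |
      oneNorm r ν g (p.1, p.2.2 0) ≤ ENNReal.ofReal t} := by
  have h := measurable_oneNorm (r := r) (ν := ν) hg
  exact measurableSet_le (by fun_prop) measurable_const

theorem measurable_truncKer {g : F × Y × (Fin 1 → S) → B} (hg : Measurable g) (t : ℝ) :
    Measurable (truncKer r ν t g) :=
  Measurable.ite (measurableSet_truncKer hg t) hg measurable_const

theorem integrable_truncKer {g : F × Y × (Fin 1 → S) → B} (hg : Measurable g)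
    (hgi : Integrable g (jointLaw μ φ ν 1)) (t : ℝ) :
    Integrable (truncKer r ν t g) (jointLaw μ φ ν 1) := by
  have : truncKer r ν t g = Set.indicator {p : F × Y × (Fin 1 → S) |
      oneNorm r ν g (p.1, p.2.2 0) ≤ ENNReal.ofReal t} g := by
    ext p
    by_cases h : oneNorm r ν g (p.1, p.2.2 0) ≤ ENNReal.ofReal t <;>
      simp [truncKer, Set.indicator, h]
  rw [this]
  exact hgi.indicator (measurableSet_truncKer hg t)

open scoped Classical in
theorem oneNorm_truncKer (hr : 0 < r) (g : F × Y × (Fin 1 → S) → B) (t : ℝ) (p : F × S) :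
    oneNorm r ν (truncKer r ν t g) p =
      if oneNorm r ν g p ≤ ENNReal.ofReal t then oneNorm r ν g p else 0 := by
  by_cases h : oneNorm r ν g p ≤ ENNReal.ofReal t
  · rw [if_pos h]
    conv_lhs => unfold oneNorm
    conv_rhs => unfold oneNorm
    simp only [kerF, truncKer, vcons_zero, Prod.mk.eta, h, if_true]
  · rw [if_neg h, oneNorm]
    simp only [kerF, truncKer, vcons_zero, Prod.mk.eta, h, if_false]
    exact eLpNorm'_zero hr

theorem uTail_kerF_order_one (g : F × Y × (Fin 1 → S) → B) (N : ℕ) (t : ℝ) :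
    uTail r μ (φ.prod μ) ν (kerF g) N t =
      (φ.prod μ) {p | ENNReal.ofReal t < oneNorm r ν g p} :=
  uTail_order_zero r (φ.prod μ) ν (kerF g) N t

theorem uTail_kerF_truncKer_le (hr : 0 < r) (g : F × Y × (Fin 1 → S) → B) (t : ℝ) (N : ℕ) (s : ℝ) :
    uTail r μ (φ.prod μ) ν (kerF (truncKer r ν t g)) N s ≤
      uTail r μ (φ.prod μ) ν (kerF g) N s := by
  rw [uTail_kerF_order_one, uTail_kerF_order_one]
  refine measure_mono fun p (hp : ENNReal.ofReal s < _) => ?_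
  rw [oneNorm_truncKer hr] at hp
  split_ifs at hp with h
  · exact hp
  · exact absurd hp (by simp)

/-- Truncation leaves the sums unchanged unless one of the `N` summands has norm above `t`. -/
theorem uTail_le_truncKer {g : F × Y × (Fin 1 → S) → B} (hg : Measurable g) (N : ℕ) (s t : ℝ) :
    uTail r μ φ ν g N s ≤ N * uTail r μ (φ.prod μ) ν (kerF g) N t +
      uTail r μ φ ν (truncKer r ν t g) N s := by
  refine le_trans ?_ (add_le_add (measure_kerF_le r hg N t) le_rfl)
  refine le_trans (measure_mono ?_) (measure_union_le _ _)
  rintro p ⟨n, hn, hp⟩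
  by_cases h : ∃ j < N, ENNReal.ofReal t < uNorm r ν (kerF g) j ((p.1, p.2 j), p.2)
  · exact Or.inl h
  · refine Or.inr ⟨n, hn, hp.trans_eq ?_⟩
    push Not at h
    unfold uNorm
    congr 1
    ext y
    rw [usum_succ, usum_succ]
    refine Finset.sum_congr rfl fun j hj => ?_
    rw [usum_order_zero, usum_order_zero]
    have h1 := h j ((Finset.mem_range.1 hj).trans_le hn)
    simp only [uNorm, usum_order_zero] at h1
    have h2 : oneNorm r ν g (p.1, p.2 j) ≤ ENNReal.ofReal t := h1
    simp only [truncKer, vcons_zero, h2, if_true]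

/-- Markov's inequality for the `r`-th power; by Tonelli this moment is that of the truncated norm,
which is then expanded into tails. -/
theorem uTail_kerI_truncKer_le (hr : 1 < r) {g : F × Y × (Fin 1 → S) → B} (hg : Measurable g)
    {t s : ℝ} (ht : 0 < t) (hs : 0 < s) (N : ℕ) :
    uTail r μ φ (ν.prod μ) (kerI (truncKer r ν t g)) N s ≤ ENNReal.ofReal ((t / s) ^ r) *
      ∑' i : ℕ, ENNReal.ofReal ((2 ^ (-r)) ^ i) *
        (φ.prod μ) {p | ENNReal.ofReal (t / 2 / 2 ^ i) < oneNorm r ν g p} := by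
  have hr0 : 0 < r := by linarith
  have hg' := measurable_truncKer (r := r) (ν := ν) hg t
  have hH := measurable_oneNorm (r := r) (ν := ν) hg
  have hgI := measurable_kerI hg'
  have hsr : ENNReal.ofReal s ^ r = ENNReal.ofReal (s ^ r) := ENNReal.ofReal_rpow_of_pos hs
  rw [uTail_order_zero]
  have hXm : Measurable fun a => eLpNorm' (fun y => kerI (truncKer r ν t g) (a, y, Fin.elim0)) r
      (ν.prod μ) :=
    measurable_eLpNorm' r (ν.prod μ)
      (f := fun a y => kerI (truncKer r ν t g) (a, y, Fin.elim0)) (by fun_prop)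
  have h1 := mul_meas_ge_le_lintegral₀ (μ := φ) (hXm.pow_const r).aemeasurable
    (ENNReal.ofReal s ^ r)
  have h2 : ∫⁻ a, eLpNorm' (fun y => kerI (truncKer r ν t g) (a, y, Fin.elim0)) r (ν.prod μ) ^ r ∂φ
      ≤ ENNReal.ofReal (t ^ r) * ∑' i : ℕ, ENNReal.ofReal ((2 ^ (-r)) ^ i) *
        (φ.prod μ) {p | ENNReal.ofReal (t / 2 / 2 ^ i) < oneNorm r ν g p} := by
    have e1 : ∀ a, eLpNorm' (fun y => kerI (truncKer r ν t g) (a, y, Fin.elim0)) r (ν.prod μ) ^ r =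
        ∫⁻ z, oneNorm r ν (truncKer r ν t g) (a, z) ^ r ∂μ := by
      intro a
      rw [eLpNorm'_rpow_self hr0, lintegral_prod_symm' _ (by fun_prop)]
      refine lintegral_congr fun z => ?_
      rw [oneNorm, eLpNorm'_rpow_self hr0]
      rfl
    have hm : ∀ i : ℕ, MeasurableSet {p | ENNReal.ofReal (t / 2 / 2 ^ i) < oneNorm r ν g p} :=
      fun i => measurableSet_lt measurable_const hH
    have hH' := measurable_oneNorm (r := r) (ν := ν) hg'
    calc ∫⁻ a, eLpNorm' (fun y => kerI (truncKer r ν t g) (a, y, Fin.elim0)) r (ν.prod μ) ^ r ∂φ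
        = ∫⁻ p, oneNorm r ν (truncKer r ν t g) p ^ r ∂(φ.prod μ) := by
          simp only [e1]
          rw [lintegral_prod _ (Measurable.aemeasurable (by fun_prop))]
      _ ≤ ∫⁻ p, ENNReal.ofReal (t ^ r) * ∑' i : ℕ,
          (if ENNReal.ofReal (t / 2 / 2 ^ i) < oneNorm r ν g p then
            ENNReal.ofReal ((2 ^ (-r)) ^ i) else 0) ∂(φ.prod μ) := by
          refine lintegral_mono fun p => ?_
          simp only [oneNorm_truncKer hr0]
          split_ifs with h
          · have h3 := mul_le_mul_right (trunc_rpow_le_tsum ht hr0 h) (ENNReal.ofReal (t ^ r))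
            rw [← mul_assoc, ← ENNReal.ofReal_mul (by positivity), ← Real.rpow_add ht,
              add_neg_cancel, Real.rpow_zero, ENNReal.ofReal_one, one_mul] at h3
            exact h3
          · rw [ENNReal.zero_rpow_of_pos hr0]; simp
      _ = _ := by
          rw [lintegral_const_mul' _ _ ENNReal.ofReal_ne_top, lintegral_tsum fun i =>
            (Measurable.ite (hm i) measurable_const measurable_const).aemeasurable]
          congr 1
          refine tsum_congr fun i => ?_
          rw [← lintegral_indicator_const (hm i)]
          simp [Set.indicator_apply]
  have hs0 : ENNReal.ofReal (s ^ r) ≠ 0 := by simpa using by positivity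
  refine (ENNReal.mul_le_mul_iff_right hs0 ENNReal.ofReal_ne_top).1 ?_
  calc ENNReal.ofReal (s ^ r) * φ {a | ENNReal.ofReal s <
        eLpNorm' (fun y => kerI (truncKer r ν t g) (a, y, Fin.elim0)) r (ν.prod μ)}
      ≤ ENNReal.ofReal s ^ r * φ {a | ENNReal.ofReal s ^ r ≤
        eLpNorm' (fun y => kerI (truncKer r ν t g) (a, y, Fin.elim0)) r (ν.prod μ) ^ r} := by
        rw [hsr]
        gcongr with a
        intro ha
        rw [← hsr]
        exact ENNReal.rpow_le_rpow ha.le hr0.le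
    _ ≤ _ := h1.trans h2
    _ = _ := by
        rw [← mul_assoc, ← ENNReal.ofReal_mul (by positivity)]
        congr 2
        rw [Real.div_rpow ht.le hs.le]
        field_simp

/-- The mean of a truncated kernel of order one, when the exponent is at most one or the kernel is
centred. -/
theorem eLpNorm'_kerA_truncKer_le (hr : 1 < r) {g : F × Y × (Fin 1 → S) → B} (hg : Measurable g)
    (hgi : Integrable g (jointLaw μ φ ν 1)) {q : ℝ} (hq : 0 < q)
    (hc : q ≤ 1 ∨ DegenerateCond μ φ ν 1 g) {K : ℝ≥0∞}
    (hK : ∀ a, ∫⁻ z, oneNorm r ν g (a, z) ^ q ∂μ ≤ K) {t : ℝ} (ht : 0 < t) :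
    ∀ᵐ a ∂φ, eLpNorm' (fun y => kerA μ (truncKer r ν t g) (a, y, Fin.elim0)) r ν ≤
      ENNReal.ofReal (t ^ (1 - q)) * K := by
  have hr0 : 0 < r := by linarith
  have hg' := measurable_truncKer (r := r) (ν := ν) hg t
  have hH := measurable_oneNorm (r := r) (ν := ν) hg
  by_cases hq1 : q ≤ 1
  -- For `q ≤ 1` the retained part is estimated directly: a norm at most `t` is at most `t ^ (1 -
  -- q)` times its `q`-th power.
  · refine Filter.Eventually.of_forall fun a => ?_
    calc eLpNorm' (fun y => kerA μ (truncKer r ν t g) (a, y, Fin.elim0)) r ν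
        ≤ ∫⁻ z, oneNorm r ν (truncKer r ν t g) (a, z) ∂μ :=
          eLpNorm'_integral_le hr
            (f := fun z y => truncKer r ν t g (a, y, vcons z Fin.elim0)) (by fun_prop)
      _ ≤ ∫⁻ z, ENNReal.ofReal (t ^ (1 - q)) * oneNorm r ν g (a, z) ^ q ∂μ := by
          refine lintegral_mono fun z => ?_
          simp only [oneNorm_truncKer hr0]
          split_ifs with h
          · exact le_rpow_mul_rpow_of_le ht hq hq1 h
          · simp
      _ ≤ _ := by
          rw [lintegral_const_mul' _ _ ENNReal.ofReal_ne_top]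
          gcongr
          exact hK a
  · push Not at hq1
    have hD : DegenerateCond μ φ ν 1 g := hc.resolve_left (not_le.2 hq1)
    have h0 := (hD.kerA hg hgi).ae_eq_zero (integrable_kerA hgi) one_pos
    have hint : ∀ᵐ a ∂φ, ∀ᵐ y ∂ν, Integrable (fun z => g (a, y, vcons z Fin.elim0)) μ := by
      have h1 := ((measurePreserving_kerA μ φ ν).integrable_comp_of_integrable hgi).prod_right_ae
      filter_upwards [Measure.ae_ae_of_ae_prod h1] with a ha
      filter_upwards [Measure.ae_ae_of_ae_prod ha] with y hy
      obtain ⟨v, hv⟩ := hy.exists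
      rw [Subsingleton.elim Fin.elim0 v]
      exact hv
    filter_upwards [h0, hint] with a ha hai
    -- For `q > 1` the centring turns the mean of the retained part into minus the mean of the
    -- discarded part `g2`, which lives where the norm exceeds `t`.
    set g2 : F × Y × (Fin 1 → S) → B := fun p => g p - truncKer r ν t g p with hg2
    have hg2m : Measurable g2 := hg.sub hg'
    have hval : ∀ y z, g2 (a, y, vcons z Fin.elim0) =
        if oneNorm r ν g (a, z) ≤ ENNReal.ofReal t then 0 else g (a, y, vcons z Fin.elim0) := by
      intro y z
      by_cases h : oneNorm r ν g (a, z) ≤ ENNReal.ofReal t <;> simp [hg2, truncKer, h]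
    have hset : MeasurableSet {z | oneNorm r ν g (a, z) ≤ ENNReal.ofReal t} :=
      measurableSet_le (by fun_prop) measurable_const
    have e1 : ∀ᵐ y ∂ν, ‖kerA μ (truncKer r ν t g) (a, y, Fin.elim0)‖ =
        ‖∫ z, g2 (a, y, vcons z Fin.elim0) ∂μ‖ := by
      filter_upwards [ha, hai] with y hy hyi
      have hti : Integrable (fun z => truncKer r ν t g (a, y, vcons z Fin.elim0)) μ := by
        have : (fun z => truncKer r ν t g (a, y, vcons z Fin.elim0)) =
            Set.indicator {z | oneNorm r ν g (a, z) ≤ ENNReal.ofReal t}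
              fun z => g (a, y, vcons z Fin.elim0) := by
          ext z
          by_cases h : oneNorm r ν g (a, z) ≤ ENNReal.ofReal t <;>
            simp [truncKer, Set.indicator, h]
        rw [this]
        exact hyi.indicator hset
      have h3 : ∫ z, g (a, y, vcons z Fin.elim0) ∂μ = 0 := hy
      simp only [hg2]
      rw [integral_sub hyi hti, h3, zero_sub, norm_neg]
      rfl
    calc eLpNorm' (fun y => kerA μ (truncKer r ν t g) (a, y, Fin.elim0)) r ν
        = eLpNorm' (fun y => ∫ z, g2 (a, y, vcons z Fin.elim0) ∂μ) r ν :=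
          eLpNorm'_congr_norm_ae e1
      _ ≤ ∫⁻ z, eLpNorm' (fun y => g2 (a, y, vcons z Fin.elim0)) r ν ∂μ :=
          eLpNorm'_integral_le hr (f := fun z y => g2 (a, y, vcons z Fin.elim0)) (by fun_prop)
      _ ≤ ∫⁻ z, ENNReal.ofReal (t ^ (1 - q)) * oneNorm r ν g (a, z) ^ q ∂μ := by
          refine lintegral_mono fun z => ?_
          simp only [hval]
          by_cases h : oneNorm r ν g (a, z) ≤ ENNReal.ofReal t
          · simp only [h, if_true]
            refine le_trans (le_of_eq (eLpNorm'_zero hr0)) (by simp)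
          · simp only [h, if_false]
            exact le_rpow_mul_rpow_of_ge ht hq1 (not_le.1 h)
      _ ≤ _ := by
          rw [lintegral_const_mul' _ _ ENNReal.ofReal_ne_top]
          gcongr
          exact hK a

/-- Without centring the mean need not be small, but `H ≤ 1 + H ^ q` bounds it uniformly in the
truncation level. -/
theorem eLpNorm'_kerA_truncKer_le_one_add (hr : 1 < r) {g : F × Y × (Fin 1 → S) → B}
    (hg : Measurable g) {q : ℝ} (hq : 1 ≤ q) {K : ℝ≥0∞}
    (hK : ∀ a, ∫⁻ z, oneNorm r ν g (a, z) ^ q ∂μ ≤ K) (t : ℝ) (a : F) :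
    eLpNorm' (fun y => kerA μ (truncKer r ν t g) (a, y, Fin.elim0)) r ν ≤ 1 + K := by
  have hr0 : 0 < r := by linarith
  have hg' := measurable_truncKer (r := r) (ν := ν) hg t
  have hH := measurable_oneNorm (r := r) (ν := ν) hg
  calc eLpNorm' (fun y => kerA μ (truncKer r ν t g) (a, y, Fin.elim0)) r ν
      ≤ ∫⁻ z, oneNorm r ν (truncKer r ν t g) (a, z) ∂μ :=
        eLpNorm'_integral_le hr
          (f := fun z y => truncKer r ν t g (a, y, vcons z Fin.elim0)) (by fun_prop)
    _ ≤ ∫⁻ z, (1 + oneNorm r ν g (a, z) ^ q) ∂μ := by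
        refine lintegral_mono fun z => ?_
        simp only [oneNorm_truncKer hr0]
        split_ifs with h
        · rcases le_total (oneNorm r ν g (a, z)) 1 with h1 | h1
          · exact h1.trans le_self_add
          · calc oneNorm r ν g (a, z) = oneNorm r ν g (a, z) ^ (1 : ℝ) := by simp
              _ ≤ oneNorm r ν g (a, z) ^ q := ENNReal.rpow_le_rpow_of_exponent_le h1 hq
              _ ≤ _ := le_add_self
        · simp
    _ ≤ _ := by
        rw [lintegral_add_left measurable_const]
        simp only [lintegral_const, measure_univ, mul_one]
        gcongr
        exact hK a

end Truncation

end UStat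

/-! ### Order one with a moment of order below `r` -/

namespace UStat

section OrderOne

variable {S B F Y : Type*} [MeasurableSpace S] [NormedAddCommGroup B] [NormedSpace ℝ B]
  [CompleteSpace B] [TopologicalSpace.SeparableSpace B] [MeasurableSpace B] [BorelSpace B]
  [MeasurableSpace F] [MeasurableSpace Y]
  {μ : Measure S} [IsProbabilityMeasure μ] {φ : Measure F} [IsProbabilityMeasure φ]
  {ν : Measure Y} [IsProbabilityMeasure ν] {r η : ℝ}

theorem uSeries_kerI_truncKer_le (hr : 1 < r) (hη : 0 ≤ η) {g : F × Y × (Fin 1 → S) → B}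
    (hg : Measurable g) {t s : ℝ} (ht : 0 < t) (hs : 0 < s) (N : ℕ) :
    uSeries r η μ φ (ν.prod μ) (kerI (truncKer r ν t g)) N s ≤
      (∑' l : ℕ, ENNReal.ofReal ((η * 2 ^ r) ^ l)) * (ENNReal.ofReal ((t / s) ^ r) *
      ∑' i : ℕ, ENNReal.ofReal ((2 ^ (-r)) ^ i) *
        (φ.prod μ) {p | ENNReal.ofReal (t / 2 / 2 ^ i) < oneNorm r ν g p}) := by
  rw [← ENNReal.tsum_mul_right]
  refine ENNReal.tsum_le_tsum fun l => ?_
  refine (mul_le_mul_right (uTail_kerI_truncKer_le hr hg ht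
    (by positivity : 0 < s / 2 ^ l) N) _).trans (le_of_eq ?_)
  rw [← mul_assoc, ← mul_assoc, ← ENNReal.ofReal_mul (by positivity),
    ← ENNReal.ofReal_mul (by positivity)]
  congr 2
  have e : t / (s / 2 ^ l) = t / s * 2 ^ l := by field_simp
  rw [e, Real.mul_rpow (by positivity) (by positivity), mul_pow, ← Real.rpow_natCast 2 l,
    ← Real.rpow_mul (by norm_num), mul_comm (l : ℝ) r, Real.rpow_mul (by norm_num),
    Real.rpow_natCast]
  ring

theorem uSeries_order_zero_le (hη : 0 ≤ η) {g : F × Y × (Fin 0 → S) → B} {w s Q : ℝ} (hw : 0 ≤ w)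
    (hs : 0 < s) (hQ : 0 ≤ Q)
    (h : ∀ᵐ a ∂φ, eLpNorm' (fun y => g (a, y, Fin.elim0)) r ν ≤ ENNReal.ofReal w) (N : ℕ) :
    uSeries r η μ φ ν g N s ≤
      (∑' l : ℕ, ENNReal.ofReal ((η * 2 ^ Q) ^ l)) * ENNReal.ofReal ((w / s) ^ Q) := by
  rw [← ENNReal.tsum_mul_right]
  refine ENNReal.tsum_le_tsum fun l => ?_
  rw [uTail_order_zero]
  refine (mul_le_mul_right (ofReal_geometric_mul_prob_le φ
    (by positivity : 0 < s / 2 ^ l) hQ h) _).trans (le_of_eq ?_)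
  rw [← ENNReal.ofReal_mul (by positivity), ← ENNReal.ofReal_mul (by positivity)]
  congr 1
  have e : w / (s / 2 ^ l) = w / s * 2 ^ l := by field_simp
  rw [e, Real.mul_rpow (by positivity) (by positivity), mul_pow, ← Real.rpow_natCast 2 l,
    ← Real.rpow_mul (by norm_num), mul_comm (l : ℝ) Q, Real.rpow_mul (by norm_num),
    Real.rpow_natCast]
  ring

/-- The truncation level is the same `t` for all terms of the series, although the `l`-th tail is
taken at `t / 2 ^ l`; the recursion is then applied to the truncated kernel. -/
theorem uSeries_le_truncKer {C δ : ℝ} (hr : 1 < r) (hC0 : 0 < C) (hC : IsMartingaleConst B μ r C)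
    (hη : 0 < η) (hη1 : η < 1) (hδ : 0 < δ) (hδ4 : δ ≤ 1 / 4) (hδη : C * (2 * δ) ^ r ≤ η / 2)
    {g : F × Y × (Fin 1 → S) → B} (hg : Measurable g) (hgi : Integrable g (jointLaw μ φ ν 1))
    {N : ℕ} (hN : 1 ≤ N) {t : ℝ} (ht : 0 < t) :
    uSeries r η μ φ ν g N t ≤
      (∑' l : ℕ, ENNReal.ofReal (η ^ l)) * (N * uTail r μ (φ.prod μ) ν (kerF g) N t) +
      2 * (N * uSeries r η μ (φ.prod μ) ν (kerF g) N (δ / 2 * t) +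
      uSeries r η μ φ (ν.prod μ) (kerI (truncKer r ν t g)) N (δ / 2 * t / N ^ (1 / r)) +
      uSeries r η μ φ ν (kerA μ (truncKer r ν t g)) N (δ / 2 * t / N)) := by
  have h1 := uSeries_le hr hC0 hC hη hη1 hδ hδ4 hδη (measurable_truncKer (r := r) (ν := ν) hg t)
    (integrable_truncKer hg hgi t) hN ht
  calc uSeries r η μ φ ν g N t ≤ ∑' l : ℕ, (ENNReal.ofReal (η ^ l) *
        (N * uTail r μ (φ.prod μ) ν (kerF g) N t) +
        ENNReal.ofReal (η ^ l) * uTail r μ φ ν (truncKer r ν t g) N (t / 2 ^ l)) := by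
        refine ENNReal.tsum_le_tsum fun l => ?_
        rw [← mul_add]
        gcongr
        exact uTail_le_truncKer hg N (t / 2 ^ l) t
    _ = (∑' l : ℕ, ENNReal.ofReal (η ^ l)) * (N * uTail r μ (φ.prod μ) ν (kerF g) N t) +
          uSeries r η μ φ ν (truncKer r ν t g) N t := by
        rw [ENNReal.tsum_add, ENNReal.tsum_mul_right]
        rfl
    _ ≤ _ := by
        refine add_le_add le_rfl (h1.trans ?_)
        gcongr
        exact ENNReal.tsum_le_tsum fun l => mul_le_mul_right
          (uTail_kerF_truncKer_le (by linarith) g t N _) _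

/-- The mean falls below the level `t / N` by a factor of order `2 ^ (-(b * θ))`. If `q ≤ 1` or the
kernel is centred, this comes from `t ^ (1 - q)` and `q * τ ≥ ρ + 1 ≥ θ + 1`. Otherwise `e = 0`: the
mean stays bounded while `t / N` grows like `2 ^ (b * (τ - 1))`, with `τ - 1 ≥ θ`. -/
theorem exists_mean_truncKer_le (hr : 1 < r) {g : F × Y × (Fin 1 → S) → B} (hg : Measurable g)
    (hgi : Integrable g (jointLaw μ φ ν 1)) {q ρ τ θ ε : ℝ} {e : ℕ} (hq : 0 < q) (hε : 0 < ε)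
    (he : e ≤ 1) (hD : DegenerateCond μ φ ν e g) {K : ℝ≥0∞} (hKtop : K ≠ ∞)
    (hK : ∀ a, ∫⁻ z, oneNorm r ν g (a, z) ^ q ∂μ ≤ K) (hρq : ρ + 1 ≤ q * τ) (hθρ : θ ≤ ρ)
    (hθe : e = 0 → θ ≤ τ - 1) :
    ∃ D : ℝ, 0 < D ∧ ∀ b : ℕ, ∀ᵐ a ∂φ,
      eLpNorm' (fun y => kerA μ (truncKer r ν (ε * 2 ^ (b * τ)) g) (a, y, Fin.elim0)) r ν ≤
        ENNReal.ofReal (D * 2 ^ (-(b * θ)) * (ε * 2 ^ (b * τ)) / (2 ^ b : ℕ)) := by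
  set κ := K.toReal with hκ
  have hκ0 : 0 ≤ κ := ENNReal.toReal_nonneg
  have hKκ : K = ENNReal.ofReal κ := (ENNReal.ofReal_toReal hKtop).symm
  have e0 : ∀ b : ℕ, ((2 ^ b : ℕ) : ℝ) = 2 ^ (b : ℝ) := fun b => by
    rw [Real.rpow_natCast]; push_cast; rfl
  refine ⟨κ * ε ^ (-q) + (1 + κ) / ε, by positivity, fun b => ?_⟩
  set t := ε * (2 : ℝ) ^ (b * τ) with ht
  have ht0 : 0 < t := by positivity
  rw [e0]
  by_cases hc : q ≤ 1 ∨ DegenerateCond μ φ ν 1 g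
  · filter_upwards [eLpNorm'_kerA_truncKer_le hr hg hgi hq hc hK ht0] with a ha
    refine ha.trans ?_
    rw [hKκ, ← ENNReal.ofReal_mul (by positivity)]
    refine ENNReal.ofReal_le_ofReal ?_
    have h1 : t ^ (1 - q) = t * (ε ^ (-q) * 2 ^ (-(b * (q * τ)))) := by
      rw [sub_eq_add_neg, Real.rpow_add ht0, Real.rpow_one]
      congr 1
      rw [ht, Real.mul_rpow hε.le (by positivity), ← Real.rpow_mul (by norm_num)]
      congr 2; ring
    have h2 : (2 : ℝ) ^ (-(b * (q * τ))) ≤ 2 ^ (-(b * θ)) / 2 ^ (b : ℝ) := by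
      rw [← Real.rpow_sub (by norm_num)]
      refine Real.rpow_le_rpow_of_exponent_le (by norm_num) ?_
      have : (b : ℝ) * (θ + 1) ≤ b * (q * τ) := by
        gcongr; linarith
      linarith
    calc t ^ (1 - q) * κ = (κ * ε ^ (-q)) * t * 2 ^ (-(b * (q * τ))) := by rw [h1]; ring
      _ ≤ (κ * ε ^ (-q) + (1 + κ) / ε) * t * (2 ^ (-(b * θ)) / 2 ^ (b : ℝ)) := by
          gcongr
          have : 0 ≤ (1 + κ) / ε := by positivity
          linarith
      _ = _ := by ring
  · push Not at hc
    have he0 : e = 0 := by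
      rcases Nat.eq_zero_or_pos e with h | h
      · exact h
      · have : e = 1 := by omega
        subst this
        exact absurd hD hc.2
    refine Filter.Eventually.of_forall fun a => ?_
    refine (eLpNorm'_kerA_truncKer_le_one_add hr hg hc.1.le hK t a).trans ?_
    rw [hKκ, ← ENNReal.ofReal_one, ← ENNReal.ofReal_add (by norm_num) hκ0]
    refine ENNReal.ofReal_le_ofReal ?_
    have h2 : (1 : ℝ) ≤ 2 ^ (-(b * θ)) * 2 ^ (b * τ) / 2 ^ (b : ℝ) := by
      rw [← Real.rpow_add (by norm_num), ← Real.rpow_sub (by norm_num)]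
      refine Real.one_le_rpow (by norm_num) ?_
      have : (b : ℝ) * θ ≤ b * (τ - 1) := by
        gcongr; exact hθe he0
      linarith
    calc 1 + κ = (1 + κ) / ε * ε * 1 := by field_simp
      _ ≤ (κ * ε ^ (-q) + (1 + κ) / ε) * ε * (2 ^ (-(b * θ)) * 2 ^ (b * τ) / 2 ^ (b : ℝ)) := by
          gcongr
          have : 0 ≤ κ * ε ^ (-q) := by positivity
          linarith
      _ = _ := by rw [ht]; ring

/-- Every contribution except the mean reduces to tails of `oneNorm`, summable by its `q`-th moment.
The mean is essentially bounded, and the order `(ρ + 1) / θ` in its tail bound turns the gain `2 ^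
(-(b * θ))` into `2 ^ (-(b * (ρ + 1)))`, which beats the weight `2 ^ (b * ρ)`. -/
theorem uSum_order_one_lt_top {C : ℝ} (hr : 1 < r) (hC0 : 0 < C) (hC : IsMartingaleConst B μ r C)
    {g : F × Y × (Fin 1 → S) → B} (hg : Measurable g)
    (hgi : Integrable g (jointLaw μ φ ν 1)) {q ρ τ θ ε : ℝ} {e : ℕ} (hq : 0 < q) (hqr : q < r)
    (hε : 0 < ε) (hρ : 0 < ρ) (hτ : 0 < τ)
    (he : e ≤ 1) (hD : DegenerateCond μ φ ν e g) {K : ℝ≥0∞} (hKtop : K ≠ ∞)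
    (hK : ∀ a, ∫⁻ z, oneNorm r ν g (a, z) ^ q ∂μ ≤ K) (hρq : ρ + 1 ≤ q * τ) (hθ : 0 < θ)
    (hθρ : θ ≤ ρ) (hθe : e = 0 → θ ≤ τ - 1) (hη : 0 < η) (hη1 : η < 1) (hηq : η * 2 ^ q < 1)
    (hηr : η * 2 ^ r < 1) (hηQ : η * 2 ^ ((ρ + 1) / θ) < 1) :
    uSum r η μ φ ν ρ τ g ε < ∞ := by
  have hr0 : 0 < r := by linarith
  obtain ⟨δ, hδ, hδ4, hδη⟩ := exists_goodLambda_delta hr hC0 hη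
  obtain ⟨D, hD0, hDb⟩ := exists_mean_truncKer_le hr hg hgi hq hε he hD hKtop hK hρq hθρ hθe
  have hH := measurable_oneNorm (r := r) (ν := ν) hg
  have hHq : ∫⁻ p, oneNorm r ν g p ^ q ∂(φ.prod μ) < ∞ := by
    rw [lintegral_prod _ (Measurable.aemeasurable (by fun_prop))]
    refine (lintegral_mono fun a => hK a).trans_lt ?_
    simpa using hKtop.lt_top
  have e0 : ∀ b : ℕ, ((2 ^ b : ℕ) : ℝ) = 2 ^ (b : ℝ) := fun b => by
    rw [Real.rpow_natCast]; push_cast; rfl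
  have e4 : ∀ b : ℕ, ENNReal.ofReal (2 ^ (b * ρ)) * ((2 ^ b : ℕ) : ℝ≥0∞) =
      ENNReal.ofReal (2 ^ (b * (ρ + 1))) := fun b => by
    rw [← ENNReal.ofReal_natCast, e0, ← ENNReal.ofReal_mul (by positivity),
      ← Real.rpow_add (by norm_num)]
    congr 2; ring
  set G0 := ∑' l : ℕ, ENNReal.ofReal (η ^ l) with hG0
  set Gr := ∑' l : ℕ, ENNReal.ofReal ((η * 2 ^ r) ^ l) with hGr
  set GQ := ∑' l : ℕ, ENNReal.ofReal ((η * 2 ^ ((ρ + 1) / θ)) ^ l) with hGQ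
  have hG0t : G0 < ∞ := tsum_ofReal_pow_lt_top hη.le hη1
  have hGrt : Gr < ∞ := tsum_ofReal_pow_lt_top (by positivity) hηr
  have hGQt : GQ < ∞ := tsum_ofReal_pow_lt_top (by positivity) hηQ
  set X1 : ℕ → ℝ≥0∞ := fun b => ENNReal.ofReal (2 ^ (b * (ρ + 1))) *
    (φ.prod μ) {p | ENNReal.ofReal (ε * 2 ^ (b * τ)) < oneNorm r ν g p} with hX1
  set X2 : ℕ → ℝ≥0∞ := fun b => ENNReal.ofReal (2 ^ (b * (ρ + 1))) *
    ∑' l : ℕ, ENNReal.ofReal (η ^ l) * (φ.prod μ) {p | ENNReal.ofReal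
      (δ / 2 * ε * 2 ^ (b * τ) / 2 ^ l) < oneNorm r ν g p} with hX2
  set X3 : ℕ → ℝ≥0∞ := fun b => ENNReal.ofReal (2 ^ (b * (ρ + 1))) *
    ∑' l : ℕ, ENNReal.ofReal ((2 ^ (-r)) ^ l) * (φ.prod μ) {p | ENNReal.ofReal
      (ε / 2 * 2 ^ (b * τ) / 2 ^ l) < oneNorm r ν g p} with hX3
  have hX1t : ∑' b, X1 b < ∞ :=
    (tsum_dyadic_measure_le (by linarith) hτ hρq hε (φ.prod μ) hH).trans_lt
      (ENNReal.mul_lt_top ENNReal.ofReal_lt_top hHq)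
  have hX2t : ∑' b, X2 b < ∞ :=
    tsum_dyadic_geometric_lt_top (by linarith) hτ hρq hη.le hηq (by positivity) (φ.prod μ) hH hHq
  have hX3t : ∑' b, X3 b < ∞ := by
    refine tsum_dyadic_geometric_lt_top (by linarith) hτ hρq (by positivity) ?_ (by positivity)
      (φ.prod μ) hH hHq
    -- The ratio `2 ^ (-r) * 2 ^ q` is below one because `q < r`.
    rw [← Real.rpow_add (by norm_num)]
    exact Real.rpow_lt_one_of_one_lt_of_neg (by norm_num) (by linarith)
  set c3 := ENNReal.ofReal ((δ / 2) ^ (-r)) with hc3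
  set c4 := ENNReal.ofReal ((D / (δ / 2)) ^ ((ρ + 1) / θ)) with hc4
  have hterm : ∀ b : ℕ, ENNReal.ofReal (2 ^ (b * ρ)) *
      uSeries r η μ φ ν g (2 ^ b) (ε * 2 ^ (b * τ)) ≤
      G0 * X1 b + 2 * (X2 b + Gr * (c3 * X3 b) +
        GQ * (c4 * ENNReal.ofReal ((1 / 2) ^ b))) := by
    intro b
    set t := ε * (2 : ℝ) ^ (b * τ) with ht
    have ht0 : 0 < t := by positivity
    have hN0 : (0 : ℝ) < (2 ^ b : ℕ) := by positivity
    have h1 := uSeries_le_truncKer hr hC0 hC hη hη1 hδ hδ4 hδη hg hgi (N := 2 ^ b)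
      Nat.one_le_two_pow ht0
    have h3 := uSeries_kerI_truncKer_le (φ := φ) (ν := ν) (μ := μ) hr hη.le hg ht0
      (s := δ / 2 * t / ((2 ^ b : ℕ) : ℝ) ^ (1 / r)) (by positivity) (2 ^ b)
    have h4 := uSeries_order_zero_le (μ := μ) (Q := (ρ + 1) / θ) hη.le (by positivity)
      (s := δ / 2 * t / ((2 ^ b : ℕ) : ℝ)) (by positivity) (by positivity) (hDb b) (2 ^ b)
    have e3 : (t / (δ / 2 * t / ((2 ^ b : ℕ) : ℝ) ^ (1 / r))) ^ r =
        (δ / 2) ^ (-r) * ((2 ^ b : ℕ) : ℝ) := by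
      have : t / (δ / 2 * t / ((2 ^ b : ℕ) : ℝ) ^ (1 / r)) =
          (δ / 2)⁻¹ * ((2 ^ b : ℕ) : ℝ) ^ (1 / r) := by
        field_simp
      rw [this, Real.mul_rpow (by positivity) (by positivity), ← Real.rpow_mul hN0.le,
        one_div, inv_mul_cancel₀ hr0.ne', Real.rpow_one, Real.rpow_neg (by positivity),
        Real.inv_rpow (by positivity)]
    have e5 : (D * 2 ^ (-(b * θ)) * t / ((2 ^ b : ℕ) : ℝ) / (δ / 2 * t / ((2 ^ b : ℕ) : ℝ))) ^
        ((ρ + 1) / θ) = (D / (δ / 2)) ^ ((ρ + 1) / θ) * 2 ^ (-(b * (ρ + 1))) := by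
      have : D * 2 ^ (-(b * θ)) * t / ((2 ^ b : ℕ) : ℝ) / (δ / 2 * t / ((2 ^ b : ℕ) : ℝ)) =
          D / (δ / 2) * 2 ^ (-(b * θ)) := by
        field_simp
      rw [this, Real.mul_rpow (by positivity) (by positivity), ← Real.rpow_mul (by norm_num)]
      congr 2
      field_simp
    rw [e3, ENNReal.ofReal_mul (by positivity), ENNReal.ofReal_natCast] at h3
    rw [e5, ENNReal.ofReal_mul (by positivity)] at h4
    have e6 : ENNReal.ofReal (2 ^ (b * ρ)) * ENNReal.ofReal (2 ^ (-(b * (ρ + 1)))) =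
        ENNReal.ofReal ((1 / 2) ^ b) := by
      rw [← ENNReal.ofReal_mul (by positivity), ← Real.rpow_add (by norm_num)]
      congr 1
      rw [show (b : ℝ) * ρ + -(b * (ρ + 1)) = -b by ring, Real.rpow_neg (by norm_num),
        Real.rpow_natCast, one_div, inv_pow]
    calc ENNReal.ofReal (2 ^ (b * ρ)) * uSeries r η μ φ ν g (2 ^ b) t
        ≤ ENNReal.ofReal (2 ^ (b * ρ)) * _ := mul_le_mul_right h1 _
      _ ≤ ENNReal.ofReal (2 ^ (b * ρ)) * (_ + 2 * (_ + _ + _)) :=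
          mul_le_mul_right (add_le_add le_rfl (mul_le_mul_right
            (add_le_add (add_le_add le_rfl h3) h4) _)) _
      _ = _ := by
          have e7 : uTail r μ (φ.prod μ) ν (kerF g) (2 ^ b) t =
              (φ.prod μ) {p | ENNReal.ofReal t < oneNorm r ν g p} := uTail_kerF_order_one _ _ _
          have e8 : uSeries r η μ (φ.prod μ) ν (kerF g) (2 ^ b) (δ / 2 * t) =
              ∑' l : ℕ, ENNReal.ofReal (η ^ l) * (φ.prod μ) {p | ENNReal.ofReal
                (δ / 2 * ε * 2 ^ (b * τ) / 2 ^ l) < oneNorm r ν g p} := by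
            unfold uSeries
            refine tsum_congr fun l => ?_
            rw [uTail_kerF_order_one, ht, ← mul_assoc]
          have e9 : ∀ l : ℕ, t / 2 / 2 ^ l = ε / 2 * 2 ^ (b * τ) / 2 ^ l := fun l => by
            rw [ht]; ring
          simp only [e7, e8, e9, hX1, hX2, hX3, ← e4, ← e6, hGr, hGQ, hc3, hc4]
          ring
  refine (ENNReal.tsum_le_tsum hterm).trans_lt ?_
  rw [ENNReal.tsum_add, ENNReal.tsum_mul_left, ENNReal.tsum_mul_left, ENNReal.tsum_add,
    ENNReal.tsum_add, ENNReal.tsum_mul_left, ENNReal.tsum_mul_left, ENNReal.tsum_mul_left,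
    ENNReal.tsum_mul_left]
  refine ENNReal.add_lt_top.2 ⟨ENNReal.mul_lt_top hG0t hX1t, ENNReal.mul_lt_top (by simp)
    (ENNReal.add_lt_top.2 ⟨ENNReal.add_lt_top.2 ⟨hX2t, ENNReal.mul_lt_top hGrt
      (ENNReal.mul_lt_top ENNReal.ofReal_lt_top hX3t)⟩, ENNReal.mul_lt_top hGQt
      (ENNReal.mul_lt_top ENNReal.ofReal_lt_top
        (tsum_ofReal_pow_lt_top (by norm_num) (by norm_num)))⟩)⟩

end OrderOne

end UStat

/-! ### Induction on the order when `q 1 < r` -/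

namespace UStat

open scoped Topology

section LowMoments

/-- The relations of `ExponentCond`, where the moment condition is only imposed if at least one
variable is frozen. -/
def ExponentCondPos (r : ℝ) (k e : ℕ) (ρ τ : ℝ) (q : ℕ → ℝ) : Prop :=
  ∀ j a c : ℕ, j + a + c = k → e ≤ a + j →
    0 < τ - a / r - c ∧ (0 < j → ρ + j ≤ q j * (τ - a / r - c))

/-- Once a variable has been frozen every later count `j` stands for `j + 1 > 0`, so the
unrestricted condition holds. -/
theorem ExponentCondPos.kerF {k : ℕ} {r ρ τ : ℝ} {e : ℕ} {q : ℕ → ℝ}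
    (h : ExponentCondPos r (k + 1) e ρ τ q) :
    ExponentCond r k (e - 1) (ρ + 1) τ fun j => q (j + 1) := by
  intro j a c hk he
  have := h (j + 1) a c (by omega) (by omega)
  push_cast at this
  exact ⟨this.1, by linarith [this.2 (by omega)]⟩

theorem ExponentCondPos.kerI {k : ℕ} {r ρ τ : ℝ} {e : ℕ} {q : ℕ → ℝ}
    (h : ExponentCondPos r (k + 1) e ρ τ q) : ExponentCondPos r k (e - 1) ρ (τ - 1 / r) q := by
  intro j a c hk he
  have := h j (a + 1) c (by omega) (by omega)
  push_cast at this
  rw [show τ - 1 / r - a / r - c = τ - (a + 1) / r - c by ring]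
  exact this

theorem ExponentCondPos.kerA {k : ℕ} {r ρ τ : ℝ} {e : ℕ} {q : ℕ → ℝ}
    (h : ExponentCondPos r (k + 1) e ρ τ q) : ExponentCondPos r k e ρ (τ - 1) q := by
  intro j a c hk he
  have := h j a (c + 1) (by omega) (by omega)
  push_cast at this
  rw [show τ - 1 - a / r - c = τ - a / r - (c + 1) by ring]
  exact this

theorem eventually_mul_lt_one (x : ℝ) : ∀ᶠ η in 𝓝[>] (0 : ℝ), η * x < 1 := by
  have h : Filter.Tendsto (fun η : ℝ => η * x) (𝓝[>] 0) (𝓝 (0 * x)) :=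
    (Filter.tendsto_id.mul_const x).mono_left nhdsWithin_le_nhds
  rw [zero_mul] at h
  exact h.eventually_lt_const one_pos

universe u v

variable {S : Type u} {B : Type v} [MeasurableSpace S] [NormedAddCommGroup B] [NormedSpace ℝ B]
  [CompleteSpace B] [TopologicalSpace.SeparableSpace B] [MeasurableSpace B] [BorelSpace B]
  {μ : Measure S} [IsProbabilityMeasure μ] {r C : ℝ}

/-- The parameter space is a single point, so finiteness almost everywhere is finiteness everywhere
with one bound. -/
theorem exists_oneNorm_bound {Y : Type*} [MeasurableSpace Y] (φ : Measure PUnit.{u + 1})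
    [IsProbabilityMeasure φ] (ν : Measure Y) [IsProbabilityMeasure ν]
    {g : PUnit.{u + 1} × Y × (Fin 1 → S) → B} (hg : Measurable g) {q : ℕ → ℝ}
    (hM : MomentCond r μ φ ν q g {0}) :
    ∃ K : ℝ≥0∞, K ≠ ∞ ∧ ∀ a, ∫⁻ z, oneNorm r ν g (a, z) ^ q 1 ∂μ ≤ K := by
  have hM' : MomentCond r μ φ ν q g (insert 0 ((∅ : Finset (Fin 0)).map (Fin.succEmb 0))) := hM
  have h1 := (momentCond_order_zero_iff _ _).1 (hM'.kerF hg)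
  have hH := measurable_oneNorm (r := r) (ν := ν) hg
  have h2 : ∫⁻ p, oneNorm r ν g p ^ q 1 ∂(φ.prod μ) < ∞ := h1
  rw [lintegral_prod _ (Measurable.aemeasurable (by fun_prop))] at h2
  obtain ⟨a, ha⟩ := (ae_lt_top (by fun_prop) h2.ne).exists
  exact ⟨_, ha.ne, fun a' => le_rfl⟩

/-- Branches that have frozen a variable are handed to `uSum_lt_top_of_moments`. The others keep a
one-point parameter space and end at order one by truncation. How small `η` must be depends on the
exponents reached there, hence the filter; it is uniform in the kernel, the laws and `ε`. -/
theorem eventually_uSum_lt_top (hr : 1 < r) (hC0 : 0 < C) (hC : IsMartingaleConst B μ r C)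
    (k : ℕ) :
    ∀ {q : ℕ → ℝ} {e : ℕ} {ρ τ : ℝ}, 0 < ρ → (∀ j, 0 ≤ q j) → 0 < q 1 → q 1 < r →
      ExponentCondPos r (k + 1) e ρ τ q →
      ∀ᶠ η in 𝓝[>] (0 : ℝ), ∀ {Y : Type u} [MeasurableSpace Y] (φ : Measure PUnit.{u + 1})
      [IsProbabilityMeasure φ] (ν : Measure Y) [IsProbabilityMeasure ν]
      {g : PUnit.{u + 1} × Y × (Fin (k + 1) → S) → B} {ε : ℝ},
      Measurable g → Integrable g (jointLaw μ φ ν (k + 1)) →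
      (e ≤ k + 1 → ∀ J, J.Nonempty → MomentCond r μ φ ν q g J) → DegenerateCond μ φ ν e g → 0 < ε →
      uSum r η μ φ ν ρ τ g ε < ∞ := by
  have hr0 : 0 < r := by linarith
  have hev1 := eventually_mul_lt_one 1
  induction k with
  | zero =>
    intro q e ρ τ hρ _ hq1 hqr hE
    by_cases he : e ≤ 1
    · have h1 := hE 1 0 0 rfl (by omega)
      simp only [Nat.cast_zero, zero_div, sub_zero, Nat.cast_one, Nat.one_pos, true_implies] at h1
      -- For `e = 0` the averaged branch supplies `τ - 1 > 0`; for `e = 1` the kernel is centred and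
      -- only `θ ≤ ρ` is needed.
      set θ : ℝ := if e = 0 then min ρ (τ - 1) else ρ with hθ
      have hθ0 : 0 < θ := by
        rw [hθ]
        split_ifs with h
        · have h2 := hE 0 0 1 rfl (by omega)
          simp only [Nat.cast_zero, zero_div, sub_zero, Nat.cast_one] at h2
          exact lt_min hρ h2.1
        · exact hρ
      have hθρ : θ ≤ ρ := by
        rw [hθ]
        split_ifs
        · exact min_le_left _ _
        · exact le_rfl
      have hθe : e = 0 → θ ≤ τ - 1 := by
        intro h
        rw [hθ, if_pos h]
        exact min_le_right _ _
      filter_upwards [hev1, eventually_mul_lt_one (2 ^ q 1), eventually_mul_lt_one (2 ^ r),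
        eventually_mul_lt_one (2 ^ ((ρ + 1) / θ)), self_mem_nhdsWithin] with η hη1 hηq hηr hηQ hη
      intro Y _ φ _ ν _ g ε hg hgi hM hD hε
      obtain ⟨K, hKtop, hK⟩ := exists_oneNorm_bound φ ν hg (hM he {0} (by simp))
      exact uSum_order_one_lt_top hr hC0 hC hg hgi hq1 hqr hε hρ h1.1 he hD hKtop hK h1.2 hθ0 hθρ
        hθe hη (by simpa using hη1) hηq hηr hηQ
    · filter_upwards [hev1, self_mem_nhdsWithin] with η hη1 hη
      intro Y _ φ _ ν _ g ε hg hgi _ hD hε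
      -- Degeneracy exceeds the order, so the exponent condition is vacuous and no moments are
      -- required; any `q` will do.
      refine uSum_lt_top_of_moments hr hC0 hC hη (by simpa using hη1) 1 φ ν (q := fun _ => 0) (e := e)
        hg hgi hρ (fun _ _ => le_rfl) (fun _ _ => by simpa using hη1) ?_ (fun h => absurd h he) hD hε
      intro j a c h1 h2
      omega
  | succ k ih =>
    intro q e ρ τ hρ hq hq1 hqr hE
    have hevq : ∀ᶠ η in 𝓝[>] (0 : ℝ), ∀ j ∈ Finset.range (k + 2), η * 2 ^ q (j + 1) < 1 := by
      rw [Finset.eventually_all]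
      exact fun j _ => eventually_mul_lt_one _
    filter_upwards [hev1, hevq, ih hρ hq hq1 hqr hE.kerI, ih hρ hq hq1 hqr hE.kerA,
      self_mem_nhdsWithin] with η hη1 hηq hI hA hη
    intro Y _ φ _ ν _ g ε hg hgi hM hD hε
    replace hη : 0 < η := hη
    replace hη1 : η < 1 := by simpa using hη1
    obtain ⟨δ, hδ, hδ4, hδη⟩ := exists_goodLambda_delta hr hC0 hη
    refine (uSum_le hr hC0 hC hη hη1 hδ hδ4 hδη hg hgi ρ τ hε).trans_lt ?_
    refine ENNReal.mul_lt_top (by simp) (ENNReal.add_lt_top.2 ⟨ENNReal.add_lt_top.2 ⟨?_, ?_⟩, ?_⟩)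
    · exact uSum_lt_top_of_moments hr hC0 hC hη hη1 (k + 1) (φ.prod μ) ν (measurable_kerF hg)
        (integrable_kerF hgi) (by linarith) (fun j _ => hq (j + 1))
        (fun j hj => hηq j (Finset.mem_range.2 (by omega))) hE.kerF
        (fun he J => (hM (by omega) _ (Finset.insert_nonempty _ _)).kerF hg) (hD.kerF hg)
        (by positivity)
    · exact hI φ (ν.prod μ) (measurable_kerI hg) (integrable_kerI hgi)
        (fun he J hJ => (hM (by omega) _ (hJ.map)).kerI hg) (hD.kerI hg) (by positivity)
    · exact hA φ ν (measurable_kerA μ hg) (integrable_kerA hgi)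
        (fun he J hJ => (hM (by omega) _ (hJ.map)).kerA hr.le hg (hq _)) (hD.kerA hg hgi)
        (by positivity)

end LowMoments

end UStat

/-! ### Frozen moments and transfer to the product law -/

namespace UStat

section Coordinates

variable {S : Type*} [MeasurableSpace S] {m : ℕ}

/-- The indices of the first `j` coordinates. -/
def firstIdx (m j : ℕ) : Finset (Fin m) := Finset.univ.filter fun i => (i : ℕ) < j

@[simp] theorem mem_firstIdx {j : ℕ} {i : Fin m} : i ∈ firstIdx m j ↔ (i : ℕ) < j := by
  simp [firstIdx]

theorem card_firstIdx {j : ℕ} (hj : j ≤ m) : (firstIdx m j).card = j := by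
  have : firstIdx m j = Finset.univ.map (Fin.castLEEmb hj) := by
    ext i
    simp only [mem_firstIdx, Finset.mem_map, Finset.mem_univ, true_and]
    exact ⟨fun h => ⟨⟨i, h⟩, rfl⟩, by rintro ⟨a, rfl⟩; exact a.2⟩
  rw [this, Finset.card_map, Finset.card_univ, Fintype.card_fin]

theorem exists_perm_mem_firstIdx (J : Finset (Fin m)) :
    ∃ σ : Equiv.Perm (Fin m), ∀ i, i ∈ J ↔ σ i ∈ firstIdx m J.card := by
  have hc : Fintype.card {x // x ∈ J} = Fintype.card {x // x ∈ firstIdx m J.card} := by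
    rw [Fintype.card_coe, Fintype.card_coe, card_firstIdx ((Finset.card_le_univ J).trans (by simp))]
  let e := Fintype.equivOfCardEq hc
  exact ⟨e.extendSubtype, fun i => ⟨fun h => e.extendSubtype_mem i h, fun h => by
    by_contra hi
    exact e.extendSubtype_not_mem i hi h⟩⟩

variable (μ : Measure S) [IsProbabilityMeasure μ]

theorem measurePreserving_perm (σ : Equiv.Perm (Fin m)) :
    MeasurePreserving (fun (x : Fin m → S) i => x (σ i)) (vecLaw μ m) (vecLaw μ m) := by
  have hm : Measurable fun (x : Fin m → S) i => x (σ i) := by fun_prop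
  refine ⟨hm, (Measure.pi_eq fun s hs => ?_).symm⟩
  rw [Measure.map_apply hm (MeasurableSet.univ_pi hs)]
  have : (fun (x : Fin m → S) i => x (σ i)) ⁻¹' Set.univ.pi s =
      Set.univ.pi fun i => s (σ.symm i) := by
    ext x
    simp only [Set.mem_preimage, Set.mem_pi, Set.mem_univ, true_imp_iff]
    exact ⟨fun h i => by simpa using h (σ.symm i), fun h i => by simpa using h (σ i)⟩
  rw [this, Measure.pi_pi]
  exact Equiv.prod_comp σ.symm fun i => μ (s i)

theorem measurePreserving_piecewise (J : Finset (Fin m)) :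
    MeasurePreserving (fun p : (Fin m → S) × (Fin m → S) => J.piecewise p.1 p.2)
      ((vecLaw μ m).prod (vecLaw μ m)) (vecLaw μ m) := by
  have hm : Measurable fun p : (Fin m → S) × (Fin m → S) => J.piecewise p.1 p.2 := by fun_prop
  refine ⟨hm, (Measure.pi_eq fun s hs => ?_).symm⟩
  rw [Measure.map_apply hm (MeasurableSet.univ_pi hs)]
  have : (fun p : (Fin m → S) × (Fin m → S) => J.piecewise p.1 p.2) ⁻¹' Set.univ.pi s =
      (Set.univ.pi fun i => if i ∈ J then s i else Set.univ) ×ˢ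
        (Set.univ.pi fun i => if i ∈ J then Set.univ else s i) := by
    ext ⟨x, y⟩
    simp only [Set.mem_preimage, Set.mem_pi, Set.mem_univ, true_imp_iff, Set.mem_prod,
      Finset.piecewise, ← forall_and]
    refine forall_congr' fun i => ?_
    by_cases h : i ∈ J <;> simp [h]
  rw [this, Measure.prod_prod, Measure.pi_pi, Measure.pi_pi, ← Finset.prod_mul_distrib]
  refine Finset.prod_congr rfl fun i _ => ?_
  by_cases h : i ∈ J <;> simp [h]

end Coordinates

section Frozen

variable {S B : Type*} [MeasurableSpace S] [NormedAddCommGroup B] {m : ℕ} {h : (Fin m → S) → B}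

/-- The `r`-th moment of the kernel when the variables with index in `J` are frozen. -/
noncomputable def frozenMoment (r : ℝ) (μ : Measure S) (h : (Fin m → S) → B) (J : Finset (Fin m))
    (x : Fin m → S) : ℝ≥0∞ :=
  ∫⁻ x', ‖h (J.piecewise x x')‖ₑ ^ r ∂(vecLaw μ m)

variable (r : ℝ) (μ : Measure S) [IsProbabilityMeasure μ]

theorem measurable_frozenMoment [MeasurableSpace B] [BorelSpace B] (hh : Measurable h)
    (J : Finset (Fin m)) : Measurable (frozenMoment r μ h J) := by
  have : Measurable fun p : (Fin m → S) × (Fin m → S) => ‖h (J.piecewise p.1 p.2)‖ₑ ^ r := by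
    fun_prop
  exact this.lintegral_prod_right'

theorem frozenMoment_perm [MeasurableSpace B] [BorelSpace B] (hh : Measurable h)
    (hs : IsSymmKernel h) {J J' : Finset (Fin m)} {σ : Equiv.Perm (Fin m)}
    (hσ : ∀ i, i ∈ J ↔ σ i ∈ J') (x : Fin m → S) :
    frozenMoment r μ h J (fun i => x (σ i)) = frozenMoment r μ h J' x := by
  unfold frozenMoment
  rw [← (measurePreserving_perm μ σ).lintegral_comp (by fun_prop)]
  refine lintegral_congr fun y => ?_
  rw [← hs σ (J'.piecewise x y)]
  congr 3
  ext i
  simp only [Finset.piecewise, hσ i]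

theorem lintegral_frozenMoment_perm [MeasurableSpace B] [BorelSpace B] (hh : Measurable h)
    (hs : IsSymmKernel h) (J : Finset (Fin m)) (q : ℝ) :
    ∫⁻ x, frozenMoment r μ h J x ^ q ∂(vecLaw μ m) =
      ∫⁻ x, frozenMoment r μ h (firstIdx m J.card) x ^ q ∂(vecLaw μ m) := by
  obtain ⟨σ, hσ⟩ := exists_perm_mem_firstIdx J
  have := measurable_frozenMoment r μ hh J
  rw [← (measurePreserving_perm μ σ).lintegral_comp (by fun_prop)]
  simp only [frozenMoment_perm r μ hh hs hσ]

/-- Replacing the coordinates outside `J` by an independent copy changes neither the law nor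
membership in `A`. This is the defining property of a conditional expectation given the coordinates
in `J`. -/
theorem setLIntegral_frozenMoment [MeasurableSpace B] [BorelSpace B] (hh : Measurable h)
    (J : Finset (Fin m)) {A : Set (Fin m → S)} (hA : MeasurableSet A)
    (hAJ : ∀ x y, (∀ i ∈ J, x i = y i) → (x ∈ A ↔ y ∈ A)) :
    ∫⁻ x in A, frozenMoment r μ h J x ∂(vecLaw μ m) = ∫⁻ x in A, ‖h x‖ₑ ^ r ∂(vecLaw μ m) := by
  have hm : Measurable fun x => A.indicator (fun x => ‖h x‖ₑ ^ r) x :=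
    Measurable.indicator (by fun_prop) hA
  rw [← lintegral_indicator hA, ← lintegral_indicator hA,
    ← (measurePreserving_piecewise μ J).lintegral_comp hm, lintegral_prod _ (by fun_prop)]
  refine lintegral_congr fun x => ?_
  have h1 : ∀ y, (J.piecewise x y ∈ A ↔ x ∈ A) := fun y =>
    hAJ _ _ fun i hi => by simp [Finset.piecewise, hi]
  by_cases hx : x ∈ A
  · simp [hx, h1, frozenMoment, Set.indicator]
  · simp [hx, h1, Set.indicator]

end Frozen

section Transfer

variable {Ω S B : Type*} [MeasurableSpace Ω] [MeasurableSpace S] {P : Measure Ω}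
  [IsProbabilityMeasure P] {ξ : ℕ → Ω → S} {m : ℕ}

theorem measurePreserving_seq (hξ : ∀ i, Measurable (ξ i)) (hind : iIndepFun ξ P)
    (hid : ∀ i, IdentDistrib (ξ i) (ξ 0) P P) :
    MeasurePreserving (fun ω i => ξ i ω) P (seqLaw (P.map (ξ 0))) := by
  refine ⟨by fun_prop, ?_⟩
  rw [hind.map_fun_eq_infinitePi_map₀' fun i => (hξ i).aemeasurable]
  simp only [(hid _).map_eq]

theorem measurePreserving_initial (hξ : ∀ i, Measurable (ξ i)) (hind : iIndepFun ξ P)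
    (hid : ∀ i, IdentDistrib (ξ i) (ξ 0) P P) :
    MeasurePreserving (initial ξ m) P (vecLaw (P.map (ξ 0)) m) := by
  have := Measure.isProbabilityMeasure_map (μ := P) (hξ 0).aemeasurable
  exact (measurePreserving_seq_comp (P.map (ξ 0)) Fin.val_injective).comp
    (measurePreserving_seq hξ hind hid)

theorem sigmaInitial_le (hξ : ∀ i, Measurable (ξ i)) (j : ℕ) :
    sigmaInitial ξ j ≤ ‹MeasurableSpace Ω› := by
  have : Measurable (initial ξ j) := by unfold initial; fun_prop
  exact this.comap_le

theorem measurable_sigmaInitial_comp {β : Type*} [MeasurableSpace β] {f : (Fin m → S) → β}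
    (hf : Measurable f) {j : ℕ} (hfj : ∀ x y, (∀ i ∈ firstIdx m j, x i = y i) → f x = f y) :
    Measurable[sigmaInitial ξ j] fun ω => f (initial ξ m ω) := by
  rcases isEmpty_or_nonempty Ω with hΩ | ⟨⟨ω₀⟩⟩
  · exact @measurable_of_empty _ _ (sigmaInitial ξ j) _ _ _
  -- The missing coordinates are filled with an arbitrary value, taken from the sequence itself
  -- since `S` is not assumed nonempty.
  let E : (Fin j → S) → Fin m → S := fun v i => if hi : (i : ℕ) < j then v ⟨i, hi⟩ else ξ 0 ω₀
  have hE : Measurable E := by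
    rw [measurable_pi_iff]
    intro i
    by_cases hi : (i : ℕ) < j
    · simp only [E, dif_pos hi]; fun_prop
    · simp only [E, dif_neg hi]; fun_prop
  have : (fun ω => f (initial ξ m ω)) = fun ω => f (E (initial ξ j ω)) := by
    ext ω
    refine hfj _ _ fun i hi => ?_
    rw [mem_firstIdx] at hi
    simp [E, hi, initial]
  rw [this]
  exact (hf.comp hE).comp (comap_measurable _)

theorem exists_measurableSet_of_sigmaInitial {j : ℕ} (hj : j ≤ m) {s : Set Ω}
    (hs : MeasurableSet[sigmaInitial ξ j] s) :
    ∃ A : Set (Fin m → S), MeasurableSet A ∧ initial ξ m ⁻¹' A = s ∧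
      ∀ x y, (∀ i ∈ firstIdx m j, x i = y i) → (x ∈ A ↔ y ∈ A) := by
  obtain ⟨C, hC, rfl⟩ := hs
  have hm : Measurable fun (x : Fin m → S) (i : Fin j) => x (Fin.castLE hj i) := by fun_prop
  refine ⟨_, hm hC, rfl, fun x y hxy => ?_⟩
  have : (fun i : Fin j => x (Fin.castLE hj i)) = fun i => y (Fin.castLE hj i) := by
    ext i
    exact hxy _ (by simp)
  simp only [Set.mem_preimage, this]

variable [NormedAddCommGroup B] [MeasurableSpace B] [BorelSpace B] {h : (Fin m → S) → B}

theorem frozenMoment_initial_ae_eq (hξ : ∀ i, Measurable (ξ i)) (hind : iIndepFun ξ P)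
    (hid : ∀ i, IdentDistrib (ξ i) (ξ 0) P P) (hh : Measurable h) (r : ℝ) {j : ℕ} (hj : j ≤ m) :
    (fun ω => frozenMoment r (P.map (ξ 0)) h (firstIdx m j) (initial ξ m ω)) =ᵐ[P]
      P⁻[fun ω => ‖h (initial ξ m ω)‖ₑ ^ r | sigmaInitial ξ j] := by
  have := Measure.isProbabilityMeasure_map (μ := P) (hξ 0).aemeasurable
  have hmp := measurePreserving_initial (m := m) hξ hind hid
  have hfm := measurable_frozenMoment r (P.map (ξ 0)) hh (firstIdx m j)
  refine ae_eq_condLExp (sigmaInitial_le hξ j) P _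
    (measurable_sigmaInitial_comp hfm fun x y hxy => ?_) fun s hs => ?_
  · unfold frozenMoment
    refine lintegral_congr fun z => ?_
    rw [Finset.piecewise_congr _ hxy fun _ _ => rfl]
  · obtain ⟨A, hA, rfl, hAJ⟩ := exists_measurableSet_of_sigmaInitial hj hs
    rw [hmp.setLIntegral_comp_preimage hA hfm,
      setLIntegral_frozenMoment r _ hh _ hA hAJ]
    exact (hmp.setLIntegral_comp_preimage hA (f := fun x => ‖h x‖ₑ ^ r) (by fun_prop)).symm

theorem lintegral_frozenMoment_lt_top (hξ : ∀ i, Measurable (ξ i)) (hind : iIndepFun ξ P)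
    (hid : ∀ i, IdentDistrib (ξ i) (ξ 0) P P) (hh : Measurable h) {r q : ℝ} (hq : 0 < q) {j : ℕ}
    (hj : j ≤ m) (hH : MemLp (condMoment P ξ h r j) (ENNReal.ofReal q) P) :
    ∫⁻ x, frozenMoment r (P.map (ξ 0)) h (firstIdx m j) x ^ (q / r) ∂(vecLaw (P.map (ξ 0)) m)
      < ∞ := by
  have := Measure.isProbabilityMeasure_map (μ := P) (hξ 0).aemeasurable
  have hfm := measurable_frozenMoment r (P.map (ξ 0)) hh (firstIdx m j)
  have h1 := lintegral_rpow_enorm_lt_top_of_eLpNorm_lt_top (by simpa using hq) (by simp) hH.2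
  rw [← (measurePreserving_initial (m := m) hξ hind hid).lintegral_comp (by fun_prop)]
  refine (le_of_eq (lintegral_congr_ae ?_)).trans_lt h1
  filter_upwards [frozenMoment_initial_ae_eq hξ hind hid hh r hj] with ω hω
  rw [condMoment, enorm_eq_self, ENNReal.toReal_ofReal hq.le, ← ENNReal.rpow_mul, hω]
  congr 1
  ring

/-- The `r`-th moment of the kernel is the mean of its frozen moment, and `M ≤ 1 + M ^ (q / r)`
because `q ≥ r`. This supplies the case `J = ∅` not covered by the hypotheses. -/
theorem lintegral_enorm_rpow_lt_top (hξ : ∀ i, Measurable (ξ i)) (hind : iIndepFun ξ P)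
    (hid : ∀ i, IdentDistrib (ξ i) (ξ 0) P P) (hh : Measurable h) {r q : ℝ} (hr : 0 < r)
    (hq : r ≤ q) {j : ℕ} (hj : j ≤ m)
    (hH : MemLp (condMoment P ξ h r j) (ENNReal.ofReal q) P) :
    ∫⁻ x, ‖h x‖ₑ ^ r ∂(vecLaw (P.map (ξ 0)) m) < ∞ := by
  have := Measure.isProbabilityMeasure_map (μ := P) (hξ 0).aemeasurable
  have h1 := lintegral_frozenMoment_lt_top hξ hind hid hh (hr.trans_le hq) hj hH
  have h2 := setLIntegral_frozenMoment r (P.map (ξ 0)) hh (firstIdx m j) MeasurableSet.univ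
    (by simp)
  rw [Measure.restrict_univ] at h2
  rw [← h2]
  calc ∫⁻ x, frozenMoment r (P.map (ξ 0)) h (firstIdx m j) x ∂(vecLaw (P.map (ξ 0)) m)
      ≤ ∫⁻ x, (1 + frozenMoment r (P.map (ξ 0)) h (firstIdx m j) x ^ (q / r))
          ∂(vecLaw (P.map (ξ 0)) m) := by
        refine lintegral_mono fun x => ?_
        rcases le_total (frozenMoment r (P.map (ξ 0)) h (firstIdx m j) x) 1 with hx | hx
        · exact hx.trans le_self_add
        · refine le_trans ?_ le_add_self
          conv_lhs => rw [← ENNReal.rpow_one (frozenMoment r (P.map (ξ 0)) h (firstIdx m j) x)]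
          exact ENNReal.rpow_le_rpow_of_exponent_le hx ((one_le_div hr).2 hq)
    _ < ∞ := by
        rw [lintegral_add_left measurable_const]
        simpa using h1

end Transfer

/-! ### The kernel `h` with trivial parameter spaces -/

section PointKernel

universe u v

variable {S : Type u} {B : Type v} {m : ℕ}

/-- A kernel of the variables alone, with trivial parameter spaces. -/
def pointKernel (h : (Fin m → S) → B) : PUnit.{u + 1} × PUnit.{u + 1} × (Fin m → S) → B :=
  fun p => h p.2.2

variable [MeasurableSpace S]

theorem measurePreserving_pointKernel (μ : Measure S) [IsProbabilityMeasure μ] :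
    MeasurePreserving (fun p : PUnit.{u + 1} × PUnit.{u + 1} × (Fin m → S) => p.2.2)
      (jointLaw μ (Measure.dirac PUnit.unit) (Measure.dirac PUnit.unit) m) (vecLaw μ m) :=
  measurePreserving_snd.comp measurePreserving_snd

variable [NormedAddCommGroup B] [MeasurableSpace B] [BorelSpace B] {h : (Fin m → S) → B}

theorem momentCond_pointKernel {μ : Measure S} [IsProbabilityMeasure μ] {r : ℝ} {q : ℕ → ℝ}
    {J : Finset (Fin m)}
    (hJ : ∫⁻ x, frozenMoment r μ h J x ^ (q J.card / r) ∂(vecLaw μ m) < ∞) :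
    MomentCond r μ (Measure.dirac PUnit.unit) (Measure.dirac PUnit.unit) q (pointKernel h) J := by
  unfold MomentCond
  simpa only [lintegral_dirac, pointKernel, frozenMoment] using hJ

theorem momentCond_pointKernel_empty {μ : Measure S} [IsProbabilityMeasure μ] {r : ℝ} {q : ℕ → ℝ}
    (hr : 0 < r) (hq : 0 ≤ q 0) (hJ : ∫⁻ x, ‖h x‖ₑ ^ r ∂(vecLaw μ m) < ∞) :
    MomentCond r μ (Measure.dirac PUnit.unit) (Measure.dirac PUnit.unit) q (pointKernel h) ∅ := by
  refine momentCond_pointKernel ?_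
  simp only [frozenMoment, Finset.piecewise_empty, Finset.card_empty, lintegral_const,
    measure_univ, mul_one]
  exact ENNReal.rpow_lt_top_of_nonneg (by positivity) hJ.ne

variable [NormedSpace ℝ B] [CompleteSpace B]

/-- By symmetry a permutation moves `T` into the first `d - 1` coordinates; the event then lies in
`sigmaInitial ξ (d - 1)`, where the conditional expectation vanishes. -/
theorem degenerateCond_pointKernel {Ω : Type*} [MeasurableSpace Ω] {P : Measure Ω}
    [IsProbabilityMeasure P] {ξ : ℕ → Ω → S} (hξ : ∀ i, Measurable (ξ i)) (hind : iIndepFun ξ P)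
    (hid : ∀ i, IdentDistrib (ξ i) (ξ 0) P P) [TopologicalSpace.SeparableSpace B]
    (hh : Measurable h) (hs : IsSymmKernel h) {d : ℕ} (hd : IsDegenerateOfOrder P ξ h d) :
    DegenerateCond (P.map (ξ 0)) (Measure.dirac PUnit.unit) (Measure.dirac PUnit.unit) d
      (pointKernel h) := by
  have hμ := Measure.isProbabilityMeasure_map (μ := P) (hξ 0).aemeasurable
  intro T hT A hA hAT
  have hhs : StronglyMeasurable h := hh.stronglyMeasurable
  obtain ⟨σ, hσ⟩ := exists_perm_mem_firstIdx T
  have hperm := measurePreserving_perm (P.map (ξ 0)) σ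
  have hini := measurePreserving_initial (m := m) hξ hind hid
  have hpt := measurePreserving_pointKernel (m := m) (P.map (ξ 0))
  set A₀ : Set (Fin m → S) := {x | (PUnit.unit, PUnit.unit, x) ∈ A} with hA₀
  have hA₀m : MeasurableSet A₀ := by
    have : Measurable fun x : Fin m → S => ((PUnit.unit, PUnit.unit, x) :
      PUnit.{u + 1} × PUnit.{u + 1} × (Fin m → S)) := by fun_prop
    exact this hA
  have e1 : ∫ p in A, pointKernel h p ∂(jointLaw (P.map (ξ 0)) (Measure.dirac PUnit.unit)
      (Measure.dirac PUnit.unit) m) = ∫ x in A₀, h x ∂(vecLaw (P.map (ξ 0)) m) := by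
    rw [← hpt.map_eq, setIntegral_map hA₀m hhs.aestronglyMeasurable hpt.aemeasurable]
    rfl
  have e2 : ∫ x in A₀, h x ∂(vecLaw (P.map (ξ 0)) m) =
      ∫ x in (fun (x : Fin m → S) i => x (σ i)) ⁻¹' A₀, h x ∂(vecLaw (P.map (ξ 0)) m) := by
    conv_lhs => rw [← hperm.map_eq]
    rw [setIntegral_map hA₀m hhs.aestronglyMeasurable hperm.aemeasurable]
    simp only [hs σ]
  set A₁ : Set (Fin m → S) := (fun (x : Fin m → S) i => x (σ i)) ⁻¹' A₀ with hA₁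
  have hA₁m : MeasurableSet A₁ := hperm.measurable hA₀m
  have e3 : ∫ x in A₁, h x ∂(vecLaw (P.map (ξ 0)) m) =
      ∫ ω in initial ξ m ⁻¹' A₁, h (initial ξ m ω) ∂P := by
    rw [← hini.map_eq, setIntegral_map hA₁m hhs.aestronglyMeasurable hini.aemeasurable]
  have hA₁d : ∀ x y : Fin m → S, (∀ i ∈ firstIdx m (d - 1), x i = y i) →
      ((x ∈ A₁) = (y ∈ A₁)) := by
    intro x y hxy
    refine propext (hAT _ _ _ _ fun i hi => hxy _ ?_)
    have := (hσ i).1 hi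
    rw [mem_firstIdx] at this ⊢
    omega
  have hm : MeasurableSet[sigmaInitial ξ (d - 1)] (initial ξ m ⁻¹' A₁) :=
    @Measurable.setOf _ (sigmaInitial ξ (d - 1)) _
      (measurable_sigmaInitial_comp hA₁m.mem hA₁d)
  rw [e1, e2, e3, ← setIntegral_condExp (sigmaInitial_le hξ _) hd.1 hm,
    integral_congr_ae (ae_restrict_of_ae hd.2.1)]
  simp

theorem integrable_pointKernel {Ω : Type*} [MeasurableSpace Ω] {P : Measure Ω}
    [IsProbabilityMeasure P] {ξ : ℕ → Ω → S} (hξ : ∀ i, Measurable (ξ i)) (hind : iIndepFun ξ P)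
    (hid : ∀ i, IdentDistrib (ξ i) (ξ 0) P P) [TopologicalSpace.SeparableSpace B]
    (hh : Measurable h) (hi : Integrable (fun ω => h (initial ξ m ω)) P) :
    Integrable (pointKernel h) (jointLaw (P.map (ξ 0)) (Measure.dirac PUnit.unit)
      (Measure.dirac PUnit.unit) m) := by
  have hμ := Measure.isProbabilityMeasure_map (μ := P) (hξ 0).aemeasurable
  have hhs : StronglyMeasurable h := hh.stronglyMeasurable
  refine (measurePreserving_pointKernel (P.map (ξ 0))).integrable_comp_of_integrable ?_
  exact ((measurePreserving_initial hξ hind hid).integrable_comp hhs.aestronglyMeasurable).1 hi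

end PointKernel

end UStat

/-! ### Reduction of the weighted series to dyadic blocks -/

namespace UStat

section Estimates

/-- Induction from `m * (n + 1) ≤ (m + 1) * n` and the absorption identity for binomial
coefficients. -/
theorem pow_le_pow_mul_choose {m n : ℕ} (h : m ≤ n) : n ^ m ≤ m ^ m * n.choose m := by
  induction m generalizing n with
  | zero => simp
  | succ m ih =>
    obtain ⟨n, rfl⟩ : ∃ k, n = k + 1 := ⟨n - 1, by omega⟩
    have hmn : m ≤ n := by omega
    have hpos : 0 < m ^ m := Nat.pow_self_pos
    have h1 : (n + 1) ^ m ≤ (m + 1) ^ m * n.choose m := by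
      refine Nat.le_of_mul_le_mul_left ?_ hpos
      calc m ^ m * (n + 1) ^ m = (m * (n + 1)) ^ m := (mul_pow _ _ _).symm
        _ ≤ ((m + 1) * n) ^ m := Nat.pow_le_pow_left (by nlinarith) m
        _ = (m + 1) ^ m * n ^ m := mul_pow _ _ _
        _ ≤ (m + 1) ^ m * (m ^ m * n.choose m) := Nat.mul_le_mul_left _ (ih hmn)
        _ = m ^ m * ((m + 1) ^ m * n.choose m) := by ring
    calc (n + 1) ^ (m + 1) = (n + 1) * (n + 1) ^ m := by ring
      _ ≤ (n + 1) * ((m + 1) ^ m * n.choose m) := Nat.mul_le_mul_left _ h1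
      _ = (m + 1) ^ m * ((n + 1) * n.choose m) := by ring
      _ = (m + 1) ^ (m + 1) * (n + 1).choose (m + 1) := by
          rw [Nat.add_one_mul_choose_eq]; ring

theorem exists_sum_rpow_le {γ : ℝ} (hγ : -1 < γ) :
    ∃ K : ℝ, 0 < K ∧ ∀ M : ℕ, ∑ N ∈ Finset.range M, ((N + 1 : ℕ) : ℝ) ^ γ ≤ K * (M : ℝ) ^ (γ + 1) := by
  have hp : 0 < γ + 1 := by linarith
  rcases le_or_gt 0 γ with h | h
  · refine ⟨1, one_pos, fun M => ?_⟩
    calc ∑ N ∈ Finset.range M, ((N + 1 : ℕ) : ℝ) ^ γ ≤ ∑ N ∈ Finset.range M, (M : ℝ) ^ γ := by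
          refine Finset.sum_le_sum fun N hN => ?_
          have : N + 1 ≤ M := Finset.mem_range.1 hN
          gcongr
      _ = M * (M : ℝ) ^ γ := by simp
      _ ≤ 1 * (M : ℝ) ^ (γ + 1) := by
          rw [Real.rpow_add_one' (by positivity) hp.ne', one_mul, mul_comm]
  · refine ⟨1 / (γ + 1), by positivity, fun M => ?_⟩
    induction M with
    | zero => simp [Real.zero_rpow hp.ne']
    | succ M ih =>
      rw [Finset.sum_range_succ]
      have hM : (0 : ℝ) < M + 1 := by positivity
      have hs : (-1 : ℝ) ≤ -1 / (M + 1) := by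
        rw [le_div_iff₀ hM]
        linarith [(Nat.cast_nonneg M : (0 : ℝ) ≤ M)]
      have hB := rpow_one_add_le_one_add_mul_self hs hp.le (by linarith)
      have h1 : (M : ℝ) = (M + 1) * (1 + -1 / (M + 1)) := by field_simp; ring
      -- Bernoulli's inequality for the exponent `γ + 1`, which lies in `(0, 1)`, gives the
      -- telescoping bound usually read off from an integral.
      have h2 : (M : ℝ) ^ (γ + 1) ≤ (M + 1 : ℝ) ^ (γ + 1) - (γ + 1) * (M + 1 : ℝ) ^ γ := by
        conv_lhs => rw [h1]
        rw [Real.mul_rpow hM.le (by linarith)]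
        calc (M + 1 : ℝ) ^ (γ + 1) * (1 + -1 / (M + 1)) ^ (γ + 1)
            ≤ (M + 1 : ℝ) ^ (γ + 1) * (1 + (γ + 1) * (-1 / (M + 1))) := by gcongr
          _ = _ := by
              rw [Real.rpow_add_one hM.ne']
              field_simp
              ring
      push_cast
      calc _ ≤ 1 / (γ + 1) * (M : ℝ) ^ (γ + 1) + (M + 1 : ℝ) ^ γ := by push_cast at ih; linarith
        _ ≤ 1 / (γ + 1) * ((M + 1 : ℝ) ^ (γ + 1) - (γ + 1) * (M + 1 : ℝ) ^ γ) + (M + 1 : ℝ) ^ γ := by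
            gcongr
        _ = _ := by field_simp; ring

end Estimates

section Dyadic

variable {Ω S B : Type*} [NormedAddCommGroup B] {ξ : ℕ → Ω → S} {m : ℕ} {h : (Fin m → S) → B}

/-- Reversal matches increasing with decreasing tuples, and symmetry of the kernel makes the order
of its arguments irrelevant. -/
theorem uStat_eq_usum (hs : IsSymmKernel h) (n : ℕ) (ω : Ω) :
    uStat ξ h n ω = usum h n fun i => ξ i ω := by
  unfold uStat usum
  refine Finset.sum_bij (fun i _ l => (i (Fin.rev l) : ℕ)) ?_ ?_ ?_ ?_
  · intro i hi
    have hi' : StrictMono i := by simpa [incIndices] using hi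
    exact mem_decIdx.2 ⟨fun l => (i _).2, fun a b hab => hi' (Fin.rev_lt_rev.2 hab)⟩
  · intro i _ i' _ hii'
    ext l
    simpa using congrFun hii' (Fin.rev l)
  · intro I hI
    rw [mem_decIdx] at hI
    refine ⟨fun l => ⟨I (Fin.rev l), hI.1 _⟩, ?_, ?_⟩
    · simp only [incIndices, Finset.mem_filter, Finset.mem_univ, true_and]
      exact fun a b hab => hI.2 (Fin.rev_lt_rev.2 hab)
    · ext l
      simp
  · intro i _
    exact (hs Fin.revPerm fun l => ξ (i l) ω).symm

/-- The block is chosen with `n < 2 ^ c ≤ 2 * n`. The bound `n ^ m ≤ m ^ m * n.choose m` and this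
factor two account for the constants in the level. -/
theorem exists_dyadic_of_lt_iSup {α ε : ℝ} (hαm : α ≤ m) (hε : 0 < ε) {N : ℕ} {ω : Ω}
    (hω : ENNReal.ofReal ε < ⨆ n : ℕ, ⨆ _ : max (N + 1) m ≤ n,
      ENNReal.ofReal ((n : ℝ) ^ α * (1 / (n.choose m : ℝ)) * ‖uStat ξ h n ω‖)) :
    ∃ c : ℕ, N + 1 < 2 ^ c ∧ ∃ n ≤ 2 ^ c,
      ENNReal.ofReal (ε / ((m : ℝ) ^ m * 2 ^ (m - α)) * 2 ^ (c * (m - α))) < ‖uStat ξ h n ω‖ₑ := by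
  simp only [lt_iSup_iff] at hω
  obtain ⟨n, hn, hlt⟩ := hω
  have hn1 : N + 1 ≤ n := (le_max_left _ _).trans hn
  have hnm : m ≤ n := (le_max_right _ _).trans hn
  have hn0 : n ≠ 0 := by omega
  have hnpos : (0 : ℝ) < n := by exact_mod_cast Nat.pos_of_ne_zero hn0
  have hlt' := (ENNReal.ofReal_lt_ofReal_iff_of_nonneg hε.le).1 hlt
  have hpow : n < 2 ^ (Nat.log 2 n + 1) := Nat.lt_pow_succ_log_self (by norm_num) n
  refine ⟨Nat.log 2 n + 1, by omega, n, hpow.le, ?_⟩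
  rw [← ofReal_norm, ENNReal.ofReal_lt_ofReal_iff_of_nonneg (by positivity)]
  have hch : (0 : ℝ) < n.choose m := by exact_mod_cast Nat.choose_pos hnm
  have hmm : (0 : ℝ) < (m : ℝ) ^ m := by exact_mod_cast Nat.pow_self_pos
  have hchoose : (n : ℝ) ^ m ≤ (m : ℝ) ^ m * n.choose m := by
    exact_mod_cast pow_le_pow_mul_choose hnm
  have h1 : ε * (n : ℝ) ^ ((m : ℝ) - α) < (m : ℝ) ^ m * ‖uStat ξ h n ω‖ := by
    rw [Real.rpow_sub hnpos, Real.rpow_natCast]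
    have hα : (0 : ℝ) < (n : ℝ) ^ α := by positivity
    calc ε * ((n : ℝ) ^ m / (n : ℝ) ^ α)
        < ((n : ℝ) ^ α * (1 / (n.choose m : ℝ)) * ‖uStat ξ h n ω‖) *
          ((n : ℝ) ^ m / (n : ℝ) ^ α) := by gcongr
      _ = ((n : ℝ) ^ m / n.choose m) * ‖uStat ξ h n ω‖ := by field_simp
      _ ≤ (m : ℝ) ^ m * ‖uStat ξ h n ω‖ := by
          gcongr
          rwa [div_le_iff₀ hch]
  have h2 : (2 : ℝ) ^ (((Nat.log 2 n + 1 : ℕ) : ℝ) * (m - α)) ≤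
      2 ^ ((m : ℝ) - α) * (n : ℝ) ^ ((m : ℝ) - α) := by
    have h3 : ((2 : ℝ) ^ Nat.log 2 n) ≤ n := by exact_mod_cast Nat.pow_log_le_self 2 hn0
    push_cast
    rw [add_mul, one_mul, Real.rpow_add two_pos, mul_comm, Real.rpow_mul two_pos.le,
      Real.rpow_natCast]
    have : 0 ≤ (m : ℝ) - α := by linarith
    gcongr
  have h2p : (0 : ℝ) < 2 ^ ((m : ℝ) - α) := by positivity
  calc ε / ((m : ℝ) ^ m * 2 ^ ((m : ℝ) - α)) * 2 ^ (((Nat.log 2 n + 1 : ℕ) : ℝ) * (m - α))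
      ≤ ε / ((m : ℝ) ^ m * 2 ^ ((m : ℝ) - α)) *
        (2 ^ ((m : ℝ) - α) * (n : ℝ) ^ ((m : ℝ) - α)) := by gcongr
    _ = (ε * (n : ℝ) ^ ((m : ℝ) - α)) / (m : ℝ) ^ m := by field_simp
    _ < ‖uStat ξ h n ω‖ := by
        rw [div_lt_iff₀ hmm]
        linarith

/-- A weighted series of tails is dominated by the series over dyadic blocks. -/
theorem tsum_weight_le_dyadic {γ : ℝ} (hγ : -1 < γ) :
    ∃ K : ℝ, 0 < K ∧ ∀ p t : ℕ → ℝ≥0∞,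
      (∀ N, p N ≤ ∑' c : ℕ, if N + 1 < 2 ^ c then t c else 0) →
      ∑' N : ℕ, ENNReal.ofReal (((N + 1 : ℕ) : ℝ) ^ γ) * p N ≤
        ENNReal.ofReal K * ∑' c : ℕ, ENNReal.ofReal (2 ^ (c * (γ + 1))) * t c := by
  obtain ⟨K, hK, hsum⟩ := exists_sum_rpow_le hγ
  refine ⟨K, hK, fun p t hp => ?_⟩
  calc ∑' N : ℕ, ENNReal.ofReal (((N + 1 : ℕ) : ℝ) ^ γ) * p N
      ≤ ∑' N : ℕ, ∑' c : ℕ, ENNReal.ofReal (((N + 1 : ℕ) : ℝ) ^ γ) *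
          (if N + 1 < 2 ^ c then t c else 0) := by
        refine ENNReal.tsum_le_tsum fun N => ?_
        rw [ENNReal.tsum_mul_left]
        gcongr
        exact hp N
    _ = ∑' c : ℕ, ∑' N : ℕ, ENNReal.ofReal (((N + 1 : ℕ) : ℝ) ^ γ) *
          (if N + 1 < 2 ^ c then t c else 0) := ENNReal.tsum_comm
    _ ≤ ∑' c : ℕ, ENNReal.ofReal K * (ENNReal.ofReal (2 ^ (c * (γ + 1))) * t c) := by
        refine ENNReal.tsum_le_tsum fun c => ?_
        rw [tsum_eq_sum (s := Finset.range (2 ^ c)) fun N hN => by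
          rw [if_neg, mul_zero]
          simp only [Finset.mem_range] at hN
          omega]
        calc ∑ N ∈ Finset.range (2 ^ c), ENNReal.ofReal (((N + 1 : ℕ) : ℝ) ^ γ) *
              (if N + 1 < 2 ^ c then t c else 0)
            ≤ ∑ N ∈ Finset.range (2 ^ c), ENNReal.ofReal (((N + 1 : ℕ) : ℝ) ^ γ) * t c := by
              refine Finset.sum_le_sum fun N _ => ?_
              gcongr
              split_ifs <;> simp
          _ = ENNReal.ofReal (∑ N ∈ Finset.range (2 ^ c), ((N + 1 : ℕ) : ℝ) ^ γ) * t c := by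
              rw [← Finset.sum_mul, ENNReal.ofReal_sum_of_nonneg fun _ _ => by positivity]
          _ ≤ ENNReal.ofReal (K * 2 ^ (c * (γ + 1))) * t c := by
              gcongr
              have := hsum (2 ^ c)
              rwa [Nat.cast_pow, Nat.cast_ofNat, ← Real.rpow_natCast,
                ← Real.rpow_mul two_pos.le] at this
          _ = _ := by rw [ENNReal.ofReal_mul hK.le, mul_assoc]
    _ = _ := ENNReal.tsum_mul_left

end Dyadic

section Reduction

universe u v w

variable {Ω : Type w} {S : Type u} {B : Type v} [MeasurableSpace Ω] [MeasurableSpace S]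
  [NormedAddCommGroup B] [NormedSpace ℝ B] [TopologicalSpace.SeparableSpace B]
  [MeasurableSpace B] [BorelSpace B]
  {P : Measure Ω} [IsProbabilityMeasure P] {ξ : ℕ → Ω → S} {m : ℕ} {h : (Fin m → S) → B}

theorem measure_uStat_eq_uTail (hξ : ∀ i, Measurable (ξ i)) (hind : iIndepFun ξ P)
    (hid : ∀ i, IdentDistrib (ξ i) (ξ 0) P P) (hh : Measurable h) (hs : IsSymmKernel h) {r : ℝ}
    (hr : 0 < r) (M : ℕ) (t : ℝ) :
    P {ω | ∃ n ≤ M, ENNReal.ofReal t < ‖uStat ξ h n ω‖ₑ} =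
      uTail r (P.map (ξ 0)) (Measure.dirac PUnit.unit) (Measure.dirac PUnit.unit)
        (pointKernel h) M t := by
  have := Measure.isProbabilityMeasure_map (μ := P) (hξ 0).aemeasurable
  have hm : MeasurableSet {x : ℕ → S | ∃ n ≤ M, ENNReal.ofReal t < ‖usum h n x‖ₑ} := by
    have : {x : ℕ → S | ∃ n ≤ M, ENNReal.ofReal t < ‖usum h n x‖ₑ} =
        ⋃ n ∈ Finset.range (M + 1), {x | ENNReal.ofReal t < ‖usum h n x‖ₑ} := by
      ext x; simp
    rw [this]
    refine Finset.measurableSet_biUnion _ fun n _ => measurableSet_lt measurable_const ?_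
    have : Measurable fun x : ℕ → S => usum h n x :=
      measurable_usum (g := fun _ => h) (e := fun x => x) (by fun_prop) measurable_id n
    exact this.enorm
  have hN : ∀ n p, uNorm r (Measure.dirac PUnit.unit) (pointKernel.{u} h) n p =
      ‖usum h n p.2‖ₑ := by
    intro n p
    simp [uNorm, pointKernel, eLpNorm'_const _ hr]
  have h1 := (measurePreserving_seq hξ hind hid).measure_preimage hm.nullMeasurableSet
  have h2 := (measurePreserving_snd (μ := Measure.dirac PUnit.unit.{u + 1})
    (ν := seqLaw (P.map (ξ 0)))).measure_preimage hm.nullMeasurableSet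
  simp only [uTail, hN, uStat_eq_usum hs]
  exact h1.trans h2.symm

theorem uTail_le_uSeries (r η : ℝ) {F Y : Type*} [MeasurableSpace F] [MeasurableSpace Y]
    (μ : Measure S) (φ : Measure F) (ν : Measure Y) (g : F × Y × (Fin m → S) → B) (N : ℕ) (t : ℝ) :
    uTail r μ φ ν g N t ≤ uSeries r η μ φ ν g N t := by
  have := ENNReal.le_tsum (f := fun l : ℕ => ENNReal.ofReal (η ^ l) *
    uTail r μ φ ν g N (t / 2 ^ l)) 0
  simpa [uSeries] using this

/-- The weights of all `N < 2 ^ c` add up to order `2 ^ (c * (γ + 1))`. Only the term `l = 0` of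
each series of tails is needed, so `K` and `δ` do not depend on `η`, which is chosen later. -/
theorem exists_tsum_le_uSum (hξ : ∀ i, Measurable (ξ i)) (hind : iIndepFun ξ P)
    (hid : ∀ i, IdentDistrib (ξ i) (ξ 0) P P) (hh : Measurable h) (hs : IsSymmKernel h)
    {r α γ ε : ℝ} (hr : 0 < r) (hαm : α ≤ m) (hγ : -1 < γ) (hε : 0 < ε) :
    ∃ K δ : ℝ, 0 < δ ∧ ∀ η : ℝ, ∑' N : ℕ, ENNReal.ofReal (((N + 1 : ℕ) : ℝ) ^ γ) *
      P {ω | ENNReal.ofReal ε < ⨆ n : ℕ, ⨆ _ : max (N + 1) m ≤ n,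
          ENNReal.ofReal ((n : ℝ) ^ α * (1 / (n.choose m : ℝ)) * ‖uStat ξ h n ω‖)} ≤
      ENNReal.ofReal K * uSum r η (P.map (ξ 0)) (Measure.dirac PUnit.unit)
        (Measure.dirac PUnit.unit) (γ + 1) (m - α) (pointKernel h) δ := by
  obtain ⟨K, hK, hsum⟩ := tsum_weight_le_dyadic hγ
  have hmm : (0 : ℝ) < (m : ℝ) ^ m := by exact_mod_cast Nat.pow_self_pos
  set δ : ℝ := ε / ((m : ℝ) ^ m * 2 ^ ((m : ℝ) - α)) with hδ
  refine ⟨K, δ, by positivity, fun η => ?_⟩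
  refine (hsum _ (fun c => P {ω | ∃ n ≤ 2 ^ c,
    ENNReal.ofReal (δ * 2 ^ (c * ((m : ℝ) - α))) < ‖uStat ξ h n ω‖ₑ}) fun N => ?_).trans ?_
  · calc P {ω | ENNReal.ofReal ε < ⨆ n : ℕ, ⨆ _ : max (N + 1) m ≤ n,
          ENNReal.ofReal ((n : ℝ) ^ α * (1 / (n.choose m : ℝ)) * ‖uStat ξ h n ω‖)}
        ≤ P (⋃ c : ℕ, {ω | N + 1 < 2 ^ c ∧ ∃ n ≤ 2 ^ c,
          ENNReal.ofReal (δ * 2 ^ (c * ((m : ℝ) - α))) < ‖uStat ξ h n ω‖ₑ}) := by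
          refine measure_mono fun ω hω => Set.mem_iUnion.2 ?_
          exact exists_dyadic_of_lt_iSup hαm hε hω
      _ ≤ _ := by
          refine (measure_iUnion_le _).trans (ENNReal.tsum_le_tsum fun c => ?_)
          split_ifs with hc <;> simp [hc]
  · unfold uSum
    gcongr with c
    rw [measure_uStat_eq_uTail hξ hind hid hh hs hr]
    exact uTail_le_uSeries _ _ _ _ _ _ _ _

end Reduction

/-! ### The moment exponents satisfy the recursion's requirements -/

section Exponents

variable {α γ r : ℝ} {m d : ℕ}

/-- For `j + a + c = m` one has `m - α - a / r - c = (a + j) * (r - 1) / r + j / r - α`. Since `a +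
j ≥ max d j`, this is at least the denominator of the exponent, and that denominator is positive
because `α < (r - 1) * d / r`. -/
theorem exponentCond_momentExponent (hr : 1 < r) (hαd : α < (r - 1) * d / r) (hγ : -1 < γ) :
    ExponentCond r m d (γ + 1) (m - α) fun j => momentExponent α d j γ r := by
  intro j a c hm he
  have hr0 : 0 < r := by linarith
  have hs : 0 < (r - 1) / r := div_pos (by linarith) hr0
  have hden : 0 < (max d j : ℕ) * ((r - 1) / r) - α + j / r := by
    have h1 : (d : ℝ) * ((r - 1) / r) ≤ (max d j : ℕ) * ((r - 1) / r) := by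
      gcongr
      exact le_max_left _ _
    have h2 : (r - 1) * d / r = d * ((r - 1) / r) := by ring
    have h3 : (0 : ℝ) ≤ j / r := by positivity
    linarith
  have hle : (max d j : ℕ) * ((r - 1) / r) - α + j / r ≤ m - α - a / r - c := by
    have h1 : ((max d j : ℕ) : ℝ) * ((r - 1) / r) ≤ (a + j : ℕ) * ((r - 1) / r) := by
      gcongr
      exact max_le he (by omega)
    have h2 : (m : ℝ) = j + a + c := by exact_mod_cast hm.symm
    have h3 : ((a + j : ℕ) : ℝ) * ((r - 1) / r) = a + j - a / r - j / r := by
      push_cast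
      field_simp
      ring
    linarith
  refine ⟨hden.trans_le hle, ?_⟩
  unfold momentExponent
  rw [div_mul_eq_mul_div, le_div_iff₀ hden]
  have : 0 ≤ γ + j + 1 := by linarith [(Nat.cast_nonneg j : (0 : ℝ) ≤ j)]
  calc (γ + 1 + j) * ((max d j : ℕ) * ((r - 1) / r) - α + j / r)
      = (γ + j + 1) * ((max d j : ℕ) * ((r - 1) / r) - α + j / r) := by ring
    _ ≤ _ := by gcongr

theorem momentExponent_pos (hr : 1 < r) (hαd : α < (r - 1) * d / r) (hγ : -1 < γ) (j : ℕ) :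
    0 < momentExponent α d j γ r := by
  have hE := exponentCond_momentExponent (m := max d j) hr hαd hγ j (max d j - j) 0 (by omega)
    (by omega)
  have h1 : 0 < γ + 1 + j := by linarith [(Nat.cast_nonneg j : (0 : ℝ) ≤ j)]
  exact pos_of_mul_pos_left (h1.trans_le hE.2) hE.1.le

end Exponents

end UStat

/-! ### Assembly -/

theorem mainTheorem6
    {Ω S B : Type*} [MeasurableSpace Ω] [MeasurableSpace S]
    [NormedAddCommGroup B] [NormedSpace ℝ B] [CompleteSpace B]
    [TopologicalSpace.SeparableSpace B] [MeasurableSpace B] [BorelSpace B]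
    (P : Measure Ω) [IsProbabilityMeasure P]
    (r : ℝ) (hB : UStat.IsSmoothSpace B r)
    (ξ : ℕ → Ω → S) (hξ_meas : ∀ i, Measurable (ξ i)) (hξ_indep : iIndepFun ξ P)
    (hξ_ident : ∀ i, IdentDistrib (ξ i) (ξ 0) P P)
    (m : ℕ) (hm : 2 ≤ m) (d : ℕ) (hd : 1 ≤ d) (hdm : d ≤ m)
    (h : (Fin m → S) → B) (hh_meas : Measurable h) (hh_symm : UStat.IsSymmKernel h)
    (hh_deg : UStat.IsDegenerateOfOrder P ξ h d)
    (α : ℝ) (hα : 0 < α) (hαd : α < (r - 1) * d / r)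
    (γ : ℝ) (hγ : -1 < γ)
    (hH : ∀ j : ℕ, 1 ≤ j → j ≤ m →
      MemLp (UStat.condMoment P ξ h r j)
        (ENNReal.ofReal (UStat.momentExponent α d j γ r)) P)
    (ε : ℝ) (hε : 0 < ε) :
    ∑' N : ℕ, ENNReal.ofReal (((N + 1 : ℕ) : ℝ) ^ γ) *
      P {ω | ENNReal.ofReal ε <
        ⨆ n : ℕ, ⨆ _ : max (N + 1) m ≤ n,
          ENNReal.ofReal ((n : ℝ) ^ α * (1 / (n.choose m : ℝ)) * ‖UStat.uStat ξ h n ω‖)}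
      < ⊤ := by
  have hr1 : 1 < r := hB.1
  have hr0 : 0 < r := by linarith
  have hμ := Measure.isProbabilityMeasure_map (μ := P) (hξ_meas 0).aemeasurable
  obtain ⟨C, hC0, hC⟩ := hB.exists_isMartingaleConst (P.map (ξ 0))
  have hE := UStat.exponentCond_momentExponent (m := m) hr1 hαd hγ
  have hq := UStat.momentExponent_pos hr1 hαd hγ
  have hαm : α ≤ m := by
    have h1 : (r - 1) * d / r ≤ d := by
      rw [div_le_iff₀ hr0]
      nlinarith [(Nat.cast_nonneg d : (0 : ℝ) ≤ d)]
    have h2 : (d : ℝ) ≤ m := by exact_mod_cast hdm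
    linarith
  have hgm : Measurable (UStat.pointKernel h) := by unfold UStat.pointKernel; fun_prop
  have hgi := UStat.integrable_pointKernel hξ_meas hξ_indep hξ_ident hh_meas hh_deg.1
  have hD := UStat.degenerateCond_pointKernel hξ_meas hξ_indep hξ_ident hh_meas hh_symm hh_deg
  have hM : ∀ J : Finset (Fin m), J.Nonempty → UStat.MomentCond r (P.map (ξ 0))
      (Measure.dirac PUnit.unit) (Measure.dirac PUnit.unit)
      (fun j => UStat.momentExponent α d j γ r) (UStat.pointKernel h) J := by
    intro J hJ
    have hJm : J.card ≤ m := (Finset.card_le_univ J).trans (by simp)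
    refine UStat.momentCond_pointKernel ?_
    rw [UStat.lintegral_frozenMoment_perm r _ hh_meas hh_symm]
    exact UStat.lintegral_frozenMoment_lt_top hξ_meas hξ_indep hξ_ident hh_meas (hq _) hJm
      (hH _ hJ.card_pos hJm)
  obtain ⟨K, δ, hδ, hK⟩ := UStat.exists_tsum_le_uSum hξ_meas hξ_indep hξ_ident hh_meas hh_symm
    hr0 hαm hγ hε
  suffices hη : ∃ η : ℝ, UStat.uSum r η (P.map (ξ 0)) (Measure.dirac PUnit.unit)
      (Measure.dirac PUnit.unit) (γ + 1) (m - α) (UStat.pointKernel h) δ < ∞ by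
    obtain ⟨η, hη⟩ := hη
    exact (hK η).trans_lt (ENNReal.mul_lt_top ENNReal.ofReal_lt_top hη)
  -- The empty set of frozen variables needs `‖h‖ ^ r` integrable. This follows from `H_{1,r}` when
  -- `q_1 ≥ r`; otherwise the truncation argument is used.
  rcases le_or_gt r (UStat.momentExponent α d 1 γ r) with hqr | hqr
  · have hevq : ∀ᶠ η in nhdsWithin (0 : ℝ) (Set.Ioi 0), ∀ j ∈ Finset.range (m + 1),
        η * 2 ^ UStat.momentExponent α d j γ r < 1 := by
      rw [Finset.eventually_all]
      exact fun j _ => UStat.eventually_mul_lt_one _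
    obtain ⟨η, ⟨hηq, hη1⟩, hη⟩ :=
      ((hevq.and (UStat.eventually_mul_lt_one 1)).and self_mem_nhdsWithin).exists
    refine ⟨η, UStat.uSum_lt_top_of_moments hr1 hC0 hC hη (by simpa using hη1) m _ _ hgm hgi
      (by linarith) (fun j _ => (hq j).le)
      (fun j hj => hηq j (Finset.mem_range.2 (Nat.lt_succ_of_le hj))) hE (fun _ J => ?_) hD hδ⟩
    rcases J.eq_empty_or_nonempty with rfl | hJ
    · exact UStat.momentCond_pointKernel_empty hr0 (hq 0).le
        (UStat.lintegral_enorm_rpow_lt_top hξ_meas hξ_indep hξ_ident hh_meas hr0 hqr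
          (by omega) (hH 1 le_rfl (by omega)))
    · exact hM J hJ
  · obtain ⟨k, rfl⟩ : ∃ k, m = k + 1 := ⟨m - 1, by omega⟩
    obtain ⟨η, hη⟩ := (UStat.eventually_uSum_lt_top hr1 hC0 hC k (e := d) (ρ := γ + 1)
      (τ := (k + 1 : ℕ) - α) (by linarith) (fun j => (hq j).le) (hq 1) hqr
      (fun j a c hk he => ⟨(hE j a c hk he).1, fun _ => (hE j a c hk he).2⟩)).exists
    exact ⟨η, hη _ _ hgm hgi (fun _ => hM) hD hδ⟩
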